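/- **BY forests.** A BY forest $T=(T,S,\epsilon F)$ consists of a finite graph-theoretic forest $T$ with a positive integer length $l(e)$ attached to each edge $e$, a subgraph $S\subseteq T$, an isometric graph automorphism $F$ of $T$ with $F(S)=S$, and a sign function $\epsilon\colon\pi_0(T\setminus S)\to\{\pm1\}$, where $T\setminus S$ is the complement of $S$ in the topological space underlying $T$. It satisfies *parity condition (B)* if no iterate of $F$ inverts (i.e. interchanges the two endpoints of) an edge of $T$ of odd length. Let $\Lambda=\mathrm H_1(T,S,\mathbb Z)$ be the relative homology lattice, with the intersection length pairing, i.e. the restriction of the pairing $\langle\gamma,\gamma'\rangle=\sum_e l(e)\gamma(e)\gamma'(e)$ on $1$-chains, the sum being over the edges of $T$ not in $S$. The signed automorphism $\epsilon F$ acts isometrically on $\Lambda$, sending the class of a path $\gamma$ in the closure of a component $C$ of $T\setminus S$ to $\epsilon(C)[F\gamma]$, and hence acts on $\Lambda^\vee=\mathrm{Hom}(\Lambda,\mathbb Z)$ (by $\varphi\mapsto\varphi\circ(\epsilon F)^{-1}$) and on the *geometric Néron component group* $\bar\Phi_T=\Lambda^\vee/\Lambda$, the cokernel of the map $\Lambda\to\Lambda^\vee$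 induced by the pairing. **Fixpoint-regularity.** For an abelian group $A$ with an endomorphism $\sigma$ and an integer $d\ge1$ put $$\mathrm{Gr}^\sigma_d(A)=A^{\sigma^d}\Big/\sum_{c\mid d,\ c\neq d}A^{\sigma^c},\qquad A^{\sigma^c}=\{a\in A:\sigma^c a=a\}.$$ We say that $A$ is *fixpoint-regular* for $\sigma$ if for every $d\ge1$ there is an abelian group $A_d$ such that $\mathrm{Gr}^\sigma_d(A)\cong A_d\otimes_{\mathbb Z}\mathbb Z[\mu_d]$ as $\mathbb Z[\mu_d]$-modules, where on the left a primitive $d$-th root of unity $\zeta_d\in\mathbb Z[\mu_d]$ acts as $\sigma$ (that this gives a $\mathbb Z[\mu_d]$-module structure on $\mathrm{Gr}^\sigma_d(A)$ is part of the assertion). **Theorem.** Let $T=(T,S,\epsilon F)$ be a BY forest satisfying parity condition (B). Then the geometric Néron component group $\bar\Phi_T=\Lambda^\vee/\Lambda$ is fixpoint-regular for the action of $\epsilon F$. -/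

import Mathlib

open scoped TensorProduct

universe u

noncomputable section

namespace BYTheory

/-! ## Fixpoint filtrations -/

section Fixpoints

variable {A : Type u} [AddCommGroup A]

/-- The subgroup `A^{σ^f}` of points of `A` fixed by `σ^f`. -/
def fixedBy (σ : Module.End ℤ A) (f : ℕ) : Submodule ℤ A :=
  LinearMap.eqLocus (σ ^ f) LinearMap.id

theorem mem_fixedBy {σ : Module.End ℤ A} {f : ℕ} {a : A} :
    a ∈ fixedBy σ f ↔ (σ ^ f) a = a := Iff.rfl

theorem map_mem_fixedBy {σ : Module.End ℤ A} {f : ℕ} {a : A} (ha : a ∈ fixedBy σ f) :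
    σ a ∈ fixedBy σ f := by
  rw [mem_fixedBy] at *
  have h : (σ ^ f) (σ a) = σ ((σ ^ f) a) := by
    rw [← Module.End.mul_apply, ← Module.End.mul_apply, pow_mul_comm']
  rw [h, ha]

/-- The sum `∑ A^{σ^d}` over the divisors `d ∣ f` with `d ≠ f`. -/
def lowerFixed (σ : Module.End ℤ A) (f : ℕ) : Submodule ℤ A :=
  ⨆ d ∈ f.properDivisors, fixedBy σ d

theorem map_mem_lowerFixed {σ : Module.End ℤ A} {f : ℕ} {a : A} (ha : a ∈ lowerFixed σ f) :
    σ a ∈ lowerFixed σ f := by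
  have h : lowerFixed σ f ≤ (lowerFixed σ f).comap σ := by
    refine iSup₂_le fun d hd x hx => ?_
    exact (le_iSup₂_of_le (f := fun d (_ : d ∈ f.properDivisors) => fixedBy σ d) d hd le_rfl)
      (map_mem_fixedBy hx)
  exact h ha

/-- The partial quotient `Gr_f^σ(A) = A^{σ^f} / ∑_{d ∣ f, d ≠ f} A^{σ^d}`. -/
abbrev Gr (σ : Module.End ℤ A) (f : ℕ) : Type u :=
  fixedBy σ f ⧸ (lowerFixed σ f).submoduleOf (fixedBy σ f)

/-- The endomorphism of `Gr_f^σ(A)` induced by `σ`. -/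
def grMap (σ : Module.End ℤ A) (f : ℕ) : Module.End ℤ (Gr σ f) :=
  Submodule.mapQ _ _ (σ.restrict fun _ hx => map_mem_fixedBy hx)
    (fun _ hx => map_mem_lowerFixed hx)

/-- The ring `ℤ[μ_d]`: the subring of the `d`-th cyclotomic field generated by the `d`-th roots
of unity. -/
abbrev ZMu (d : ℕ) : Type := CyclotomicRing d ℤ ℚ

/-- A primitive `d`-th root of unity in `ℤ[μ_d]`. -/
abbrev zetaMu (d : ℕ) [NeZero d] : ZMu d := IsCyclotomicExtension.zeta d ℤ (ZMu d)

/-- `A` is fixpoint-regular for `σ` if for every `d ≥ 1` there is an abelian group `B` such that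
`Gr_d^σ(A)`, viewed as the `ℤ[μ_d]`-module on which a primitive `d`-th root of unity acts as `σ`,
is isomorphic to the `ℤ[μ_d]`-module `ℤ[μ_d] ⊗_ℤ B`. As `ℤ[μ_d]` is generated as a ring by a
primitive `d`-th root of unity, there is at most one such module structure on `Gr_d^σ(A)`. -/
def IsFixpointRegular (σ : Module.End ℤ A) : Prop :=
  ∀ (d : ℕ) [NeZero d], ∃ (B : Type u) (_ : AddCommGroup B) (_ : Module (ZMu d) (Gr σ d)),
    (∀ x : Gr σ d, zetaMu d • x = grMap σ d x) ∧
      Nonempty (Gr σ d ≃ₗ[ZMu d] (ZMu d ⊗[ℤ] B))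

end Fixpoints

/-! ## BY forests -/

/-- A pair `(T, S)` of an integrally metrised graph-theoretic forest `T` with vertex set `V` and a
subgraph `S` of `T`. Only the values of `length` at the edges of `T` carry information. -/
structure ForestPair (V : Type u) where
  graph : SimpleGraph V
  isAcyclic : graph.IsAcyclic
  length : Sym2 V → ℕ
  length_pos : ∀ e ∈ graph.edgeSet, 0 < length e
  S : graph.Subgraph

namespace ForestPair

variable {V : Type u} (P : ForestPair V)

/-- `{u, v}` is an edge of `T` that does not lie in `S`. -/
def OffAdj (u v : V) : Prop := P.graph.Adj u v ∧ ¬ P.S.Adj u v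

variable {P} in
theorem OffAdj.symm {u v : V} (h : P.OffAdj u v) : P.OffAdj v u :=
  ⟨h.1.symm, fun h' => h.2 h'.symm⟩

/-- The cells making up the topological space `T ∖ S`: the vertices of `T` not in `S`, and the
(open) edges of `T` not in `S`. -/
abbrev Cell : Type u :=
  {v : V // v ∉ P.S.verts} ⊕ {e : Sym2 V // e ∈ P.graph.edgeSet ∧ e ∉ P.S.edgeSet}

/-- The incidence graph of the cells of `T ∖ S`: a vertex is joined to the edges it lies on. -/
def cellGraph : SimpleGraph P.Cell :=
  SimpleGraph.fromRel fun x y => ∃ v e, x = Sum.inl v ∧ y = Sum.inr e ∧ v.1 ∈ e.1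

/-- The set `π₀(T ∖ S)` of connected components of `T ∖ S`. An edge outside `S` with both endpoints
in `S` is a component by itself. -/
abbrev Components : Type u := P.cellGraph.ConnectedComponent

/-- The component of `T ∖ S` containing the (open) edge `{u, v}`. -/
def edgeComponent {u v : V} (h : P.OffAdj u v) : P.Components :=
  P.cellGraph.connectedComponentMk
    (Sum.inr ⟨s(u, v), P.graph.mem_edgeSet.2 h.1, fun h' => h.2 (P.S.mem_edgeSet.1 h')⟩)

theorem edgeComponent_symm {u v : V} (h : P.OffAdj u v) :
    P.edgeComponent h.symm = P.edgeComponent h := by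
  unfold edgeComponent
  congr 3
  exact Sym2.eq_swap

theorem edgeComponent_eq_vertex {u v : V} (h : P.OffAdj u v) (hv : v ∉ P.S.verts) :
    P.edgeComponent h = P.cellGraph.connectedComponentMk (Sum.inl ⟨v, hv⟩) := by
  refine SimpleGraph.ConnectedComponent.sound (SimpleGraph.Adj.reachable ?_)
  refine (SimpleGraph.fromRel_adj _ _ _).2 ⟨by simp, Or.inr ⟨_, _, rfl, rfl, ?_⟩⟩
  simp

section Homology

/-- The group `C₁(T, S) = C₁(T) / C₁(S)` of relative cellular `1`-chains: a chain is written as the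
function sending `(u, v)` to the coefficient of the edge oriented from `u` to `v`. -/
def chains : Submodule ℤ (V → V → ℤ) where
  carrier := {c | (∀ u v, c v u = -c u v) ∧ ∀ u v, ¬ P.OffAdj u v → c u v = 0}
  add_mem' {a b} ha hb :=
    ⟨fun u v => by simp only [Pi.add_apply, ha.1 u v, hb.1 u v]; ring,
      fun u v h => by simp only [Pi.add_apply, ha.2 u v h, hb.2 u v h]; ring⟩
  zero_mem' := ⟨fun _ _ => by simp, fun _ _ _ => rfl⟩
  smul_mem' n a ha :=
    ⟨fun u v => by simp only [Pi.smul_apply, smul_eq_mul, ha.1 u v]; ring,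
      fun u v h => by simp only [Pi.smul_apply, smul_eq_mul, ha.2 u v h]; ring⟩

/-- The product of the coefficients of an edge in two chains; it does not depend on the
orientation of the edge. -/
def edgeProd (c c' : P.chains) : Sym2 V → ℤ :=
  Sym2.lift ⟨fun u v => c.1 u v * c'.1 u v, fun u v => by
    simp only [c.2.1 u v, c'.2.1 u v]; ring⟩

@[simp] theorem edgeProd_mk (c c' : P.chains) (u v : V) :
    P.edgeProd c c' s(u, v) = c.1 u v * c'.1 u v := rfl

variable [Fintype V]

/-- The boundary map `C₁(T, S) → C₀(T, S)`, where `C₀(T, S) = C₀(T) / C₀(S)` is the free group on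
the vertices outside `S`; it sends the edge oriented from `u` to `v` to `v - u`. -/
def boundary : P.chains →ₗ[ℤ] ({v : V // v ∉ P.S.verts} → ℤ) where
  toFun c v := ∑ u, c.1 u v.1
  map_add' a b := by ext v; simp [Finset.sum_add_distrib]
  map_smul' n a := by ext v; simp [Finset.mul_sum]

/-- The relative homology lattice `Λ = H₁(T, S, ℤ)` (there are no `2`-cells). -/
abbrev Lattice : Type u := LinearMap.ker P.boundary

/-- The intersection length pairing `⟨γ, γ'⟩ = ∑_e l(e) γ(e) γ'(e)` on `C₁(T, S)`; the sum is over
the edges of `T` outside `S`, as all other terms vanish. -/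
def chainPairing : P.chains →ₗ[ℤ] P.chains →ₗ[ℤ] ℤ :=
  LinearMap.mk₂ ℤ (fun c c' => ∑ e : Sym2 V, (P.length e : ℤ) * P.edgeProd c c' e)
    (fun a b c => by
      rw [← Finset.sum_add_distrib]
      refine Finset.sum_congr rfl fun e _ => ?_
      induction e using Sym2.ind with | _ x y => simp; ring)
    (fun n a c => by
      rw [Finset.smul_sum]
      refine Finset.sum_congr rfl fun e _ => ?_
      induction e using Sym2.ind with | _ x y => simp; ring)
    (fun a b c => by
      rw [← Finset.sum_add_distrib]
      refine Finset.sum_congr rfl fun e _ => ?_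
      induction e using Sym2.ind with | _ x y => simp; ring)
    (fun n a c => by
      rw [Finset.smul_sum]
      refine Finset.sum_congr rfl fun e _ => ?_
      induction e using Sym2.ind with | _ x y => simp; ring)

/-- The map `Λ → Λ^∨ = Hom(Λ, ℤ)` induced by the intersection length pairing. -/
def toDual : P.Lattice →ₗ[ℤ] Module.Dual ℤ P.Lattice :=
  P.chainPairing.domRestrict₁₂ (LinearMap.ker P.boundary) (LinearMap.ker P.boundary)

theorem toDual_apply (a b : P.Lattice) :
    P.toDual a b = ∑ e : Sym2 V, (P.length e : ℤ) * P.edgeProd a.1 b.1 e := rfl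

/-- The geometric Néron component group `Λ^∨ / Λ`. -/
abbrev NeronGroup : Type u := Module.Dual ℤ P.Lattice ⧸ LinearMap.range P.toDual

end Homology

end ForestPair

/-- A BY forest `(T, S, εF)` with vertex set `V`: a pair `(T, S)` with an isometric automorphism `F`
of `T` that maps `S` onto itself, and a sign function `ε` on `π₀(T ∖ S)`. -/
structure BYForest (V : Type u) extends ForestPair V where
  F : graph ≃g graph
  length_map : ∀ u v, graph.Adj u v → length s(F u, F v) = length s(u, v)
  map_verts : ∀ v, F v ∈ S.verts ↔ v ∈ S.verts
  map_adj : ∀ u v, S.Adj (F u) (F v) ↔ S.Adj u v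
  sign : toForestPair.Components → ℤˣ

namespace BYForest

variable {V : Type u} (T : BYForest V)

/-- Parity condition (B): no iterate of `F` inverts an edge of odd length. -/
def ParityB : Prop :=
  ∀ (k : ℕ) (u v : V), T.graph.Adj u v → T.F^[k] u = v → T.F^[k] v = u → ¬ Odd (T.length s(u, v))

theorem offAdj_map (u v : V) : T.OffAdj (T.F u) (T.F v) ↔ T.OffAdj u v := by
  unfold ForestPair.OffAdj
  rw [T.F.map_adj_iff, T.map_adj]

open Classical in
/-- The sign of the component of `T ∖ S` containing the edge `{u, v}` (with the value `1` if `{u, v}`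
is not an edge outside `S`). -/
def edgeSign (u v : V) : ℤ :=
  if h : T.OffAdj u v then (T.sign (T.edgeComponent h) : ℤ) else 1

theorem edgeSign_mul_self (u v : V) : T.edgeSign u v * T.edgeSign u v = 1 := by
  unfold edgeSign
  split_ifs
  · rw [← Units.val_mul, Int.units_mul_self, Units.val_one]
  · rfl

theorem edgeSign_symm (u v : V) : T.edgeSign v u = T.edgeSign u v := by
  unfold edgeSign
  by_cases h : T.OffAdj u v
  · rw [dif_pos h, dif_pos h.symm, ForestPair.edgeComponent_symm]
  · rw [dif_neg h, dif_neg fun h' => h h'.symm]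

/-- The sign of the component of `T ∖ S` containing the vertex `v` outside `S`. -/
def vertexSign (v : {v : V // v ∉ T.S.verts}) : ℤ :=
  T.sign (T.cellGraph.connectedComponentMk (Sum.inl v))

theorem edgeSign_mul_chain (c : T.chains) (u : V) (v : {v : V // v ∉ T.S.verts}) :
    T.edgeSign u v.1 * c.1 u v.1 = T.vertexSign v * c.1 u v.1 := by
  by_cases h : T.OffAdj u v.1
  · unfold edgeSign vertexSign
    rw [dif_pos h, ForestPair.edgeComponent_eq_vertex _ h v.2]
  · rw [c.2.2 u v.1 h]; simp

/-- The action of `εF` on relative `1`-chains: the oriented edge `(u, v)` in the component `C` is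
sent to `ε(C) · (F u, F v)`. -/
def chainMap : T.chains →ₗ[ℤ] T.chains where
  toFun c := ⟨fun x y => T.edgeSign (T.F.symm x) (T.F.symm y) * c.1 (T.F.symm x) (T.F.symm y),
    fun x y => by
      simp only [T.edgeSign_symm (T.F.symm x), c.2.1 (T.F.symm x) (T.F.symm y)]; ring,
    fun x y h => by
      have h' : ¬ T.OffAdj (T.F.symm x) (T.F.symm y) := by
        rwa [← offAdj_map, T.F.apply_symm_apply, T.F.apply_symm_apply]
      simp only [c.2.2 _ _ h', mul_zero]⟩
  map_add' a b := by ext x y; simp; ring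
  map_smul' n a := by ext x y; simp; ring

/-- The inverse of `chainMap`. -/
def chainMapInv : T.chains →ₗ[ℤ] T.chains where
  toFun c := ⟨fun u v => T.edgeSign u v * c.1 (T.F u) (T.F v),
    fun x y => by simp only [T.edgeSign_symm x, c.2.1 (T.F x) (T.F y)]; ring,
    fun x y h => by
      have h' : ¬ T.OffAdj (T.F x) (T.F y) := by rwa [offAdj_map]
      simp only [c.2.2 _ _ h', mul_zero]⟩
  map_add' a b := by ext x y; simp; ring
  map_smul' n a := by ext x y; simp; ring

@[simp] theorem chainMap_apply (c : T.chains) (x y : V) :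
    (T.chainMap c).1 x y =
      T.edgeSign (T.F.symm x) (T.F.symm y) * c.1 (T.F.symm x) (T.F.symm y) := rfl

@[simp] theorem chainMapInv_apply (c : T.chains) (u v : V) :
    (T.chainMapInv c).1 u v = T.edgeSign u v * c.1 (T.F u) (T.F v) := rfl

theorem chainMap_chainMapInv (c : T.chains) : T.chainMap (T.chainMapInv c) = c := by
  ext x y
  simp [← mul_assoc, edgeSign_mul_self]

theorem chainMapInv_chainMap (c : T.chains) : T.chainMapInv (T.chainMap c) = c := by
  ext x y
  simp [← mul_assoc, edgeSign_mul_self]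

section Action

variable [Fintype V]

theorem chainMap_mem {c : T.chains} (hc : c ∈ LinearMap.ker T.boundary) :
    T.chainMap c ∈ LinearMap.ker T.boundary := by
  rw [LinearMap.mem_ker] at *
  ext y
  have hv : T.F.symm y.1 ∉ T.S.verts := by
    rw [← T.map_verts, T.F.apply_symm_apply]; exact y.2
  have h := congrFun hc ⟨T.F.symm y.1, hv⟩
  change ∑ x, T.edgeSign (T.F.symm x) (T.F.symm y.1) * c.1 (T.F.symm x) (T.F.symm y.1) = 0
  refine (Equiv.sum_comp T.F.symm.toEquiv
    (fun u => T.edgeSign u (T.F.symm y.1) * c.1 u (T.F.symm y.1))).trans ?_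
  rw [Finset.sum_congr rfl fun u _ => T.edgeSign_mul_chain c u ⟨T.F.symm y.1, hv⟩,
    ← Finset.mul_sum]
  change T.vertexSign _ * T.boundary c ⟨T.F.symm y.1, hv⟩ = 0
  rw [h]; simp

theorem chainMapInv_mem {c : T.chains} (hc : c ∈ LinearMap.ker T.boundary) :
    T.chainMapInv c ∈ LinearMap.ker T.boundary := by
  rw [LinearMap.mem_ker] at *
  ext v
  have hv : T.F v.1 ∉ T.S.verts := by rw [T.map_verts]; exact v.2
  have h := congrFun hc ⟨T.F v.1, hv⟩
  change ∑ u, (T.chainMapInv c).1 u v.1 = 0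
  have key : ∀ u, (T.chainMapInv c).1 u v.1 = T.vertexSign v * c.1 (T.F u) (T.F v.1) := by
    intro u
    have h1 := T.edgeSign_mul_chain (T.chainMapInv c) u v
    rw [chainMapInv_apply, ← mul_assoc, edgeSign_mul_self, one_mul] at h1
    rw [chainMapInv_apply]
    have h2 : T.vertexSign v * T.vertexSign v = 1 := by
      unfold vertexSign
      rw [← Units.val_mul, Int.units_mul_self, Units.val_one]
    calc T.edgeSign u v.1 * c.1 (T.F u) (T.F v.1)
        = T.vertexSign v * (T.vertexSign v * (T.edgeSign u v.1 * c.1 (T.F u) (T.F v.1))) := by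
          rw [← mul_assoc (T.vertexSign v), h2, one_mul]
      _ = T.vertexSign v * c.1 (T.F u) (T.F v.1) := by rw [← h1]
  rw [Finset.sum_congr rfl fun u _ => key u, ← Finset.mul_sum]
  have h3 : ∑ u, c.1 (T.F u) (T.F v.1) = 0 :=
    (Equiv.sum_comp T.F.toEquiv (fun x => c.1 x (T.F v.1))).trans h
  rw [h3, mul_zero]

/-- The automorphism `εF` of `Λ = H₁(T, S, ℤ)`. -/
def latticeEquiv : T.Lattice ≃ₗ[ℤ] T.Lattice :=
  LinearEquiv.ofLinearMap (T.chainMap.restrict fun _ hc => T.chainMap_mem hc)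
    (T.chainMapInv.restrict fun _ hc => T.chainMapInv_mem hc)
    (LinearMap.ext fun c => Subtype.ext (T.chainMap_chainMapInv c.1))
    (LinearMap.ext fun c => Subtype.ext (T.chainMapInv_chainMap c.1))

theorem toDual_latticeEquiv (a b : T.Lattice) :
    T.toDual (T.latticeEquiv a) (T.latticeEquiv b) = T.toDual a b := by
  rw [ForestPair.toDual_apply, ForestPair.toDual_apply,
    ← (Finite.injective_iff_bijective.1 (Sym2.map.injective T.F.injective)).sum_comp]
  refine Finset.sum_congr rfl fun e _ => ?_
  induction e using Sym2.ind with | _ u v => ?_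
  change (T.length s(T.F u, T.F v) : ℤ) *
    ((T.chainMap a.1).1 (T.F u) (T.F v) * (T.chainMap b.1).1 (T.F u) (T.F v)) =
    (T.length s(u, v) : ℤ) * (a.1.1 u v * b.1.1 u v)
  rw [chainMap_apply, chainMap_apply, T.F.symm_apply_apply, T.F.symm_apply_apply]
  by_cases h : T.OffAdj u v
  · rw [T.length_map u v h.1, mul_mul_mul_comm, edgeSign_mul_self, one_mul]
  · rw [a.1.2.2 u v h]; simp

/-- The automorphism of `Λ^∨` induced by `εF`, namely `φ ↦ φ ∘ (εF)⁻¹`. -/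
def dualEquiv : Module.Dual ℤ T.Lattice ≃ₗ[ℤ] Module.Dual ℤ T.Lattice :=
  T.latticeEquiv.symm.dualMap

theorem dualEquiv_toDual (a : T.Lattice) :
    T.dualEquiv (T.toDual a) = T.toDual (T.latticeEquiv a) := by
  ext b
  change T.toDual a (T.latticeEquiv.symm b) = _
  rw [← toDual_latticeEquiv, LinearEquiv.apply_symm_apply]

/-- The action of `εF` on the geometric Néron component group `Λ^∨ / Λ`. -/
def neronMap : Module.End ℤ T.NeronGroup :=
  Submodule.mapQ _ _ T.dualEquiv.toLinearMap <| by
    rintro _ ⟨a, rfl⟩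
    exact ⟨T.latticeEquiv a, (T.dualEquiv_toDual a).symm⟩

end Action

end BYForest

end BYTheory

end

noncomputable section

namespace BYTheory

open Polynomial

/-- The norm polynomial `(X ^ d - 1) / (X ^ (d / p) - 1)`, for a divisor `p` of `d`. -/
def normPoly (d p : ℕ) : ℤ[X] := ∑ i ∈ Finset.range p, (X ^ (d / p)) ^ i

theorem normPoly_mul {d p : ℕ} (hp : p ∣ d) : normPoly d p * (X ^ (d / p) - 1) = X ^ d - 1 := by
  rw [normPoly, geom_sum_mul, ← pow_mul, Nat.div_mul_cancel hp]

theorem normPoly_eq_prod {d p : ℕ} (hd : 0 < d) (hp : p ∣ d) :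
    normPoly d p = ∏ m ∈ d.divisors \ (d / p).divisors, cyclotomic m ℤ := by
  have h0 : (X ^ (d / p) - 1 : ℤ[X]) ≠ 0 :=
    X_pow_sub_C_ne_zero (Nat.div_pos (Nat.le_of_dvd hd hp) (Nat.pos_of_dvd_of_pos hp hd)) 1
  refine mul_right_cancel₀ h0 ?_
  rw [normPoly_mul hp, mul_comm,
    X_pow_sub_one_mul_prod_cyclotomic_eq_X_pow_sub_one_of_dvd ℤ (Nat.div_dvd_of_dvd hp) hd.ne']

theorem pow_eq_one_of_aeval_cyclotomic {k : Type*} [CommRing k] {x : k} {m : ℕ}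
    (h : aeval x (cyclotomic m ℤ) = 0) : x ^ m = 1 := by
  obtain ⟨q, hq⟩ := cyclotomic.dvd_X_pow_sub_one m ℤ
  have h2 := congrArg (aeval x) hq
  rw [map_mul, h, zero_mul] at h2
  simpa [sub_eq_zero] using h2

theorem pow_eq_one_of_pow_prime_pow {k : Type*} [Field k] {l : ℕ} (hl : l.Prime)
    (hk : (l : k) = 0) {x : k} {a m : ℕ} (h : x ^ (l ^ a * m) = 1) : x ^ m = 1 := by
  obtain ⟨q, hq⟩ := CharP.exists k
  have hql : q = l := by
    have h1 : q ∣ l := (CharP.cast_eq_zero_iff k q l).1 hk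
    rcases (Nat.dvd_prime hl).1 h1 with rfl | h2
    · exact absurd rfl (CharP.char_ne_one k 1)
    · exact h2
  subst hql
  have := Fact.mk hl
  have h1 : (x ^ m - 1) ^ q ^ a = 0 := by
    rw [sub_pow_char_pow, one_pow, ← pow_mul, mul_comm m, h, sub_self]
  exact sub_eq_zero.1 (pow_eq_zero_iff (pow_ne_zero _ hl.ne_zero) |>.1 h1)

/-- The cyclotomic polynomial lies in the ideal generated by the norm polynomials. -/
theorem cyclotomic_mem_span {d : ℕ} (hd : 0 < d) :
    cyclotomic d ℤ ∈ Ideal.span (insert (X ^ d - 1 : ℤ[X]) (normPoly d '' d.primeFactors)) := by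
  set g : ℕ → ℤ[X] := fun p => ∏ m ∈ (d.divisors \ (d / p).divisors).erase d, cyclotomic m ℤ
  set g₀ : ℤ[X] := ∏ m ∈ d.properDivisors, cyclotomic m ℤ
  have hg : ∀ p ∈ d.primeFactors, normPoly d p = cyclotomic d ℤ * g p := by
    intro p hp
    rw [normPoly_eq_prod hd (Nat.dvd_of_mem_primeFactors hp)]
    refine (Finset.mul_prod_erase _ _ ?_).symm
    have h1 : d / p < d := Nat.div_lt_self hd (Nat.prime_of_mem_primeFactors hp).one_lt
    have h2 : 0 < d / p := Nat.div_pos (Nat.le_of_dvd hd (Nat.dvd_of_mem_primeFactors hp))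
      (Nat.prime_of_mem_primeFactors hp).pos
    simp only [Finset.mem_sdiff, Nat.mem_divisors]
    exact ⟨⟨dvd_rfl, hd.ne'⟩, fun h => absurd (Nat.le_of_dvd h2 h.1) (by omega)⟩
  have hg₀ : (X ^ d - 1 : ℤ[X]) = cyclotomic d ℤ * g₀ := by
    rw [← prod_cyclotomic_eq_X_pow_sub_one hd, ← Nat.insert_self_properDivisors hd.ne',
      Finset.prod_insert (by simp)]
  have htop : Ideal.span (insert g₀ (g '' d.primeFactors)) = ⊤ := by
    by_contra hne
    obtain ⟨M, hM, hJ⟩ := Ideal.exists_le_maximal _ hne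
    let _ : Field (ℤ[X] ⧸ M) := Ideal.Quotient.field M
    set x : ℤ[X] ⧸ M := Ideal.Quotient.mk M X
    have hev : ∀ P : ℤ[X], aeval x P = Ideal.Quotient.mk M P := by
      intro P
      have : (aeval x : ℤ[X] →ₐ[ℤ] ℤ[X] ⧸ M) = Ideal.Quotient.mkₐ ℤ M := by
        ext; simp [x]
      rw [this]; rfl
    have hz : ∀ P ∈ insert g₀ (g '' d.primeFactors), aeval x P = 0 := fun P hP => by
      rw [hev]; exact Ideal.Quotient.eq_zero_iff_mem.2 (hJ (Ideal.subset_span hP))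
    have hroot : ∀ p ∈ d.primeFactors, ∃ m, m ∣ d ∧ ¬ m ∣ d / p ∧ m ≠ d ∧ x ^ m = 1 := by
      intro p hp
      have h1 := hz (g p) (Or.inr ⟨p, hp, rfl⟩)
      rw [map_prod, Finset.prod_eq_zero_iff] at h1
      obtain ⟨m, hm, h2⟩ := h1
      simp only [Finset.mem_erase, Finset.mem_sdiff, Nat.mem_divisors] at hm
      have h2' : 0 < d / p := Nat.div_pos (Nat.le_of_dvd hd (Nat.dvd_of_mem_primeFactors hp))
        (Nat.prime_of_mem_primeFactors hp).pos
      exact ⟨m, hm.2.1.1, fun h => hm.2.2 ⟨h, h2'.ne'⟩, hm.1, pow_eq_one_of_aeval_cyclotomic h2⟩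
    obtain ⟨m₀, hm₀, hx₀⟩ : ∃ m ∈ d.properDivisors, x ^ m = 1 := by
      have h1 := hz g₀ (Or.inl rfl)
      rw [map_prod, Finset.prod_eq_zero_iff] at h1
      obtain ⟨m, hm, h2⟩ := h1
      exact ⟨m, hm, pow_eq_one_of_aeval_cyclotomic h2⟩
    rw [Nat.mem_properDivisors] at hm₀
    have hnorm : ∀ p ∈ d.primeFactors, ((p : ℕ) : ℤ[X] ⧸ M) ≠ 0 → x ^ (d / p) ≠ 1 := by
      intro p hp hpk h
      have h1 : aeval x (normPoly d p) = 0 := by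
        rw [hg p hp, map_mul, hz _ (Or.inr ⟨p, hp, rfl⟩), mul_zero]
      simp [normPoly, h] at h1
      exact hpk h1
    by_cases hl : ∃ l ∈ d.primeFactors, ((l : ℕ) : ℤ[X] ⧸ M) = 0
    · obtain ⟨l, hl, hlk⟩ := hl
      have hlp := Nat.prime_of_mem_primeFactors hl
      obtain ⟨m, hmd, hml, hmne, hxm⟩ := hroot l hl
      obtain ⟨a, d', hd', hdd⟩ := Nat.exists_eq_pow_mul_and_not_dvd hd.ne' l hlp.ne_one
      obtain ⟨b, m', hm', hmm⟩ := Nat.exists_eq_pow_mul_and_not_dvd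
        (Nat.pos_of_dvd_of_pos hmd hd).ne' l hlp.ne_one
      have hd'0 : 0 < d' := Nat.pos_of_ne_zero fun h => by simp [h] at hd'
      have hcop : ∀ n, ¬ l ∣ n → ∀ c, (l ^ c).Coprime n := fun n hn c =>
        Nat.Coprime.pow_left _ ((Nat.Prime.coprime_iff_not_dvd hlp).2 hn)
      have hm'd' : m' ∣ d' := by
        refine ((hcop m' hm' a).symm).dvd_of_dvd_mul_left ?_
        rw [← hdd]; exact (Dvd.intro_left _ hmm.symm).trans hmd
      have hba : b ≤ a := by
        have : l ^ b ∣ l ^ a := by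
          refine (hcop d' hd' b).dvd_of_dvd_mul_right ?_
          rw [← hdd]; exact (Dvd.intro _ hmm.symm).trans hmd
        exact (Nat.pow_dvd_pow_iff_le_right hlp.one_lt).1 this
      have hab : a ≤ b := by
        by_contra hlt
        refine hml ?_
        obtain ⟨e, rfl⟩ : ∃ e, a = e + 1 := ⟨a - 1, by omega⟩
        have : d / l = l ^ e * d' := by
          rw [hdd, pow_succ, mul_right_comm, Nat.mul_div_cancel _ hlp.pos]
        rw [this, hmm]
        exact mul_dvd_mul (pow_dvd_pow _ (by omega)) hm'd'
      have hord : orderOf x = d' := by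
        refine orderOf_eq_of_pow_and_pow_div_prime hd'0 ?_ ?_
        · refine pow_eq_one_of_pow_prime_pow hlp hlk (a := a) ?_
          rw [← hdd]
          obtain ⟨c, hc⟩ := hm₀.1
          rw [hc, pow_mul, hx₀, one_pow]
        · intro p hp hpd h
          have hpd' : p ∣ d := hdd ▸ dvd_mul_of_dvd_right hpd _
          have hpl : p ≠ l := fun h => hd' (h ▸ hpd)
          refine hnorm p (Nat.mem_primeFactors.2 ⟨hp, hpd', hd.ne'⟩) ?_ ?_
          · intro hpk
            refine hpl ?_
            have hcp : IsCoprime (p : ℤ) (l : ℤ) :=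
              Nat.isCoprime_iff_coprime.2 ((Nat.coprime_primes hp hlp).2 hpl)
            obtain ⟨u, v, huv⟩ := hcp
            have h1 := congrArg (Int.cast : ℤ → ℤ[X] ⧸ M) huv
            simp [hpk, hlk] at h1
          · have : d / p = l ^ a * (d' / p) := by rw [hdd, Nat.mul_div_assoc _ hpd]
            rw [this, mul_comm, pow_mul, h, one_pow]
      have hxm' : x ^ m' = 1 := pow_eq_one_of_pow_prime_pow hlp hlk (a := b) (hmm ▸ hxm)
      have h1 : d' ∣ m' := hord ▸ orderOf_dvd_of_pow_eq_one hxm'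
      refine hmne ?_
      rw [hmm, hdd, le_antisymm hba hab, Nat.dvd_antisymm hm'd' h1]
    · push Not at hl
      have hord : orderOf x = d := by
        refine orderOf_eq_of_pow_and_pow_div_prime hd ?_ ?_
        · obtain ⟨c, hc⟩ := hm₀.1
          rw [hc, pow_mul, hx₀, one_pow]
        · intro p hp hpd
          have := Nat.mem_primeFactors.2 ⟨hp, hpd, hd.ne'⟩
          exact hnorm p this (hl p this)
      have h1 : d ∣ m₀ := hord ▸ orderOf_dvd_of_pow_eq_one hx₀
      have h2 : 0 < m₀ := Nat.pos_of_dvd_of_pos hm₀.1 hd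
      exact absurd (Nat.le_of_dvd h2 h1) (by omega)
  have h1 : (1 : ℤ[X]) ∈ Ideal.span (insert g₀ (g '' d.primeFactors)) := htop ▸ trivial
  have h2 : ∀ P ∈ Ideal.span (insert g₀ (g '' d.primeFactors)), cyclotomic d ℤ * P ∈
      Ideal.span (insert (X ^ d - 1 : ℤ[X]) (normPoly d '' d.primeFactors)) := by
    intro P hP
    induction hP using Submodule.span_induction with
    | mem P hP =>
      rcases hP with rfl | ⟨p, hp, rfl⟩
      · rw [← hg₀]; exact Ideal.subset_span (Or.inl rfl)
      · rw [← hg p hp]; exact Ideal.subset_span (Or.inr ⟨p, hp, rfl⟩)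
    | zero => simp
    | add P Q _ _ hP hQ => rw [mul_add]; exact Ideal.add_mem _ hP hQ
    | smul r P _ hP =>
      rw [smul_eq_mul, mul_left_comm]; exact Ideal.mul_mem_left _ _ hP
  simpa using h2 1 h1


open Polynomial

section Generic

variable {A : Type u} [AddCommGroup A] {M : Type u} [AddCommGroup M]

theorem fixedBy_mono (σ : Module.End ℤ A) {c d : ℕ} (h : c ∣ d) : fixedBy σ c ≤ fixedBy σ d := by
  obtain ⟨k, rfl⟩ := h
  intro a ha
  rw [mem_fixedBy] at *
  rw [pow_mul]
  induction k with
  | zero => simp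
  | succ n ih => rw [pow_succ, Module.End.mul_apply, ha, ih]

theorem fixedBy_le_lowerFixed (σ : Module.End ℤ A) {c d : ℕ} (h : c ∈ d.properDivisors) :
    fixedBy σ c ≤ lowerFixed σ d :=
  le_iSup₂_of_le (f := fun d' (_ : d' ∈ d.properDivisors) => fixedBy σ d') c h le_rfl

theorem div_prime_mem_properDivisors {d p : ℕ} (hp : p ∈ d.primeFactors) :
    d / p ∈ d.properDivisors := by
  rw [Nat.mem_primeFactors] at hp
  exact Nat.mem_properDivisors.2 ⟨Nat.div_dvd_of_dvd hp.2.1,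
    Nat.div_lt_self (Nat.pos_of_ne_zero hp.2.2) hp.1.one_lt⟩

theorem lowerFixed_eq (σ : Module.End ℤ A) (d : ℕ) :
    lowerFixed σ d = ⨆ p ∈ d.primeFactors, fixedBy σ (d / p) := by
  refine le_antisymm (iSup₂_le fun c hc => ?_)
    (iSup₂_le fun p hp => fixedBy_le_lowerFixed σ (div_prime_mem_properDivisors hp))
  rw [Nat.mem_properDivisors] at hc
  obtain ⟨⟨k, rfl⟩, hlt⟩ := hc
  have hc0 : 0 < c := Nat.pos_of_ne_zero fun h => by simp [h] at hlt
  have hk : k ≠ 1 := fun h => by simp [h] at hlt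
  have hk0 : k ≠ 0 := fun h => by simp [h] at hlt
  obtain ⟨p, hp, m, hm⟩ := Nat.exists_prime_and_dvd hk
  have hmem : p ∈ (c * k).primeFactors :=
    Nat.mem_primeFactors.2 ⟨hp, ⟨c * m, by rw [hm]; ring⟩,
      (Nat.mul_pos hc0 (Nat.pos_of_ne_zero hk0)).ne'⟩
  refine le_iSup₂_of_le (f := fun p (_ : p ∈ (c * k).primeFactors) =>
    fixedBy σ ((c * k) / p)) p hmem (fixedBy_mono σ ?_)
  rw [hm, mul_left_comm, Nat.mul_div_cancel_left _ hp.pos]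
  exact dvd_mul_right _ _

theorem lowerFixed_le (σ : Module.End ℤ A) (d : ℕ) : lowerFixed σ d ≤ fixedBy σ d :=
  iSup₂_le fun _ hc => fixedBy_mono σ (Nat.mem_properDivisors.1 hc).1

theorem aeval_mem_fixedBy {σ : Module.End ℤ A} {d : ℕ} {a : A} (ha : a ∈ fixedBy σ d) (P : ℤ[X]) :
    aeval σ P a ∈ fixedBy σ d := by
  rw [mem_fixedBy] at *
  have h : (σ ^ d) * aeval σ P = aeval σ P * σ ^ d := by
    have : σ ^ d = aeval σ (X ^ d : ℤ[X]) := by simp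
    rw [this, ← map_mul, mul_comm, map_mul]
  rw [← Module.End.mul_apply, h, Module.End.mul_apply, ha]

theorem pow_mem_fixedBy {σ : Module.End ℤ A} {d : ℕ} {a : A} (ha : a ∈ fixedBy σ d) (k : ℕ) :
    (σ ^ k) a ∈ fixedBy σ d := by
  simpa using aeval_mem_fixedBy ha (X ^ k)

theorem aeval_mem_lowerFixed {σ : Module.End ℤ A} {d : ℕ} {a : A} (ha : a ∈ lowerFixed σ d)
    (P : ℤ[X]) : aeval σ P a ∈ lowerFixed σ d := by
  have h : lowerFixed σ d ≤ (lowerFixed σ d).comap (aeval σ P) :=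
    iSup₂_le fun c hc x hx => fixedBy_le_lowerFixed σ hc (aeval_mem_fixedBy hx P)
  exact h ha

theorem normPoly_mem_fixedBy {σ : Module.End ℤ A} {d p : ℕ} (hp : p ∣ d) {a : A}
    (ha : a ∈ fixedBy σ d) : aeval σ (normPoly d p) a ∈ fixedBy σ (d / p) := by
  have h := congrArg (fun P => aeval σ P a) (normPoly_mul hp)
  rw [mul_comm] at h
  simp only [map_mul, map_sub, map_pow, aeval_X, map_one, Module.End.mul_apply,
    LinearMap.sub_apply, Module.End.one_apply] at h
  rw [mem_fixedBy] at *
  rwa [ha, sub_self, sub_eq_zero] at h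

theorem aeval_normPoly_of_mem {σ : Module.End ℤ A} {d p : ℕ} {a : A}
    (ha : a ∈ fixedBy σ (d / p)) : aeval σ (normPoly d p) a = (p : ℤ) • a := by
  have h : ∀ i, ((σ ^ (d / p)) ^ i) a = a := fun i => by
    rw [← pow_mul]; exact fixedBy_mono σ (dvd_mul_right _ _) ha
  simp [normPoly, LinearMap.sum_apply, h]

theorem aeval_cyclotomic_mem_lowerFixed {σ : Module.End ℤ A} {d : ℕ} (hd : 0 < d) {a : A}
    (ha : a ∈ fixedBy σ d) : aeval σ (cyclotomic d ℤ) a ∈ lowerFixed σ d := by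
  have h : ∀ P ∈ Ideal.span (insert (X ^ d - 1 : ℤ[X]) (normPoly d '' d.primeFactors)),
      aeval σ P a ∈ lowerFixed σ d := by
    intro P hP
    induction hP using Submodule.span_induction with
    | mem P hP =>
      rcases hP with rfl | ⟨p, hp, rfl⟩
      · rw [mem_fixedBy] at ha
        simp [ha]
      · exact fixedBy_le_lowerFixed σ (div_prime_mem_properDivisors hp)
          (normPoly_mem_fixedBy (Nat.dvd_of_mem_primeFactors hp) ha)
    | zero => simp
    | add P Q _ _ hP hQ => rw [map_add]; exact add_mem hP hQ
    | smul r P _ hP => rw [smul_eq_mul, map_mul]; exact aeval_mem_lowerFixed hP r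
  exact h _ (cyclotomic_mem_span hd)

/-- `Gr_d^σ(A)` is isomorphic to `ℤ[μ_d] ⊗ B` for some abelian group `B`, where `ζ_d` acts as
`σ`. -/
def GrRegular (σ : Module.End ℤ A) (d : ℕ) [NeZero d] : Prop :=
  ∃ (B : Type u) (_ : AddCommGroup B) (e : Gr σ d ≃+ ZMu d ⊗[ℤ] B),
    ∀ x, e (grMap σ d x) = zetaMu d • e x

theorem isFixpointRegular_of_grRegular {σ : Module.End ℤ A}
    (h : ∀ (d : ℕ) [NeZero d], GrRegular σ d) : IsFixpointRegular σ := by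
  intro d _
  obtain ⟨B, _, e, he⟩ := h d
  let _ : Module (ZMu d) (Gr σ d) := e.module (ZMu d)
  refine ⟨B, inferInstance, inferInstance, fun x => ?_, ⟨e.linearEquiv (ZMu d)⟩⟩
  rw [← e.symm_apply_apply (grMap σ d x), he]
  rfl

theorem GrRegular.of_addEquiv {σ : Module.End ℤ A} {τ : Module.End ℤ M} {d : ℕ} [NeZero d]
    (e : Gr σ d ≃+ Gr τ d) (he : ∀ x, e (grMap σ d x) = grMap τ d (e x)) (h : GrRegular τ d) :
    GrRegular σ d := by
  obtain ⟨B, i, e', he'⟩ := h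
  exact ⟨B, i, e.trans e', fun x => by simp [he, he']⟩

theorem GrRegular.of_addEquiv' {σ : Module.End ℤ A} {τ : Module.End ℤ M} {d : ℕ} [NeZero d]
    (e : Gr σ d ≃+ Gr τ d) (he : ∀ x, e (grMap σ d x) = grMap τ d (e x)) (h : GrRegular σ d) :
    GrRegular τ d :=
  GrRegular.of_addEquiv e.symm (fun x => e.injective (by simp [he])) h

theorem pow_intertwine {σ : Module.End ℤ A} {τ : Module.End ℤ M} {f : A →ₗ[ℤ] M}
    (hf : ∀ a, f (σ a) = τ (f a)) (k : ℕ) (a : A) : f ((σ ^ k) a) = (τ ^ k) (f a) := by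
  induction k with
  | zero => simp
  | succ n ih => rw [pow_succ', pow_succ', Module.End.mul_apply, Module.End.mul_apply, hf, ih]

theorem aeval_intertwine {σ : Module.End ℤ A} {τ : Module.End ℤ M} {f : A →ₗ[ℤ] M}
    (hf : ∀ a, f (σ a) = τ (f a)) (P : ℤ[X]) (a : A) :
    f (aeval σ P a) = aeval τ P (f a) := by
  induction P using Polynomial.induction_on' with
  | add p q hp hq => simp [hp, hq]
  | monomial n r => simp [← C_mul_X_pow_eq_monomial, pow_intertwine hf]

theorem map_mem_fixedBy_of_intertwine {σ : Module.End ℤ A} {τ : Module.End ℤ M} {f : A →ₗ[ℤ] M}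
    (hf : ∀ a, f (σ a) = τ (f a)) {d : ℕ} {a : A} (ha : a ∈ fixedBy σ d) : f a ∈ fixedBy τ d := by
  rw [mem_fixedBy] at *
  rw [← pow_intertwine hf, ha]

theorem mem_fixedBy_of_intertwine {σ : Module.End ℤ A} {τ : Module.End ℤ M} {f : A →ₗ[ℤ] M}
    (hf : ∀ a, f (σ a) = τ (f a)) (hinj : Function.Injective f) {d : ℕ} {a : A} :
    f a ∈ fixedBy τ d ↔ a ∈ fixedBy σ d := by
  rw [mem_fixedBy, mem_fixedBy, ← pow_intertwine hf, hinj.eq_iff]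

theorem map_mem_lowerFixed_of_intertwine {σ : Module.End ℤ A} {τ : Module.End ℤ M}
    {f : A →ₗ[ℤ] M} (hf : ∀ a, f (σ a) = τ (f a)) {d : ℕ} {a : A} (ha : a ∈ lowerFixed σ d) :
    f a ∈ lowerFixed τ d := by
  have h : lowerFixed σ d ≤ (lowerFixed τ d).comap f :=
    iSup₂_le fun c hc x hx => fixedBy_le_lowerFixed τ hc (map_mem_fixedBy_of_intertwine hf hx)
  exact h ha

/-- An equivariant map that is bijective modulo the lower fixed points induces an isomorphism of
partial quotients. -/
theorem exists_grEquiv {σ : Module.End ℤ A} {τ : Module.End ℤ M} {d : ℕ} (f : A →ₗ[ℤ] M)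
    (hf : ∀ a, f (σ a) = τ (f a)) 
    (hlow : ∀ a ∈ fixedBy σ d, f a ∈ lowerFixed τ d → a ∈ lowerFixed σ d)
    (hsurj : ∀ m ∈ fixedBy τ d, ∃ a ∈ fixedBy σ d, m - f a ∈ lowerFixed τ d) :
    ∃ e : Gr σ d ≃+ Gr τ d, ∀ x, e (grMap σ d x) = grMap τ d (e x) := by
  let f' : fixedBy σ d →ₗ[ℤ] fixedBy τ d :=
    f.restrict fun a ha => map_mem_fixedBy_of_intertwine hf ha
  let F : Gr σ d →ₗ[ℤ] Gr τ d :=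
    Submodule.mapQ _ _ f' fun a ha => map_mem_lowerFixed_of_intertwine hf ha
  have hinj : Function.Injective F := by
    rw [← LinearMap.ker_eq_bot, LinearMap.ker_eq_bot']
    intro x hx
    obtain ⟨a, rfl⟩ := Submodule.Quotient.mk_surjective _ x
    have h1 : f' a ∈ (lowerFixed τ d).submoduleOf (fixedBy τ d) :=
      (Submodule.Quotient.mk_eq_zero _).1 hx
    exact (Submodule.Quotient.mk_eq_zero _).2 (hlow a.1 a.2 h1)
  have hsur : Function.Surjective F := by
    intro y
    obtain ⟨m, rfl⟩ := Submodule.Quotient.mk_surjective _ y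
    obtain ⟨a, ha, h⟩ := hsurj m.1 m.2
    refine ⟨Submodule.Quotient.mk ⟨a, ha⟩, ?_⟩
    symm
    exact (Submodule.Quotient.eq _).2 h
  refine ⟨(LinearEquiv.ofBijective F ⟨hinj, hsur⟩).toAddEquiv, fun x => ?_⟩
  obtain ⟨a, rfl⟩ := Submodule.Quotient.mk_surjective _ x
  change F (grMap σ d (Submodule.Quotient.mk a)) = grMap τ d (F (Submodule.Quotient.mk a))
  refine congrArg Submodule.Quotient.mk (Subtype.ext ?_)
  exact hf a.1

theorem GrRegular.of_equiv {σ : Module.End ℤ A} {τ : Module.End ℤ M} {d : ℕ} [NeZero d]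
    (f : A ≃ₗ[ℤ] M) (hf : ∀ a, f (σ a) = τ (f a)) (h : GrRegular τ d) : GrRegular σ d := by
  have hf' : ∀ m, f.symm (τ m) = σ (f.symm m) := fun m => f.injective (by simp [hf])
  obtain ⟨e, he⟩ := exists_grEquiv (σ := σ) (τ := τ) (d := d) f.toLinearMap hf
    (fun a _ ha => by
      simpa using map_mem_lowerFixed_of_intertwine (f := f.symm.toLinearMap) hf' ha)
    (fun m hm => ⟨f.symm m,
      map_mem_fixedBy_of_intertwine (f := f.symm.toLinearMap) hf' hm, by simp⟩)
  exact h.of_addEquiv e he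

end Generic

section Local

variable {A : Type u} [AddCommGroup A] {M : Type u} [AddCommGroup M]

/-- The product of the operators `1 - p⁻¹ N_p` over `p ∈ s`, where `c p` stands for `p⁻¹`. -/
def primePoly (d : ℕ) (c : ℕ → ℤ) (s : Finset ℕ) : ℤ[X] :=
  ∏ p ∈ s, (1 - C (c p) * normPoly d p)

theorem sub_aeval_primePoly_mem (σ : Module.End ℤ A) {d : ℕ} (c : ℕ → ℤ) {s : Finset ℕ}
    (hs : s ⊆ d.primeFactors) {a : A} (ha : a ∈ fixedBy σ d) :
    a - aeval σ (primePoly d c s) a ∈ lowerFixed σ d := by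
  induction s using Finset.induction_on with
  | empty => simp [primePoly]
  | insert p s hp ih =>
    have h1 := ih fun q hq => hs (Finset.mem_insert_of_mem hq)
    have hpd := hs (Finset.mem_insert_self p s)
    have h2 : aeval σ (primePoly d c (insert p s)) a = aeval σ (primePoly d c s) a -
        aeval σ (C (c p) * normPoly d p) (aeval σ (primePoly d c s) a) := by
      rw [primePoly, Finset.prod_insert hp, sub_mul, one_mul, map_sub, map_mul]; rfl
    rw [h2, ← sub_add]
    refine add_mem h1 ?_
    rw [map_mul]
    refine fixedBy_le_lowerFixed σ (div_prime_mem_properDivisors hpd) ?_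
    rw [← map_mul, mul_comm, map_mul, Module.End.mul_apply]
    have := normPoly_mem_fixedBy (σ := σ) (Nat.dvd_of_mem_primeFactors hpd)
      (aeval_mem_fixedBy (aeval_mem_fixedBy ha (primePoly d c s)) (C (c p)))
    exact this

theorem aeval_primePoly_of_mem (σ : Module.End ℤ A) {d : ℕ} {c : ℕ → ℤ} {s : Finset ℕ} {N : ℤ}
    {p : ℕ} (hp : p ∈ s) (hc : N ∣ 1 - c p * p) {a : A} (ha : a ∈ fixedBy σ (d / p))
    (hN : N • a = 0) : aeval σ (primePoly d c s) a = 0 := by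
  rw [primePoly, ← Finset.prod_erase_mul _ _ hp, map_mul, Module.End.mul_apply]
  have : aeval σ (1 - C (c p) * normPoly d p) a = 0 := by
    obtain ⟨k, hk⟩ := hc
    rw [map_sub, map_mul, map_one, LinearMap.sub_apply, Module.End.mul_apply,
      aeval_normPoly_of_mem ha]
    have h1 : (1 : Module.End ℤ A) a - aeval σ (C (c p)) ((p : ℤ) • a) =
        (1 - c p * p : ℤ) • a := by
      simp [sub_smul, mul_smul, smul_comm (p : ℕ) (c p) a]
    rw [h1, hk, mul_comm, mul_smul, hN, smul_zero]
  rw [this, map_zero]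

theorem normPoly_primePoly_eq_zero (σ : Module.End ℤ A) {d : ℕ} {c : ℕ → ℤ} {s : Finset ℕ} {N : ℤ}
    {p : ℕ} (hp : p ∈ s) (hpd : p ∣ d) (hc : N ∣ 1 - c p * p) {a : A} (ha : a ∈ fixedBy σ d)
    (hN : N • a = 0) : aeval σ (normPoly d p) (aeval σ (primePoly d c s) a) = 0 := by
  rw [← Module.End.mul_apply, ← map_mul, mul_comm, map_mul, Module.End.mul_apply]
  refine aeval_primePoly_of_mem σ hp hc (normPoly_mem_fixedBy hpd ha) ?_
  rw [← map_smul, hN, map_zero]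

/-- A torsion element lies in a subgroup as soon as all its primary components do. -/
theorem mem_of_primary (S : Submodule ℤ A) {a : A} {N : ℕ} (hN : 0 < N)
    (h : ∀ l : ℕ, l.Prime → ((N / l ^ N.factorization l : ℕ) : ℤ) • a ∈ S) (ha : N • a = 0) :
    a ∈ S := by
  let I : Ideal ℤ := S.comap (LinearMap.toSpanSingleton ℤ A a)
  have hI : ∀ n : ℤ, n ∈ I ↔ n • a ∈ S := fun n => Iff.rfl
  obtain ⟨g, hg⟩ := (IsPrincipalIdealRing.principal I).principal
  have hgd : ∀ n : ℤ, n ∈ I → g ∣ n := fun n hn => by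
    rw [hg] at hn; exact Ideal.mem_span_singleton.1 hn
  have hgN : g ∣ N := hgd _ ((hI _).2 (by simp [ha]))
  have hg1 : g.natAbs = 1 := by
    by_contra hne
    obtain ⟨l, hl, hlg⟩ := Nat.exists_prime_and_dvd hne
    have h1 := hgd _ ((hI _).2 (h l hl))
    have h2 : l ∣ N / l ^ N.factorization l := by
      refine hlg.trans ?_
      exact Int.natCast_dvd_natCast.1 (Int.natAbs_dvd.2 h1)
    exact Nat.not_dvd_ordCompl hl hN.ne' h2
  have h1 : (1 : ℤ) ∈ I := by
    rw [hg]
    exact Ideal.mem_span_singleton.2 (Int.isUnit_iff_natAbs_eq.2 hg1).dvd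
  simpa using (hI 1).1 h1

theorem exists_inverses {d l N : ℕ} (hN : ∃ r, N = l ^ r) (hl : l.Prime) :
    ∃ c : ℕ → ℤ, ∀ p ∈ d.primeFactors.erase l, (N : ℤ) ∣ 1 - c p * p := by
  obtain ⟨r, rfl⟩ := hN
  have : ∀ p ∈ d.primeFactors.erase l, ∃ c : ℤ, ((l ^ r : ℕ) : ℤ) ∣ 1 - c * p := by
    intro p hp
    rw [Finset.mem_erase] at hp
    have h1 : Nat.Coprime p (l ^ r) := Nat.Coprime.pow_right _
      ((Nat.coprime_primes (Nat.prime_of_mem_primeFactors hp.2) hl).2 hp.1)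
    obtain ⟨u, v, huv⟩ := Nat.isCoprime_iff_coprime.2 h1
    exact ⟨u, v, by rw [← huv]; ring⟩
  choose! c hc using this
  exact ⟨c, hc⟩

/-- Comparison of the partial quotients of a submodule with those of a torsion module, one prime
at a time. -/
theorem exists_grEquiv_of_primary {σ : Module.End ℤ A} {τ : Module.End ℤ M} {d : ℕ}
    (f : A →ₗ[ℤ] M) (hf : ∀ a, f (σ a) = τ (f a)) (hinj : Function.Injective f)
    (htors : ∀ m : M, ∃ N : ℕ, 0 < N ∧ N • m = 0)
    (H : ∀ (l r : ℕ) (m : M), l.Prime → m ∈ fixedBy τ d → (l ^ r : ℕ) • m = 0 →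
      (∀ p ∈ d.primeFactors, p ≠ l → aeval τ (normPoly d p) m = 0) →
      ∃ m' ∈ lowerFixed τ d, ∃ a, f a = m - m') :
    ∃ e : Gr σ d ≃+ Gr τ d, ∀ x, e (grMap σ d x) = grMap τ d (e x) := by
  have hdecomp : ∀ N : ℕ, 0 < N → ∀ l : ℕ, l.Prime →
      l ^ N.factorization l * (N / l ^ N.factorization l) = N := fun N _ l _ =>
    Nat.ordProj_mul_ordCompl_eq_self N l
  refine exists_grEquiv f hf ?_ ?_
  · intro a ha hfa
    rw [lowerFixed_eq, Submodule.mem_iSup_finset_iff_exists_sum] at hfa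
    obtain ⟨μ, hμ⟩ := hfa
    choose n hn0 hn using fun p => htors (μ p).1
    obtain ⟨n', hn'0, hn'⟩ := htors (f a)
    set N := n' * ∏ p ∈ d.primeFactors, n p
    have hN0 : 0 < N := Nat.mul_pos hn'0 (Finset.prod_pos fun p _ => hn0 p)
    have hNa : N • a = 0 := hinj (by
      change f ((n' * ∏ p ∈ d.primeFactors, n p) • a) = _
      rw [map_nsmul, map_zero, mul_comm n', mul_smul, hn', smul_zero])
    have hNμ : ∀ p ∈ d.primeFactors, N • (μ p).1 = 0 := fun p hp => by
      obtain ⟨k, hk⟩ : n p ∣ N := (Finset.dvd_prod_of_mem n hp).trans (dvd_mul_left _ _)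
      rw [hk, mul_comm, mul_smul, hn, smul_zero]
    refine mem_of_primary _ hN0 (fun l hl => ?_) hNa
    set u := N / l ^ N.factorization l
    set q := l ^ N.factorization l
    have hqu : q * u = N := hdecomp N hN0 l hl
    obtain ⟨c, hc⟩ := exists_inverses (d := d) ⟨_, rfl⟩ hl (N := q)
    set E := primePoly d c (d.primeFactors.erase l)
    have hua : (u : ℤ) • a ∈ fixedBy σ d := Submodule.smul_mem _ _ ha
    have h1 := sub_aeval_primePoly_mem σ c (Finset.erase_subset l _) hua
    have h2 : aeval σ E ((u : ℤ) • a) ∈ lowerFixed σ d := by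
      have h3 : f (aeval σ E ((u : ℤ) • a)) =
          ∑ p ∈ d.primeFactors, aeval τ E ((u : ℤ) • (μ p).1) := by
        rw [aeval_intertwine hf, map_smul, ← hμ, Finset.smul_sum, map_sum]
      have h4 : ∀ p ∈ d.primeFactors, p ≠ l → aeval τ E ((u : ℤ) • (μ p).1) = 0 := by
        intro p hp hpl
        have hpe : p ∈ d.primeFactors.erase l := Finset.mem_erase.2 ⟨hpl, hp⟩
        refine aeval_primePoly_of_mem τ hpe (hc p hpe) (Submodule.smul_mem _ _ (μ p).2) ?_
        rw [← mul_smul, ← Nat.cast_mul, hqu, natCast_zsmul, hNμ p hp]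
      by_cases hld : l ∈ d.primeFactors
      · rw [Finset.sum_eq_single_of_mem l hld fun p hp hpl => h4 p hp hpl] at h3
        refine fixedBy_le_lowerFixed σ (div_prime_mem_properDivisors hld) ?_
        rw [← mem_fixedBy_of_intertwine hf hinj, h3]
        exact aeval_mem_fixedBy (Submodule.smul_mem _ _ (μ l).2) E
      · rw [Finset.sum_eq_zero fun p hp => h4 p hp fun h => hld (h ▸ hp)] at h3
        rw [hinj (h3.trans (map_zero f).symm)]
        exact zero_mem _
    rw [← sub_add_cancel ((u : ℤ) • a) (aeval σ E ((u : ℤ) • a))]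
    exact add_mem h1 h2
  · intro m hm
    let S : Submodule ℤ M := (fixedBy σ d).map f ⊔ lowerFixed τ d
    suffices hmS : m ∈ S by
      obtain ⟨_, ⟨a, ha, rfl⟩, z, hz, rfl⟩ := Submodule.mem_sup.1 hmS
      exact ⟨a, ha, by simpa using hz⟩
    obtain ⟨N, hN0, hN⟩ := htors m
    refine mem_of_primary _ hN0 (fun l hl => ?_) hN
    set u := N / l ^ N.factorization l
    set q := l ^ N.factorization l
    have hqu : q * u = N := hdecomp N hN0 l hl
    obtain ⟨c, hc⟩ := exists_inverses (d := d) ⟨_, rfl⟩ hl (N := q)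
    set E := primePoly d c (d.primeFactors.erase l)
    have hum : (u : ℤ) • m ∈ fixedBy τ d := Submodule.smul_mem _ _ hm
    have hqum : (q : ℤ) • (u : ℤ) • m = 0 := by
      rw [← mul_smul, ← Nat.cast_mul, hqu, natCast_zsmul, hN]
    have h1 := sub_aeval_primePoly_mem τ c (Finset.erase_subset l _) hum
    obtain ⟨m', hm', a, ha⟩ := H l (N.factorization l) (aeval τ E ((u : ℤ) • m)) hl
      (aeval_mem_fixedBy hum E)
      (by
        rw [← natCast_zsmul, ← map_smul, hqum, map_zero])
      (fun p hp hpl => by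
        have hpe : p ∈ d.primeFactors.erase l := Finset.mem_erase.2 ⟨hpl, hp⟩
        exact normPoly_primePoly_eq_zero τ hpe (Nat.dvd_of_mem_primeFactors hp) (hc p hpe) hum hqum)
    have hfa : a ∈ fixedBy σ d := by
      rw [← mem_fixedBy_of_intertwine hf hinj, ha]
      exact sub_mem (aeval_mem_fixedBy hum E) (lowerFixed_le τ d hm')
    have h2 : (u : ℤ) • m = f a + (m' + ((u : ℤ) • m - aeval τ E ((u : ℤ) • m))) := by
      rw [ha]; abel
    rw [h2]
    exact Submodule.add_mem_sup ⟨a, hfa, rfl⟩ (add_mem hm' h1)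

end Local


open Polynomial

section Cyclotomic

variable (d : ℕ) [NeZero d]

theorem zetaMu_spec : IsPrimitiveRoot (zetaMu d) d := IsCyclotomicExtension.zeta_spec d ℤ (ZMu d)

/-- Evaluation of integral polynomials at `ζ_d`. -/
def evalZeta : ℤ[X] →ₗ[ℤ] ZMu d := (aeval (zetaMu d)).toLinearMap

theorem evalZeta_apply (P : ℤ[X]) : evalZeta d P = aeval (zetaMu d) P := rfl

theorem evalZeta_surjective : Function.Surjective (evalZeta d) := by
  intro z
  have h : z ∈ Algebra.adjoin ℤ ({zetaMu d} : Set (ZMu d)) := by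
    rw [IsCyclotomicExtension.adjoin_primitive_root_eq_top (zetaMu_spec d)]; trivial
  rw [Algebra.adjoin_singleton_eq_range_aeval] at h
  obtain ⟨P, hP⟩ := h
  exact ⟨P, hP⟩

theorem cyclotomic_dvd_of_evalZeta_eq_zero {P : ℤ[X]} (h : evalZeta d P = 0) :
    cyclotomic d ℤ ∣ P := by
  have hz : IsPrimitiveRoot (algebraMap (ZMu d) (CyclotomicField d ℚ) (zetaMu d)) d :=
    (zetaMu_spec d).map_of_injective (IsFractionRing.injective _ _)
  rw [cyclotomic_eq_minpoly hz (NeZero.pos d)]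
  refine minpoly.isIntegrallyClosed_dvd (hz.isIntegral (NeZero.pos d)) ?_
  rw [aeval_algebraMap_apply]
  change algebraMap (ZMu d) (CyclotomicField d ℚ) (evalZeta d P) = 0
  rw [h, map_zero]

end Cyclotomic

theorem sum_range_mul_eq_smul {R M : Type*} [Ring R] [AddCommGroup M] [Module R M] {φ : ℕ → M}
    {ω : R} {h : ℕ} (hφ : ∀ j, φ (j + h) = ω • φ j) (n : ℕ) :
    ∑ j ∈ Finset.range (n * h), φ j =
      (∑ i ∈ Finset.range n, ω ^ i) • ∑ j ∈ Finset.range h, φ j := by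
  have hφ' : ∀ n j, φ (n * h + j) = ω ^ n • φ j := by
    intro n
    induction n with
    | zero => simp
    | succ n ih =>
      intro j
      rw [show (n + 1) * h + j = (n * h + j) + h by ring, hφ, ih, smul_smul, ← pow_succ']
  induction n with
  | zero => simp
  | succ n ih =>
    rw [add_mul, one_mul, Finset.sum_range_add, ih, Finset.sum_range_succ, add_smul]
    congr 1
    rw [Finset.smul_sum]
    exact Finset.sum_congr rfl fun j _ => hφ' n j

theorem geom_sum_eq_zero_of_ne_one {R : Type*} [CommRing R] [IsDomain R] {ω : R} {p : ℕ}
    (h1 : ω ≠ 1) (hp : ω ^ p = 1) : ∑ i ∈ Finset.range p, ω ^ i = 0 := by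
  have h := geom_sum_mul ω p
  rw [hp, sub_self] at h
  exact (mul_eq_zero.1 h).resolve_right (sub_ne_zero.2 h1)

theorem pow_apply_pow {A : Type u} [AddCommGroup A] (σ : Module.End ℤ A) (m n : ℕ) (a : A) :
    (σ ^ m) ((σ ^ n) a) = (σ ^ (m + n)) a := by
  rw [pow_add, Module.End.mul_apply]

set_option linter.unusedSectionVars false

section Graded

variable {A : Type u} [AddCommGroup A] {σ : Module.End ℤ A} {d g : ℕ} [NeZero d] [NeZero g]

/-- A grading of `A` by `ℤ/g` that is shifted by `σ`. -/
structure CyclicGrading (σ : Module.End ℤ A) (g : ℕ) [NeZero g] where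
  pr : ZMod g → Module.End ℤ A
  sum_pr : ∀ a, ∑ j, pr j a = a
  pr_pr : ∀ i j a, pr i (pr j a) = if i = j then pr j a else 0
  map_pr : ∀ j a, σ (pr j a) = pr (j + 1) (σ a)

namespace CyclicGrading

variable (G : CyclicGrading σ g)

theorem pow_pr (k : ℕ) (j : ZMod g) (a : A) : (σ ^ k) (G.pr j a) = G.pr (j + k) ((σ ^ k) a) := by
  induction k with
  | zero => simp
  | succ n ih =>
    rw [pow_succ', Module.End.mul_apply, ih, G.map_pr, Module.End.mul_apply]
    push_cast
    rw [add_assoc]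

theorem pow_pr_of_dvd {k : ℕ} (hk : g ∣ k) (j : ZMod g) (a : A) :
    (σ ^ k) (G.pr j a) = G.pr j ((σ ^ k) a) := by
  rw [G.pow_pr, (ZMod.natCast_eq_zero_iff k g).2 hk, add_zero]

theorem pr_mem_fixedBy {k : ℕ} (hk : g ∣ k) {a : A} (ha : a ∈ fixedBy σ k) (j : ZMod g) :
    G.pr j a ∈ fixedBy σ k := by
  rw [mem_fixedBy] at *
  rw [G.pow_pr_of_dvd hk, ha]

variable (d) in
/-- The points of degree `0` fixed by `σ ^ d`. -/
def base : Submodule ℤ A := fixedBy σ d ⊓ LinearMap.eqLocus (G.pr 0) LinearMap.id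

variable (d) in
/-- The subgroup of the degree `0` part that is divided out. -/
def baseLow : Submodule ℤ (G.base d) :=
  if d = g then ⊥ else (fixedBy σ g).submoduleOf (G.base d)

theorem pr_mem_base (hgd : g ∣ d) {a : A} (ha : a ∈ fixedBy σ d) : G.pr 0 a ∈ G.base d :=
  ⟨G.pr_mem_fixedBy hgd ha 0, by
    change G.pr 0 (G.pr 0 a) = G.pr 0 a
    rw [G.pr_pr, if_pos rfl]⟩

/-- The component of degree `j`, moved to degree `0`. -/
def coord (hgd : g ∣ d) (j : ℕ) : fixedBy σ d →ₗ[ℤ] G.base d :=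
  ((G.pr 0).comp (σ ^ ((d - 1) * j))).restrict
    fun _ ha => G.pr_mem_base hgd (pow_mem_fixedBy ha _)

theorem coord_apply (hgd : g ∣ d) (j : ℕ) (a : fixedBy σ d) :
    (G.coord hgd j a : A) = G.pr 0 ((σ ^ ((d - 1) * j)) a.1) := rfl

/-- The endomorphism of `A^{σ^d}` induced by `σ`. -/
def fixedMap (σ : Module.End ℤ A) (d : ℕ) : Module.End ℤ (fixedBy σ d) :=
  σ.restrict fun _ hx => map_mem_fixedBy hx

theorem fixedMap_pow_apply (k : ℕ) (a : fixedBy σ d) :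
    (((fixedMap σ d) ^ k) a : A) = (σ ^ k) a.1 := by
  induction k with
  | zero => simp
  | succ n ih =>
    rw [pow_succ', pow_succ', Module.End.mul_apply, Module.End.mul_apply, ← ih]; rfl

theorem coord_succ (hgd : g ∣ d) (j : ℕ) (a : fixedBy σ d) :
    G.coord hgd (j + 1) (fixedMap σ d a) = G.coord hgd j a := by
  refine Subtype.ext ?_
  rw [coord_apply, coord_apply]
  change G.pr 0 ((σ ^ ((d - 1) * (j + 1))) (σ a.1)) = _
  have h1 : (d - 1) * (j + 1) + 1 = (d - 1) * j + d := by
    have : (d - 1) + 1 = d := Nat.sub_add_cancel (NeZero.pos d)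
    rw [mul_add, mul_one, add_assoc, this]
  have h2 := pow_apply_pow σ ((d - 1) * (j + 1)) 1 a.1
  rw [pow_one] at h2
  rw [h2, h1, ← pow_apply_pow, mem_fixedBy.1 a.2]

/-- The hypothesis relating the degree and the number of pieces. -/
def Admissible (d g : ℕ) : Prop := (d = g ∧ Odd d) ∨ d = 2 * g

theorem Admissible.dvd (h : Admissible d g) : g ∣ d := by
  rcases h with h | h
  · rw [h.1]
  · rw [h]; exact dvd_mul_left _ _

/-- The sign `ζ_d ^ g`. -/
def sgn (d g : ℕ) : ℤ := if d = g then 1 else -1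

theorem zeta_pow_sgn (h : Admissible d g) : zetaMu d ^ g = (sgn d g : ZMu d) := by
  unfold sgn
  have hz := (zetaMu_spec d).pow_eq_one
  rcases h with h | h
  · rw [if_pos h.1, ← h.1, hz, Int.cast_one]
  · have hg := NeZero.pos g
    have hne : d ≠ g := by omega
    rw [if_neg hne]
    have h1 : (zetaMu d ^ g) ^ 2 = 1 := by rw [← pow_mul, mul_comm, ← h, hz]
    have h2 : zetaMu d ^ g ≠ 1 := (zetaMu_spec d).pow_ne_one_of_pos_of_lt hg.ne' (by omega)
    rw [(mul_self_eq_one_iff.1 ((sq _).symm.trans h1)).resolve_left h2]; simp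

theorem sgn_mul_pow (h : Admissible d g) : sgn d g * sgn d g ^ (d - 1) = 1 := by
  rw [← pow_succ', Nat.sub_add_cancel (NeZero.pos d)]
  unfold sgn
  rcases h with h | h
  · rw [if_pos h.1, one_pow]
  · have hg := NeZero.pos g
    rw [if_neg (by omega), h, pow_mul]; simp

theorem pow_sub_sgn_mem (h : Admissible d g) (b b' : G.base d) (hb : (b' : A) = (σ ^ g) b.1) :
    b' - sgn d g • b ∈ G.baseLow d := by
  unfold baseLow sgn
  have hfix : (σ ^ d) b.1 = b.1 := b.2.1
  split_ifs with hdg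
  · rw [Submodule.mem_bot, one_smul, sub_eq_zero]
    refine Subtype.ext ?_
    rw [hb]
    exact (congrArg (fun k => (σ ^ k) b.1) hdg).symm.trans hfix
  · have h2 : d = 2 * g := h.resolve_left fun h => hdg h.1
    change (b' - (-1 : ℤ) • b : G.base d).1 ∈ fixedBy σ g
    rw [mem_fixedBy]
    have h3 : (σ ^ g) ((σ ^ g) b.1) = b.1 := by
      rw [← Module.End.mul_apply, ← pow_add, ← two_mul, ← h2, hfix]
    simp [hb, h3, add_comm]

variable (d) in
/-- The abelian group `B` with `Gr_d^σ(A) ≅ ℤ[μ_d] ⊗ B`. -/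
abbrev Coeff : Type u := G.base d ⧸ G.baseLow d

theorem mk_coord_add (h : Admissible d g) (j : ℕ) (a : fixedBy σ d) :
    (G.baseLow d).mkQ (G.coord h.dvd (j + g) a) =
      (sgn d g) ^ (d - 1) • (G.baseLow d).mkQ (G.coord h.dvd j a) := by
  have key : ∀ (k : ℕ) (b b' : G.base d), (b' : A) = (σ ^ (g * k)) b.1 →
      (G.baseLow d).mkQ b' = (sgn d g) ^ k • (G.baseLow d).mkQ b := by
    intro k
    induction k with
    | zero => intro b b' hb; simp at hb; simp [hb]
    | succ k ih =>
      intro b b' hb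
      have hb'' : (σ ^ (g * k)) b.1 ∈ G.base d := by
        refine ⟨pow_mem_fixedBy b.2.1 _, ?_⟩
        change G.pr 0 ((σ ^ (g * k)) b.1) = _
        rw [← G.pow_pr_of_dvd (dvd_mul_right _ _)]
        exact congrArg _ b.2.2
      have h1 := ih b ⟨_, hb''⟩ rfl
      have h2 := G.pow_sub_sgn_mem h ⟨_, hb''⟩ b' (by
        rw [hb, mul_add, mul_one, add_comm, pow_add, Module.End.mul_apply])
      rw [pow_succ', mul_smul, ← h1, ← map_smul]
      exact (Submodule.Quotient.eq _).2 h2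
  refine key (d - 1) _ _ ?_
  rw [coord_apply, coord_apply, G.pow_pr_of_dvd (dvd_mul_right _ _), pow_apply_pow]
  congr 3
  ring

/-- The terms of the comparison map. -/
def term (h : Admissible d g) (j : ℕ) : fixedBy σ d →ₗ[ℤ] ZMu d ⊗[ℤ] G.Coeff d :=
  (TensorProduct.mk ℤ (ZMu d) (G.Coeff d) (zetaMu d ^ j)).comp
    ((G.baseLow d).mkQ.comp (G.coord h.dvd j))

theorem term_apply (h : Admissible d g) (j : ℕ) (a : fixedBy σ d) :
    G.term h j a = (zetaMu d ^ j) ⊗ₜ[ℤ] (G.baseLow d).mkQ (G.coord h.dvd j a) := rfl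

theorem term_add (h : Admissible d g) (j : ℕ) (a : fixedBy σ d) :
    G.term h (j + g) a = G.term h j a := by
  rw [term_apply, term_apply, mk_coord_add _ h, pow_add, zeta_pow_sgn h, mul_comm, ← zsmul_eq_mul,
    TensorProduct.smul_tmul, smul_smul, sgn_mul_pow h, one_smul]

theorem term_fixedMap (h : Admissible d g) (j : ℕ) (a : fixedBy σ d) :
    G.term h (j + 1) (fixedMap σ d a) = zetaMu d • G.term h j a := by
  rw [term_apply, term_apply, coord_succ, TensorProduct.smul_tmul', pow_succ', smul_eq_mul]

theorem term_fixedMap_pow (h : Admissible d g) (k j : ℕ) (a : fixedBy σ d) :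
    G.term h (j + k) ((fixedMap σ d ^ k) a) = zetaMu d ^ k • G.term h j a := by
  induction k with
  | zero => simp
  | succ n ih =>
    rw [pow_succ', Module.End.mul_apply, ← add_assoc, term_fixedMap, ih, smul_smul, pow_succ']

theorem term_add_of_fixed (h : Admissible d g) {t : ℕ} {a : fixedBy σ d}
    (ha : (σ ^ t) a.1 = a.1) (j : ℕ) : G.term h (j + t) a = zetaMu d ^ t • G.term h j a := by
  rw [← term_fixedMap_pow]
  congr 1
  exact Subtype.ext (by rw [fixedMap_pow_apply, ha])

/-- The comparison map `A^{σ^d} → ℤ[μ_d] ⊗ B`. -/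
def compare (h : Admissible d g) : fixedBy σ d →ₗ[ℤ] ZMu d ⊗[ℤ] G.Coeff d :=
  ∑ j ∈ Finset.range g, G.term h j

theorem compare_apply (h : Admissible d g) (a : fixedBy σ d) :
    G.compare h a = ∑ j ∈ Finset.range g, G.term h j a := by
  simp [compare]

theorem compare_fixedMap (h : Admissible d g) (a : fixedBy σ d) :
    G.compare h (fixedMap σ d a) = zetaMu d • G.compare h a := by
  obtain ⟨n, hn⟩ : ∃ n, g = n + 1 := ⟨g - 1, (Nat.sub_add_cancel (NeZero.pos g)).symm⟩
  rw [compare_apply, compare_apply, Finset.smul_sum,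
    ← Finset.sum_congr rfl fun j _ => G.term_fixedMap h j a]
  have h0 : G.term h g (fixedMap σ d a) = G.term h 0 (fixedMap σ d a) := by
    simpa using G.term_add h 0 (fixedMap σ d a)
  have h1 := Finset.sum_range_succ' (fun j => G.term h j (fixedMap σ d a)) g
  rw [Finset.sum_range_succ, h0] at h1
  exact add_right_cancel h1

theorem compare_eq_zero (h : Admissible d g) {p : ℕ} (hp : p ∈ d.primeFactors) {a : fixedBy σ d}
    (ha : (σ ^ (d / p)) a.1 = a.1) : G.compare h a = 0 := by
  have hpp := Nat.prime_of_mem_primeFactors hp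
  have hpd := Nat.dvd_of_mem_primeFactors hp
  have hg := NeZero.pos g
  have hz := zetaMu_spec d
  have main : ∀ (m : ℕ) (ω : ZMu d), g = p * m → (∀ j, G.term h (j + m) a = ω • G.term h j a) → ω ≠ 1 →
      ω ^ p = 1 → G.compare h a = 0 := by
    intro m ω hm hω h1 h2
    have h3 := sum_range_mul_eq_smul (φ := fun j => G.term h j a) hω p
    rw [← hm, geom_sum_eq_zero_of_ne_one h1 h2, zero_smul] at h3
    rw [compare_apply, h3]
  rcases id h with hd | hd
  · obtain ⟨m, hm⟩ := hpd
    have hm' : d / p = m := by rw [hm, Nat.mul_div_cancel_left _ hpp.pos]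
    rw [hm'] at ha
    refine main m (zetaMu d ^ m) (hd.1 ▸ hm) (G.term_add_of_fixed _ ha) ?_ ?_
    · refine hz.pow_ne_one_of_pos_of_lt ?_ ?_
      · rintro rfl; simp at hm; exact NeZero.ne d hm
      · have : 0 < m := Nat.pos_of_ne_zero fun h0 => NeZero.ne d (by rw [hm, h0, mul_zero])
        rw [hm]; exact lt_mul_left this hpp.one_lt
    · rw [← pow_mul, mul_comm, ← hm, hz.pow_eq_one]
  · by_cases hp2 : p = 2
    · subst hp2
      have hg2 : d / 2 = g := by omega
      rw [hg2] at ha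
      rw [compare_apply]
      refine Finset.sum_eq_zero fun j _ => ?_
      rw [term_apply]
      have : G.coord h.dvd j a ∈ G.baseLow d := by
        unfold baseLow
        rw [if_neg (by omega)]
        exact G.pr_mem_fixedBy dvd_rfl (pow_mem_fixedBy ha _) 0
      rw [Submodule.mkQ_apply, (Submodule.Quotient.mk_eq_zero _).2 this, TensorProduct.tmul_zero]
    · have hpg : p ∣ g := by
        refine (Nat.Coprime.dvd_mul_left ?_).1 (hd ▸ hpd)
        exact (Nat.coprime_primes hpp Nat.prime_two).2 hp2
      obtain ⟨m, hm⟩ := hpg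
      obtain ⟨c, hc⟩ := (hpp.odd_of_ne_two hp2)
      have hm0 : 0 < m := Nat.pos_of_ne_zero fun h0 => by simp [h0] at hm; omega
      have ht : d / p = 2 * m := by
        rw [hd, hm, mul_left_comm, Nat.mul_div_cancel_left _ hpp.pos]
      rw [ht] at ha
      have ha' : (σ ^ (2 * m * (c + 1))) a.1 = a.1 :=
        fixedBy_mono σ (dvd_mul_right _ _) (mem_fixedBy.2 ha)
      refine main m (zetaMu d ^ (2 * m * (c + 1))) hm (fun j => ?_) ?_ ?_
      · rw [← G.term_add_of_fixed _ ha', ← G.term_add _ (j + m)]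
        have : j + m + g = j + 2 * m * (c + 1) := by rw [hm, hc]; ring
        rw [this]
      · rw [Ne, hz.pow_eq_one_iff_dvd, hd, hm, hc]
        intro hdvd
        have h1 : (2 * m) * (2 * c + 1) ∣ (2 * m) * (c + 1) := by
          convert hdvd using 1; ring
        have h2 := Nat.le_of_dvd (by omega) (Nat.dvd_of_mul_dvd_mul_left (by omega) h1)
        have := hpp.one_lt
        omega
      · rw [← pow_mul, hz.pow_eq_one_iff_dvd, hd, hm]
        exact ⟨c + 1, by ring⟩

theorem compare_eq_zero_of_mem (h : Admissible d g) {a : fixedBy σ d}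
    (ha : a.1 ∈ lowerFixed σ d) : G.compare h a = 0 := by
  rw [lowerFixed_eq] at ha
  have hle : (⨆ p ∈ d.primeFactors, fixedBy σ (d / p)) ≤
      (LinearMap.ker (G.compare h)).map (fixedBy σ d).subtype := by
    refine iSup₂_le fun p hp x hx => ?_
    have hxd := fixedBy_mono σ (Nat.div_dvd_of_dvd (Nat.dvd_of_mem_primeFactors hp)) hx
    exact ⟨⟨x, hxd⟩, G.compare_eq_zero h hp hx, rfl⟩
  obtain ⟨b, hb, hba⟩ := hle ha
  rwa [← Subtype.ext hba]

theorem compare_base (h : Admissible d g) (b : G.base d) :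
    G.compare h ⟨b.1, b.2.1⟩ = 1 ⊗ₜ[ℤ] (G.baseLow d).mkQ b := by
  have hb : G.pr 0 b.1 = b.1 := b.2.2
  rw [compare_apply, Finset.sum_eq_single_of_mem 0 (Finset.mem_range.2 (NeZero.pos g))]
  · rw [term_apply, pow_zero]
    congr 2
    exact Subtype.ext (by rw [coord_apply]; simpa using hb)
  · intro j hj hj0
    rw [term_apply]
    have : G.coord h.dvd j ⟨b.1, b.2.1⟩ = 0 := by
      refine Subtype.ext ?_
      rw [coord_apply]
      change G.pr 0 ((σ ^ ((d - 1) * j)) b.1) = 0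
      rw [← hb, G.pow_pr, G.pr_pr, if_neg]
      intro h0
      have h1 : ((d - 1 : ℕ) : ZMod g) = -1 := by
        rw [Nat.cast_sub (NeZero.pos d), (ZMod.natCast_eq_zero_iff d g).2 h.dvd]; simp
      push_cast at h0
      rw [h1, zero_add, neg_one_mul, zero_eq_neg, ZMod.natCast_eq_zero_iff] at h0
      exact absurd (Nat.le_of_dvd (Nat.pos_of_ne_zero hj0) h0) (by simpa using hj)
    rw [this, map_zero, TensorProduct.tmul_zero]

theorem compare_surjective (h : Admissible d g) : Function.Surjective (G.compare h) := by
  rw [← LinearMap.range_eq_top, eq_top_iff]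
  intro z _
  induction z using TensorProduct.induction_on with
  | zero => exact zero_mem _
  | add x y hx hy => exact add_mem (hx trivial) (hy trivial)
  | tmul z b =>
    obtain ⟨b, rfl⟩ := Submodule.mkQ_surjective _ b
    obtain ⟨P, rfl⟩ := evalZeta_surjective d z
    induction P using Polynomial.induction_on' with
    | add P Q hP hQ =>
      rw [map_add, TensorProduct.add_tmul]
      exact add_mem (hP trivial) (hQ trivial)
    | monomial n r =>
      have : (evalZeta d) (monomial n r) = r • zetaMu d ^ n := by
        rw [evalZeta_apply, aeval_monomial]
        simp
      rw [this, ← TensorProduct.smul_tmul']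
      refine Submodule.smul_mem _ _ ⟨(fixedMap σ d ^ n) ⟨b.1, b.2.1⟩, ?_⟩
      have hpow : ∀ k a, G.compare h ((fixedMap σ d ^ k) a) = zetaMu d ^ k • G.compare h a := by
        intro k a
        induction k with
        | zero => simp
        | succ k ih =>
          rw [pow_succ', Module.End.mul_apply, compare_fixedMap, ih, smul_smul, pow_succ']
      rw [hpow, compare_base, TensorProduct.smul_tmul', smul_eq_mul, mul_one]

variable (d) in
/-- The evaluation map `ℤ[X] ⊗ A₀ → A`, `P ⊗ b ↦ P(σ) b`. -/
def evalBase : ℤ[X] ⊗[ℤ] G.base d →ₗ[ℤ] A :=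
  TensorProduct.lift (LinearMap.mk₂ ℤ (fun P b => aeval σ P b.1)
    (by simp) (by simp) (by simp) (by simp))

theorem evalBase_tmul (P : ℤ[X]) (b : G.base d) : G.evalBase d (P ⊗ₜ b) = aeval σ P b.1 := rfl

theorem baseLow_le (h : Admissible d g) {b : G.base d} (hb : b ∈ G.baseLow d) :
    b.1 ∈ lowerFixed σ d := by
  unfold baseLow at hb
  split_ifs at hb with hdg
  · rw [Submodule.mem_bot] at hb
    rw [hb]; exact zero_mem _
  · have h2 : d = 2 * g := h.resolve_left fun h => hdg h.1
    refine fixedBy_le_lowerFixed σ ?_ hb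
    have := NeZero.pos g
    exact Nat.mem_properDivisors.2 ⟨h.dvd, by omega⟩

theorem evalBase_mem_lowerFixed (h : Admissible d g) {t : ℤ[X] ⊗[ℤ] G.base d}
    (ht : TensorProduct.map (evalZeta d) (G.baseLow d).mkQ t = 0) :
    G.evalBase d t ∈ lowerFixed σ d := by
  have hker := TensorProduct.map_ker (LinearMap.exact_subtype_ker_map (evalZeta d))
    (evalZeta_surjective d) (LinearMap.exact_subtype_ker_map (G.baseLow d).mkQ)
    (Submodule.mkQ_surjective _)
  have ht' : t ∈ LinearMap.ker (TensorProduct.map (evalZeta d) (G.baseLow d).mkQ) := ht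
  rw [hker] at ht'
  have hle : LinearMap.range (LinearMap.lTensor ℤ[X]
        (LinearMap.ker (G.baseLow d).mkQ).subtype) ⊔
      LinearMap.range (LinearMap.rTensor (G.base d) (LinearMap.ker (evalZeta d)).subtype) ≤
      (lowerFixed σ d).comap (G.evalBase d) := by
    refine sup_le ?_ ?_
    · rintro _ ⟨z, rfl⟩
      induction z using TensorProduct.induction_on with
      | zero => rw [map_zero]; exact zero_mem _
      | add x y hx hy => rw [map_add]; exact add_mem hx hy
      | tmul P b =>
        refine aeval_mem_lowerFixed (G.baseLow_le h ?_) P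
        simpa using b.2
    · rintro _ ⟨z, rfl⟩
      induction z using TensorProduct.induction_on with
      | zero => rw [map_zero]; exact zero_mem _
      | add x y hx hy => rw [map_add]; exact add_mem hx hy
      | tmul P b =>
        obtain ⟨Q, hQ⟩ := cyclotomic_dvd_of_evalZeta_eq_zero d P.2
        change aeval σ P.1 b.1 ∈ lowerFixed σ d
        rw [hQ, map_mul, Module.End.mul_apply]
        exact aeval_cyclotomic_mem_lowerFixed (NeZero.pos d) (aeval_mem_fixedBy b.2.1 Q)
  exact hle ht'

theorem mem_lowerFixed_of_compare (h : Admissible d g) {a : fixedBy σ d}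
    (ha : G.compare h a = 0) : a.1 ∈ lowerFixed σ d := by
  set t : ℤ[X] ⊗[ℤ] G.base d := ∑ j ∈ Finset.range g, (X ^ j : ℤ[X]) ⊗ₜ G.coord h.dvd j a
  have h1 : TensorProduct.map (evalZeta d) (G.baseLow d).mkQ t = G.compare h a := by
    rw [compare_apply, map_sum]
    refine Finset.sum_congr rfl fun j _ => ?_
    rw [TensorProduct.map_tmul, term_apply]
    congr 1
    rw [evalZeta_apply, map_pow, aeval_X]
  have h2 : G.evalBase d t = a.1 := by
    rw [map_sum]
    have h3 : ∀ j : ℕ, G.evalBase d ((X ^ j : ℤ[X]) ⊗ₜ G.coord h.dvd j a) =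
        G.pr (j : ZMod g) a.1 := by
      intro j
      rw [evalBase_tmul, coord_apply, map_pow, aeval_X, G.pow_pr, zero_add, pow_apply_pow]
      have h4 : j + (d - 1) * j = d * j := by
        have := Nat.sub_add_cancel (NeZero.pos d)
        calc j + (d - 1) * j = (d - 1 + 1) * j := by ring
          _ = d * j := by rw [this]
      rw [h4, mem_fixedBy.1 (fixedBy_mono σ (dvd_mul_right d j) a.2)]
    rw [Finset.sum_congr rfl fun j _ => h3 j]
    conv_rhs => rw [← G.sum_pr a.1]
    refine Finset.sum_bij' (fun j _ => (j : ZMod g)) (fun j _ => j.val) ?_ ?_ ?_ ?_ ?_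
    · simp
    · intro j _; simpa using ZMod.val_lt j
    · intro j hj; simpa using ZMod.val_cast_of_lt (Finset.mem_range.1 hj)
    · simp
    · simp
  rw [← h2]
  exact G.evalBase_mem_lowerFixed h (h1.trans ha)

/-- The partial quotients of a cyclically graded module are regular. -/
theorem grRegular (G : CyclicGrading σ g) (h : Admissible d g) : GrRegular σ d := by
  let F : Gr σ d →ₗ[ℤ] ZMu d ⊗[ℤ] G.Coeff d :=
    Submodule.liftQ _ (G.compare h) fun a ha => G.compare_eq_zero_of_mem h ha
  have hinj : Function.Injective F := by
    rw [← LinearMap.ker_eq_bot, LinearMap.ker_eq_bot']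
    intro x hx
    obtain ⟨a, rfl⟩ := Submodule.Quotient.mk_surjective _ x
    exact (Submodule.Quotient.mk_eq_zero _).2 (G.mem_lowerFixed_of_compare h hx)
  have hsur : Function.Surjective F := by
    intro y
    obtain ⟨a, ha⟩ := G.compare_surjective h y
    exact ⟨Submodule.Quotient.mk a, ha⟩
  refine ⟨G.Coeff d, inferInstance, (LinearEquiv.ofBijective F ⟨hinj, hsur⟩).toAddEquiv,
    fun x => ?_⟩
  obtain ⟨a, rfl⟩ := Submodule.Quotient.mk_surjective _ x
  exact G.compare_fixedMap h a

end CyclicGrading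

end Graded


open Polynomial

/-- A permutation of a set together with a sign at each point. -/
structure SignedPerm (X : Type u) where
  perm : Equiv.Perm X
  sgn : X → ℤˣ

namespace SignedPerm

variable {X : Type u} (s : SignedPerm X) (G : Type*) [AddCommGroup G]

/-- The action on functions: `(s h) (s x) = sgn x • h x`. -/
def act : Module.End ℤ (X → G) where
  toFun h x := (s.sgn (s.perm.symm x) : ℤ) • h (s.perm.symm x)
  map_add' a b := by ext x; simp
  map_smul' n a := by ext x; simp [smul_comm n]

variable {G}

theorem act_apply (h : X → G) (x : X) :
    s.act G h x = (s.sgn (s.perm.symm x) : ℤ) • h (s.perm.symm x) := rfl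

theorem act_apply_perm (h : X → G) (x : X) :
    s.act G h (s.perm x) = (s.sgn x : ℤ) • h x := by
  simp [act_apply]

/-- The sign of the `k`-th iterate. -/
def iter (k : ℕ) (x : X) : ℤˣ := ∏ i ∈ Finset.range k, s.sgn ((s.perm ^ i) x)

theorem iter_zero (x : X) : s.iter 0 x = 1 := by simp [iter]

theorem iter_add (j k : ℕ) (x : X) : s.iter (j + k) x = s.iter j x * s.iter k ((s.perm ^ j) x) := by
  rw [iter, iter, iter, Finset.prod_range_add]
  congr 1
  refine Finset.prod_congr rfl fun i _ => ?_
  rw [← Equiv.Perm.mul_apply, ← pow_add, add_comm i j]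

theorem act_pow_apply (k : ℕ) (h : X → G) (x : X) :
    (s.act G ^ k) h ((s.perm ^ k) x) = (s.iter k x : ℤ) • h x := by
  induction k with
  | zero => simp [iter_zero]
  | succ k ih =>
    rw [pow_succ', pow_succ', Module.End.mul_apply, Equiv.Perm.mul_apply, act_apply_perm, ih,
      iter_add, smul_smul, mul_comm (s.iter k x)]
    simp [iter]

theorem iter_mul {k : ℕ} {x : X} (hx : (s.perm ^ k) x = x) (h : s.iter k x = 1) (m : ℕ) :
    s.iter (k * m) x = 1 := by
  induction m with
  | zero => simp [iter_zero]
  | succ m ih =>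
    have h1 : (s.perm ^ (k * m)) x = x := by
      rw [pow_mul]
      exact Function.IsFixedPt.perm_pow hx m
    rw [mul_add, mul_one, iter_add, ih, h1, h, one_mul]

/-- The iterates of a signed permutation. -/
def pow (k : ℕ) : SignedPerm X := ⟨s.perm ^ k, s.iter k⟩

theorem act_pow (k : ℕ) : (s.pow k).act G = s.act G ^ k := by
  refine LinearMap.ext fun h => funext fun x => ?_
  obtain ⟨y, rfl⟩ := (s.perm ^ k).surjective x
  rw [act_pow_apply]
  exact (s.pow k).act_apply_perm h y

theorem iter_pow (c k : ℕ) (x : X) : (s.pow c).iter k x = s.iter (c * k) x := by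
  induction k with
  | zero => simp [iter_zero]
  | succ k ih =>
    rw [iter_add, ih, mul_add, mul_one, iter_add]
    congr 1
    simp [iter, pow, ← pow_mul]

theorem act_comp {G' : Type*} [AddCommGroup G'] (φ : G →+ G') (h : X → G) :
    s.act G' (φ ∘ h) = φ ∘ s.act G h := by
  ext x
  simp [act_apply]

theorem act_pow_comp {G' : Type*} [AddCommGroup G'] (φ : G →+ G') (k : ℕ) (h : X → G) :
    (s.act G' ^ k) (φ ∘ h) = φ ∘ (s.act G ^ k) h := by
  induction k with
  | zero => simp
  | succ k ih => rw [pow_succ', pow_succ', Module.End.mul_apply, Module.End.mul_apply, ih, act_comp]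

theorem pow_apply_of_fixed {n : X → G} (hn : s.act G n = n) (k : ℕ) (x : X) :
    n ((s.perm ^ k) x) = (s.iter k x : ℤ) • n x := by
  rw [← act_pow_apply]
  have : ∀ k : ℕ, (s.act G ^ k) n = n := fun k => by
    induction k with
    | zero => simp
    | succ k ih => rw [pow_succ', Module.End.mul_apply, ih, hn]
  rw [this]

theorem iter_eq_or {n : X → G} (hs : ∀ x k, (s.perm ^ k) x = x → s.iter k x = 1 ∨ n x = 0)
    {r : X} {i j : ℕ} (h : (s.perm ^ i) r = (s.perm ^ j) r) : s.iter i r = s.iter j r ∨ n r = 0 := by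
  wlog hij : i ≤ j generalizing i j
  · exact (this h.symm (le_of_not_ge hij)).imp Eq.symm id
  · obtain ⟨m, rfl⟩ := Nat.exists_eq_add_of_le hij
    have h1 : (s.perm ^ m) r = r := by
      rw [pow_add, Equiv.Perm.mul_apply] at h
      exact ((s.perm ^ i).injective h).symm
    refine (hs r m h1).imp (fun h2 => ?_) id
    rw [add_comm, iter_add, h1, h2, one_mul]

/-- A fixed function on which the stabilisers act with trivial sign lifts along a surjection to a
fixed function. -/
theorem exists_fixed_lift [Finite X] {G' : Type*} [AddCommGroup G'] (φ : G' →+ G)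
    (hφ : Function.Surjective φ) {n : X → G} (hn : s.act G n = n)
    (hs : ∀ x k, (s.perm ^ k) x = x → s.iter k x = 1 ∨ n x = 0) :
    ∃ N : X → G', s.act G' N = N ∧ ∀ x, φ (N x) = n x ∧ (n x = 0 → N x = 0) := by
  classical
  let lam : G → G' := fun a => if a = 0 then 0 else Function.surjInv hφ a
  have hlam : ∀ a, φ (lam a) = a := fun a => by
    by_cases ha : a = 0
    · simp [lam, ha]
    · simp [lam, ha, Function.surjInv_eq]
  let S := Equiv.Perm.SameCycle.setoid s.perm
  let rep : X → X := fun x => (Quotient.mk S x).out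
  have hrep : ∀ x, s.perm.SameCycle (rep x) x := fun x => Quotient.exact (s := S) (Quotient.out_eq _)
  have hrep_perm : ∀ x, rep (s.perm x) = rep x := fun x => by
    have : (Quotient.mk S (s.perm x)) = Quotient.mk S x :=
      Quotient.sound (s := S) (Equiv.Perm.sameCycle_apply_left.2 (Equiv.Perm.SameCycle.refl _ _))
    simp only [rep, this]
  have hex : ∀ x, ∃ j : ℕ, (s.perm ^ j) (rep x) = x := fun x => by
    obtain ⟨i, _, _, hi⟩ := (hrep x).exists_pow_eq''
    exact ⟨i, hi⟩
  choose j hj using hex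
  let N : X → G' := fun x => (s.iter (j x) (rep x) : ℤ) • lam (n (rep x))
  have hnx : ∀ x, n x = (s.iter (j x) (rep x) : ℤ) • n (rep x) := fun x => by
    rw [← s.pow_apply_of_fixed hn, hj]
  refine ⟨N, ?_, fun x => ⟨?_, ?_⟩⟩
  · ext y
    obtain ⟨x, rfl⟩ := s.perm.surjective y
    rw [act_apply_perm]
    have h1 : (s.perm ^ (j x + 1)) (rep x) = (s.perm ^ j (s.perm x)) (rep x) := by
      rw [pow_succ', Equiv.Perm.mul_apply, hj, ← hrep_perm, hj]
    change _ • (s.iter (j x) (rep x) : ℤ) • lam (n (rep x)) =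
      (s.iter (j (s.perm x)) (rep (s.perm x)) : ℤ) • lam (n (rep (s.perm x)))
    rw [hrep_perm]
    rcases s.iter_eq_or hs h1 with h2 | h2
    · rw [← h2, iter_add, hj, smul_smul, mul_comm (s.iter _ _)]
      simp [iter]
    · simp [h2, lam]
  · simp only [N]
    rw [map_zsmul, hlam, ← hnx]
  · intro hx
    have h1 : n (rep x) = 0 := by
      rw [hnx] at hx
      rcases Int.units_eq_one_or (s.iter (j x) (rep x)) with h | h <;> simpa [h] using hx
    simp [N, lam, h1]

end SignedPerm

section MatOp

variable {X : Type u} [Fintype X] (L : X → X → ℤ)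

/-- The operator on functions given by an integral matrix. -/
def matOp (G : Type*) [AddCommGroup G] : Module.End ℤ (X → G) where
  toFun h x := ∑ y, L x y • h y
  map_add' a b := by ext x; simp [Finset.sum_add_distrib]
  map_smul' n a := by ext x; simp [Finset.smul_sum, smul_comm n]

theorem matOp_apply {G : Type*} [AddCommGroup G] (h : X → G) (x : X) :
    matOp L G h x = ∑ y, L x y • h y := rfl

theorem matOp_comp {G G' : Type*} [AddCommGroup G] [AddCommGroup G'] (φ : G →+ G') (h : X → G) :
    matOp L G' (φ ∘ h) = φ ∘ matOp L G h := by
  ext x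
  simp [matOp_apply]

variable {L} in
theorem matOp_act {s : SignedPerm X}
    (hL : ∀ x y, L (s.perm x) (s.perm y) = s.sgn x * s.sgn y * L x y)
    {G : Type*} [AddCommGroup G] (h : X → G) :
    matOp L G (s.act G h) = s.act G (matOp L G h) := by
  ext x
  obtain ⟨x, rfl⟩ := s.perm.surjective x
  rw [s.act_apply_perm, matOp_apply, matOp_apply, ← Equiv.sum_comp s.perm, Finset.smul_sum]
  refine Finset.sum_congr rfl fun y _ => ?_
  rw [s.act_apply_perm, hL, smul_smul, smul_smul]
  congr 1
  have : (s.sgn y : ℤ) * s.sgn y = 1 := by rw [← Units.val_mul, Int.units_mul_self, Units.val_one]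
  linear_combination (s.sgn x * L x y : ℤ) * this

end MatOp


open Polynomial

/-- An integral matrix on a finite set that is equivariant under a signed permutation, together
with a period at each point. -/
structure CellSystem (X : Type u) [Fintype X] extends SignedPerm X where
  mat : X → X → ℤ
  mat_equivariant : ∀ x y, mat (perm x) (perm y) = sgn x * sgn y * mat x y
  period : X → ℕ
  period_pos : ∀ x, 0 < period x
  period_perm : ∀ x, period (perm x) = period x
  perm_pow_period : ∀ x, (perm ^ period x) x = x
  iter_period : ∀ x, toSignedPerm.iter (period x) x = 1
  period_dvd : ∀ x k, (perm ^ k) x = x → period x ∣ 2 * k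
  nondeg : ∀ (d : ℕ) (h : X → ℚ), (∀ x, ¬ d ∣ period x → h x = 0) →
    (∀ x, d ∣ period x → matOp mat ℚ h x = 0) → h = 0
  connect : ∀ d : ℕ, ∃ R : X → X → Prop, Equivalence R ∧ (∀ x y, R (perm x) (perm y) ↔ R x y) ∧
    (∀ x y, d ∣ period x → d ∣ period y → mat x y ≠ 0 → R x y) ∧
    ∀ x k, d ∣ period x → R x ((perm ^ k) x) → d ∣ 2 * k

/-- The coefficient group `ℚ/ℤ`. -/
abbrev QZ : Type := AddCircle (1 : ℚ)

/-- The projection `ℚ → ℚ/ℤ`. -/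
def toQZ : ℚ →+ QZ := QuotientAddGroup.mk' _

theorem toQZ_surjective : Function.Surjective toQZ := QuotientAddGroup.mk'_surjective _

theorem toQZ_eq_zero_iff {q : ℚ} : toQZ q = 0 ↔ ∃ n : ℤ, (n : ℚ) = q := by
  unfold toQZ
  rw [QuotientAddGroup.mk'_apply, QuotientAddGroup.eq_zero_iff, AddSubgroup.mem_zmultiples_iff]
  simp

theorem exists_nsmul_eq_zero {X : Type u} [Fintype X] (h : X → QZ) :
    ∃ N : ℕ, 0 < N ∧ N • h = 0 := by
  have h1 : ∀ a : QZ, ∃ N : ℕ, 0 < N ∧ N • a = 0 := by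
    intro a
    obtain ⟨q, rfl⟩ := toQZ_surjective a
    refine ⟨q.den, q.den_pos, ?_⟩
    rw [← map_nsmul, toQZ_eq_zero_iff]
    exact ⟨q.num, by rw [nsmul_eq_mul, mul_comm, Rat.mul_den_eq_num]⟩
  choose N hN0 hN using h1
  refine ⟨∏ x, N (h x), Finset.prod_pos fun x _ => hN0 _, funext fun x => ?_⟩
  obtain ⟨k, hk⟩ := Finset.dvd_prod_of_mem (fun x => N (h x)) (Finset.mem_univ x)
  rw [Pi.smul_apply, hk, mul_comm, mul_smul, hN, smul_zero, Pi.zero_apply]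

namespace CellSystem

variable {X : Type u} [Fintype X] (C : CellSystem X)

theorem period_symm (x : X) : C.period (C.perm.symm x) = C.period x := by
  rw [← C.period_perm, Equiv.apply_symm_apply]

theorem period_pow (k : ℕ) (x : X) : C.period ((C.perm ^ k) x) = C.period x := by
  induction k with
  | zero => simp
  | succ k ih => rw [pow_succ', Equiv.Perm.mul_apply, C.period_perm, ih]

/-- The `ℚ/ℤ`-valued functions that are harmonic at the cells whose period is divisible by `d`. -/
def harmonicOn (d : ℕ) : Submodule ℤ (X → QZ) where
  carrier := {h | ∀ x, d ∣ C.period x → matOp C.mat QZ h x = 0}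
  add_mem' {a b} ha hb x hx := by rw [map_add, Pi.add_apply, ha x hx, hb x hx, add_zero]
  zero_mem' x _ := by rw [map_zero]; rfl
  smul_mem' n a ha x hx := by rw [map_smul, Pi.smul_apply, ha x hx, smul_zero]

/-- The `ℚ/ℤ`-valued functions supported on the cells whose period is divisible by `d`. -/
def supportedOn (d : ℕ) : Submodule ℤ (X → QZ) where
  carrier := {h | ∀ x, ¬ d ∣ C.period x → h x = 0}
  add_mem' {a b} ha hb x hx := by rw [Pi.add_apply, ha x hx, hb x hx, add_zero]
  zero_mem' x _ := rfl
  smul_mem' n a ha x hx := by rw [Pi.smul_apply, ha x hx, smul_zero]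

theorem act_mem_harmonicOn (d : ℕ) {h : X → QZ} (hh : h ∈ C.harmonicOn d) :
    C.act QZ h ∈ C.harmonicOn d := by
  intro x hx
  rw [matOp_act C.mat_equivariant, C.act_apply, hh _ (by rwa [C.period_symm]), smul_zero]

theorem act_mem_supportedOn (d : ℕ) {h : X → QZ} (hh : h ∈ C.supportedOn d) :
    C.act QZ h ∈ C.supportedOn d := by
  intro x hx
  rw [C.act_apply, hh _ (by rwa [C.period_symm]), smul_zero]

theorem act_mem_ker {h : X → QZ} (hh : h ∈ LinearMap.ker (matOp C.mat QZ)) :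
    C.act QZ h ∈ LinearMap.ker (matOp C.mat QZ) := by
  rw [LinearMap.mem_ker] at *
  rw [matOp_act C.mat_equivariant, hh, map_zero]

theorem pow_act_apply_of_gcd_dvd {G : Type*} [AddCommGroup G] {d : ℕ} (hd : 0 < d) {n : X → G}
    (hn : (C.act G ^ d) n = n) {k : ℕ} {x : X} (hk : Nat.gcd d (C.period x) ∣ k) :
    (C.act G ^ k) n x = n x := by
  have hper : ∀ (m : ℕ) (h : X → G), (C.act G ^ (C.period x * m)) h x = h x := by
    intro m h
    have h1 : (C.perm ^ (C.period x * m)) x = x := by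
      rw [pow_mul]; exact Function.IsFixedPt.perm_pow (C.perm_pow_period x) m
    have h3 := C.act_pow_apply (C.period x * m) h x
    rwa [h1, C.iter_mul (C.perm_pow_period x) (C.iter_period x) m, Units.val_one, one_smul] at h3
  have hdm : ∀ m : ℕ, (C.act G ^ (d * m)) n = n := fun m =>
    fixedBy_mono (C.act G) (dvd_mul_right d m) hn
  obtain ⟨a, b, hab⟩ : ∃ a b : ℕ, k + C.period x * b = d * a := by
    obtain ⟨z, hz1, hz2⟩ := Nat.chineseRemainder' (n := d) (m := C.period x) (a := 0) (b := k)
      (Nat.modEq_iff_dvd' (Nat.zero_le k) |>.2 (by simpa using hk))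
    obtain ⟨z', hz'⟩ := (Nat.modEq_zero_iff_dvd).1 hz1
    have hle : k ≤ z + C.period x * (d * k) := by
      have := Nat.mul_pos (C.period_pos x) hd
      have : k ≤ C.period x * d * k := Nat.le_mul_of_pos_left k this
      rw [mul_assoc] at this; omega
    have h5 : k ≡ z + C.period x * (d * k) [MOD C.period x] := by
      have : z + C.period x * (d * k) ≡ z [MOD C.period x] := by simp [Nat.ModEq]
      exact (this.trans hz2).symm
    obtain ⟨b, hb⟩ := (Nat.modEq_iff_dvd' hle).1 h5
    exact ⟨z' + C.period x * k, b, by rw [← hb, Nat.add_sub_cancel' hle, hz']; ring⟩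
  have h4 := hper b ((C.act G ^ k) n)
  rw [pow_apply_pow, add_comm, hab, hdm] at h4
  exact h4.symm

/-- A function with values in an `l`-primary group that is fixed by `σ ^ d`, killed by the norms
for the other primes and supported on the cells whose period is not divisible by `d`, lifts to a
rational function fixed by `σ ^ (d / l)`. -/
theorem exists_rat_lift {d l r : ℕ} (hd : 0 < d) (hl : l.Prime) {n : X → QZ}
    (hn : n ∈ fixedBy (C.act QZ) d) (hr : (l ^ r : ℕ) • n = 0)
    (hp : ∀ p ∈ d.primeFactors, p ≠ l → aeval (C.act QZ) (normPoly d p) n = 0)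
    (hsupp : ∀ x, d ∣ C.period x → n x = 0) :
    n = 0 ∨ ∃ c ∈ d.properDivisors, ∃ N : X → ℚ, (C.act ℚ ^ c) N = N ∧ toQZ ∘ N = n ∧
      ∀ x, d ∣ C.period x → N x = 0 := by
  have hn' : (C.act QZ ^ d) n = n := hn
  have hcop : ∀ (m : ℕ) (x : X), m.Coprime l → (m : ℤ) • n x = 0 → n x = 0 := by
    intro m x hm hmx
    have h1 : ((l ^ r : ℕ) : ℤ) • n x = 0 := by
      rw [natCast_zsmul, ← Pi.smul_apply, hr, Pi.zero_apply]
    obtain ⟨a, b, hab⟩ := Nat.isCoprime_iff_coprime.2 (hm.pow_right r)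
    calc n x = (a * m + b * (l ^ r : ℕ) : ℤ) • n x := by rw [hab, one_smul]
      _ = 0 := by rw [add_smul, mul_smul, mul_smul, hmx, h1, smul_zero, smul_zero, add_zero]
  have hgcd : ∀ x, n x ≠ 0 → l ∈ d.primeFactors ∧ Nat.gcd d (C.period x) ∣ d / l := by
    intro x hx
    have h1 : Nat.gcd d (C.period x) ≠ d := fun h =>
      hx (hsupp x (Nat.gcd_eq_left_iff_dvd.1 h))
    obtain ⟨k, hk⟩ := Nat.gcd_dvd_left d (C.period x)
    have hk1 : k ≠ 1 := fun h => h1 (by rw [h, mul_one] at hk; exact hk.symm)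
    obtain ⟨p, hpp, m, rfl⟩ := Nat.exists_prime_and_dvd hk1
    have hpd : p ∈ d.primeFactors := Nat.mem_primeFactors.2
      ⟨hpp, Dvd.intro_left (Nat.gcd d (C.period x) * m) (by rw [mul_assoc, mul_comm m, ← hk]), hd.ne'⟩
    have hdp : Nat.gcd d (C.period x) ∣ d / p := by
      refine ⟨m, ?_⟩
      conv_lhs => rw [hk]
      rw [mul_left_comm, Nat.mul_div_cancel_left _ hpp.pos]
    by_cases hpl : p = l
    · subst hpl; exact ⟨hpd, hdp⟩
    · refine absurd (hcop p x ((Nat.coprime_primes hpp hl).2 hpl) ?_) hx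
      have h2 := congrFun (hp p hpd hpl) x
      have h3 : ∀ i, ((C.act QZ ^ (d / p)) ^ i) n x = n x := fun i => by
        rw [← pow_mul]
        exact C.pow_act_apply_of_gcd_dvd hd hn' (hdp.trans (dvd_mul_right _ _))
      simpa [normPoly, LinearMap.sum_apply, h3] using h2
  by_cases hn0 : n = 0
  · exact Or.inl hn0
  right
  obtain ⟨x₀, hx₀⟩ := Function.ne_iff.1 hn0
  have hld := (hgcd x₀ hx₀).1
  have hfix : (C.act QZ ^ (d / l)) n = n := by
    ext x
    by_cases hx : Nat.gcd d (C.period x) ∣ d / l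
    · exact C.pow_act_apply_of_gcd_dvd hd hn' hx
    · obtain ⟨y, rfl⟩ := (C.perm ^ (d / l)).surjective x
      rw [C.period_pow] at hx
      have h1 : n y = 0 := by
        by_contra h; exact hx (hgcd y h).2
      have h2 : n ((C.perm ^ (d / l)) y) = 0 := by
        by_contra h
        have := (hgcd _ h).2
        rw [C.period_pow] at this
        exact hx this
      rw [C.act_pow_apply, h1, h2, smul_zero]
  have hfix' : (C.pow (d / l)).act QZ n = n := by rw [C.act_pow, hfix]
  obtain ⟨N, hN, hN'⟩ := (C.pow (d / l)).exists_fixed_lift toQZ toQZ_surjective hfix' (by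
    intro x k hx
    by_cases hnx : n x = 0
    · exact Or.inr hnx
    left
    have h1 := (C.pow (d / l)).pow_apply_of_fixed hfix' k x
    rw [hx] at h1
    rcases Int.units_eq_one_or ((C.pow (d / l)).iter k x) with h2 | h2
    · exact h2
    exfalso
    rw [h2] at h1
    have h3 : (2 : ℤ) • n x = 0 := by
      rw [two_smul]
      nth_rewrite 1 [h1]
      simp
    by_cases hl2 : l = 2
    · subst hl2
      have hx' : (C.perm ^ (d / 2 * k)) x = x := by rw [pow_mul]; exact hx
      have h4 := C.period_dvd x _ hx'
      have h5 : 2 * (d / 2 * k) = d * k := by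
        rw [← mul_assoc, Nat.mul_div_cancel' (Nat.dvd_of_mem_primeFactors hld)]
      rw [h5] at h4
      have h6 : C.period x ∣ Nat.gcd d (C.period x) * k := by
        rw [← Nat.gcd_mul_right]
        exact Nat.dvd_gcd h4 (dvd_mul_right _ _)
      obtain ⟨m, hm⟩ := h6.trans (mul_dvd_mul_right (hgcd x hnx).2 k)
      rw [C.iter_pow, hm, C.iter_mul (C.perm_pow_period x) (C.iter_period x)] at h2
      exact absurd h2 (by decide)
    · exact hnx (hcop 2 x ((Nat.coprime_primes Nat.prime_two hl).2 (Ne.symm hl2)) h3))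
  refine ⟨d / l, div_prime_mem_properDivisors hld, N, ?_, funext fun x => (hN' x).1,
    fun x hx => (hN' x).2 (hsupp x hx)⟩
  rw [← C.act_pow, hN]

/-- The operator that is harmonic at the cells whose period is divisible by `d`, and the identity
elsewhere, is surjective on rational functions. -/
theorem exists_rat_solution (d : ℕ) (N : X → ℚ) : ∃ M : X → ℚ,
    (∀ x, d ∣ C.period x → matOp C.mat ℚ M x = N x) ∧ (∀ x, ¬ d ∣ C.period x → M x = N x) := by
  classical
  let T : (X → ℚ) →+ (X → ℚ) :=
    { toFun := fun h x => if d ∣ C.period x then matOp C.mat ℚ h x else h x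
      map_zero' := by ext x; simp
      map_add' := fun a b => by ext x; by_cases hx : d ∣ C.period x <;> simp [hx] }
  have hinj : Function.Injective T.toRatLinearMap := by
    rw [← LinearMap.ker_eq_bot, LinearMap.ker_eq_bot']
    intro h hh
    refine C.nondeg d h (fun x hx => ?_) (fun x hx => ?_)
    · have : (if d ∣ C.period x then matOp C.mat ℚ h x else h x) = 0 := congrFun hh x
      rwa [if_neg hx] at this
    · have : (if d ∣ C.period x then matOp C.mat ℚ h x else h x) = 0 := congrFun hh x
      rwa [if_pos hx] at this
  obtain ⟨M, hM⟩ := (LinearMap.injective_iff_surjective.1 hinj) N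
  refine ⟨M, fun x hx => ?_, fun x hx => ?_⟩
  · have : (if d ∣ C.period x then matOp C.mat ℚ M x else M x) = N x := congrFun hM x
    rwa [if_pos hx] at this
  · have : (if d ∣ C.period x then matOp C.mat ℚ M x else M x) = N x := congrFun hM x
    rwa [if_neg hx] at this

theorem act_pow_mat {G : Type*} [AddCommGroup G] (c : ℕ) (h : X → G) :
    matOp C.mat G ((C.act G ^ c) h) = (C.act G ^ c) (matOp C.mat G h) :=
  pow_intertwine (matOp_act C.mat_equivariant) c h

/-- A solution with fixed data is fixed. -/
theorem rat_solution_fixed {d c : ℕ} {N M : X → ℚ} (hN : (C.act ℚ ^ c) N = N)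
    (h1 : ∀ x, d ∣ C.period x → matOp C.mat ℚ M x = N x)
    (h2 : ∀ x, ¬ d ∣ C.period x → M x = N x) : (C.act ℚ ^ c) M = M := by
  rw [← sub_eq_zero]
  refine C.nondeg d _ (fun x hx => ?_) (fun x hx => ?_)
  · obtain ⟨y, rfl⟩ := (C.perm ^ c).surjective x
    have hy : ¬ d ∣ C.period y := by rwa [C.period_pow] at hx
    rw [Pi.sub_apply, h2 _ hx, C.act_pow_apply, h2 y hy, ← C.act_pow_apply, hN, sub_self]
  · rw [map_sub, act_pow_mat]
    obtain ⟨y, rfl⟩ := (C.perm ^ c).surjective x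
    have hy : d ∣ C.period y := by rwa [C.period_pow] at hx
    rw [Pi.sub_apply, h1 _ hx, C.act_pow_apply, h1 y hy, ← C.act_pow_apply, hN, sub_self]

/-- The action on the functions that are harmonic at the cells whose period is divisible by
`d`. -/
def harmonicMap (d : ℕ) : Module.End ℤ (C.harmonicOn d) :=
  (C.act QZ).restrict fun _ h => C.act_mem_harmonicOn d h

/-- The action on the kernel. -/
def kerMap : Module.End ℤ (LinearMap.ker (matOp C.mat QZ)) :=
  (C.act QZ).restrict fun _ h => C.act_mem_ker h

/-- The action on the harmonic functions that are supported on the cells whose period is divisible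
by `d`. -/
def supportedMap (d : ℕ) : Module.End ℤ (C.harmonicOn d ⊓ C.supportedOn d : Submodule ℤ _) :=
  (C.act QZ).restrict fun _ h => ⟨C.act_mem_harmonicOn d h.1, C.act_mem_supportedOn d h.2⟩

theorem mem_lowerFixed_harmonicMap {d c : ℕ} (hc : c ∈ d.properDivisors) {M : X → ℚ}
    (hM : (C.act ℚ ^ c) M = M) (hm : toQZ ∘ M ∈ C.harmonicOn d) :
    (⟨toQZ ∘ M, hm⟩ : C.harmonicOn d) ∈ lowerFixed (C.harmonicMap d) d := by
  refine fixedBy_le_lowerFixed _ hc ?_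
  rw [← mem_fixedBy_of_intertwine (f := (C.harmonicOn d).subtype) (τ := C.act QZ) (fun _ => rfl)
    (C.harmonicOn d).injective_subtype]
  change (C.act QZ ^ c) (toQZ ∘ M) = toQZ ∘ M
  rw [C.act_pow_comp, hM]

theorem harmonicOn_torsion (d : ℕ) (m : C.harmonicOn d) : ∃ N : ℕ, 0 < N ∧ N • m = 0 := by
  obtain ⟨N, hN, h⟩ := exists_nsmul_eq_zero m.1
  exact ⟨N, hN, Subtype.ext h⟩

theorem exists_grEquiv_ker {d : ℕ} (hd : 0 < d) : ∃ e : Gr C.kerMap d ≃+ Gr (C.harmonicMap d) d,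
    ∀ x, e (grMap C.kerMap d x) = grMap (C.harmonicMap d) d (e x) := by
  have hle : LinearMap.ker (matOp C.mat QZ) ≤ C.harmonicOn d := fun h hh x _ => by
    rw [LinearMap.mem_ker.1 hh]; rfl
  refine exists_grEquiv_of_primary (Submodule.inclusion hle) (fun _ => rfl)
    (Submodule.inclusion_injective hle) (C.harmonicOn_torsion d) ?_
  intro l r f hl hf hr hp
  let φ : C.harmonicOn d →ₗ[ℤ] (X → QZ) := (matOp C.mat QZ).comp (C.harmonicOn d).subtype
  have hφ : ∀ a, φ (C.harmonicMap d a) = C.act QZ (φ a) := fun a =>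
    matOp_act C.mat_equivariant a.1
  rcases C.exists_rat_lift hd hl (n := φ f) (map_mem_fixedBy_of_intertwine hφ hf)
    (by rw [← map_nsmul, hr, map_zero])
    (fun p hpd hpl => by rw [← aeval_intertwine hφ, hp p hpd hpl, map_zero])
    (fun x hx => f.2 x hx) with h0 | ⟨c, hc, N, hN, hNn, hNs⟩
  · exact ⟨0, zero_mem _, ⟨f.1, h0⟩, Subtype.ext (by simp)⟩
  · obtain ⟨M, hM1, hM2⟩ := C.exists_rat_solution 1 N
    have hMN : matOp C.mat ℚ M = N := funext fun x => hM1 x (one_dvd _)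
    have hMf := C.rat_solution_fixed hN hM1 hM2
    have hmat : matOp C.mat QZ (toQZ ∘ M) = φ f := by rw [matOp_comp, hMN, hNn]
    have hmem : toQZ ∘ M ∈ C.harmonicOn d := fun x hx => by
      rw [hmat]; exact f.2 x hx
    refine ⟨⟨toQZ ∘ M, hmem⟩, C.mem_lowerFixed_harmonicMap hc hMf hmem,
      ⟨f.1 - toQZ ∘ M, ?_⟩, rfl⟩
    rw [LinearMap.mem_ker, map_sub, hmat]
    exact sub_self _

theorem exists_grEquiv_supported {d : ℕ} (hd : 0 < d) :
    ∃ e : Gr (C.supportedMap d) d ≃+ Gr (C.harmonicMap d) d,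
      ∀ x, e (grMap (C.supportedMap d) d x) = grMap (C.harmonicMap d) d (e x) := by
  classical
  have hle : C.harmonicOn d ⊓ C.supportedOn d ≤ C.harmonicOn d := inf_le_left
  refine exists_grEquiv_of_primary (Submodule.inclusion hle) (fun _ => rfl)
    (Submodule.inclusion_injective hle) (C.harmonicOn_torsion d) ?_
  intro l r f hl hf hr hp
  let φ : C.harmonicOn d →ₗ[ℤ] (X → QZ) :=
    { toFun := fun h x => if d ∣ C.period x then 0 else h.1 x
      map_add' := fun a b => by ext x; by_cases hx : d ∣ C.period x <;> simp [hx]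
      map_smul' := fun n a => by ext x; by_cases hx : d ∣ C.period x <;> simp [hx] }
  have hφa : ∀ h x, φ h x = if d ∣ C.period x then 0 else h.1 x := fun _ _ => rfl
  have hφ : ∀ a, φ (C.harmonicMap d a) = C.act QZ (φ a) := fun a => by
    ext x
    rw [C.act_apply, hφa, hφa, C.period_symm]
    by_cases hx : d ∣ C.period x
    · rw [if_pos hx, if_pos hx, smul_zero]
    · rw [if_neg hx, if_neg hx]; rfl
  rcases C.exists_rat_lift hd hl (n := φ f) (map_mem_fixedBy_of_intertwine hφ hf)
    (by rw [← map_nsmul, hr, map_zero])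
    (fun p hpd hpl => by rw [← aeval_intertwine hφ, hp p hpd hpl, map_zero])
    (fun x hx => by rw [hφa, if_pos hx]) with h0 | ⟨c, hc, N, hN, hNn, hNs⟩
  · refine ⟨0, zero_mem _, ⟨f.1, f.2, fun x hx => ?_⟩, Subtype.ext (by simp)⟩
    have := congrFun h0 x
    rwa [hφa, if_neg hx] at this
  · obtain ⟨M, hM1, hM2⟩ := C.exists_rat_solution d N
    have hMf := C.rat_solution_fixed hN hM1 hM2
    have hmem : toQZ ∘ M ∈ C.harmonicOn d := fun x hx => by
      rw [matOp_comp, Function.comp_apply, hM1 x hx, hNs x hx, map_zero]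
    refine ⟨⟨toQZ ∘ M, hmem⟩, C.mem_lowerFixed_harmonicMap hc hMf hmem,
      ⟨f.1 - toQZ ∘ M, sub_mem f.2 hmem, fun x hx => ?_⟩, rfl⟩
    have h3 := congrFun hNn x
    rw [hφa, if_neg hx, Function.comp_apply] at h3
    rw [Pi.sub_apply, Function.comp_apply, hM2 x hx, h3, sub_self]

/-- A grading of the cells whose period is divisible by `d`. -/
theorem exists_grading {d g : ℕ} (hg : ∀ k, d ∣ 2 * k → g ∣ k) : ∃ γ : X → ZMod g,
    (∀ x, d ∣ C.period x → γ (C.perm x) = γ x + 1) ∧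
    ∀ x y, d ∣ C.period x → d ∣ C.period y → C.mat x y ≠ 0 → γ x = γ y := by
  obtain ⟨R, hR, hperm, hmat, hper⟩ := C.connect d
  have hz : ∀ (k : ℤ) x y, R ((C.perm ^ k) x) ((C.perm ^ k) y) ↔ R x y := by
    intro k x y
    induction k with
    | zero => simp
    | succ k ih => rw [add_comm, zpow_add, zpow_one, Equiv.Perm.mul_apply, Equiv.Perm.mul_apply,
        hperm, ih]
    | pred k ih => 
      rw [← hperm, ← Equiv.Perm.mul_apply, ← Equiv.Perm.mul_apply, ← zpow_one_add]
      simpa using ih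
  have hdvd : ∀ x (k : ℤ), d ∣ C.period x → R x ((C.perm ^ k) x) → (k : ZMod g) = 0 := by
    intro x k hx h
    rw [ZMod.intCast_zmod_eq_zero_iff_dvd]
    obtain ⟨n, rfl | rfl⟩ := k.eq_nat_or_neg
    · exact Int.natCast_dvd_natCast.2 (hg n (hper x n hx (by simpa using h)))
    · rw [dvd_neg]
      refine Int.natCast_dvd_natCast.2 (hg n (hper x n hx ?_))
      rw [← hz n, ← Equiv.Perm.mul_apply, ← zpow_add, add_neg_cancel, zpow_zero] at h
      exact hR.symm h
  let S : Setoid X :=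
    { r := fun x y => ∃ k : ℤ, R ((C.perm ^ k) x) y
      iseqv := 
        { refl := fun x => ⟨0, by simpa using hR.refl x⟩
          symm := by
            rintro x y ⟨k, hk⟩
            refine ⟨-k, hR.symm ?_⟩
            rw [← hz (-k), ← Equiv.Perm.mul_apply, ← zpow_add, neg_add_cancel, zpow_zero] at hk
            exact hk
          trans := by
            rintro x y z ⟨k, hk⟩ ⟨j, hj⟩
            refine ⟨j + k, hR.trans ?_ hj⟩
            rw [zpow_add, Equiv.Perm.mul_apply]
            exact (hz j _ _).2 hk } }
  let rep : X → X := fun x => (Quotient.mk S x).out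
  have hrep : ∀ x, ∃ k : ℤ, R ((C.perm ^ k) (rep x)) x := fun x =>
    Quotient.exact (s := S) (Quotient.out_eq _)
  choose j hj using hrep
  have hsame : ∀ x y (a : ℤ), d ∣ C.period x → R ((C.perm ^ a) x) y →
      (j y : ZMod g) = j x + a := by
    intro x y a hx h
    have h1 : rep x = rep y := by
      have : Quotient.mk S x = Quotient.mk S y := Quotient.sound (s := S) ⟨a, h⟩
      simp only [rep, this]
    have h2 : R ((C.perm ^ (a + j x)) (rep x)) y := by
      refine hR.trans ?_ h
      rw [zpow_add, Equiv.Perm.mul_apply]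
      exact (hz a _ _).2 (hj x)
    have h3 : R ((C.perm ^ (a + j x)) (rep x)) ((C.perm ^ (j y)) (rep x)) := by
      refine hR.trans h2 (hR.symm ?_)
      rw [h1]; exact hj y
    have h4 : R x ((C.perm ^ (j y - a - j x)) x) := by
      have h5 := (hz (j y - a - j x) _ _).2 (hj x)
      have h6 := (hz (-a) _ _).2 h3
      rw [← Equiv.Perm.mul_apply, ← zpow_add] at h5
      rw [← Equiv.Perm.mul_apply, ← zpow_add, ← Equiv.Perm.mul_apply, ← zpow_add] at h6
      have e1 : j y - a - j x + j x = -a + j y := by ring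
      have e2 : -a + (a + j x) = j x := by ring
      rw [e1] at h5
      rw [e2] at h6
      exact hR.trans (hR.symm (hj x)) (hR.trans h6 h5)
    have h5 := hdvd x _ hx h4
    push_cast at h5
    linear_combination h5
  refine ⟨fun x => j x, fun x hx => ?_, fun x y hx hy hxy => ?_⟩
  · have := hsame x (C.perm x) 1 hx (by simpa using hR.refl _)
    simpa using this
  · have := hsame x y 0 hx (by simpa using hmat x y hx hy hxy)
    simpa using this.symm

theorem grRegular_supportedMap (d : ℕ) [NeZero d] : GrRegular (C.supportedMap d) d := by
  classical
  obtain ⟨g, hg0, hadm, hg⟩ : ∃ g, 0 < g ∧ CyclicGrading.Admissible d g ∧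
      ∀ k, d ∣ 2 * k → g ∣ k := by
    have hd := NeZero.pos d
    rcases Nat.even_or_odd d with h | h
    · obtain ⟨g, hg⟩ := h
      refine ⟨g, by omega, Or.inr (by omega), fun k hk => ?_⟩
      rw [hg, ← two_mul] at hk
      exact Nat.dvd_of_mul_dvd_mul_left (by norm_num) hk
    · exact ⟨d, hd, Or.inl ⟨rfl, h⟩, fun k hk =>
        (Nat.Coprime.dvd_mul_left (Nat.coprime_two_right.2 h)).1 hk⟩
  have : NeZero g := ⟨hg0.ne'⟩
  obtain ⟨γ, hγ1, hγ2⟩ := C.exists_grading hg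
  let K : Submodule ℤ (X → QZ) := C.harmonicOn d ⊓ C.supportedOn d
  let pr₀ : ZMod g → Module.End ℤ (X → QZ) := fun j =>
    { toFun := fun h x => if γ x = j then h x else 0
      map_add' := fun a b => by ext x; by_cases hx : γ x = j <;> simp [hx]
      map_smul' := fun n a => by ext x; by_cases hx : γ x = j <;> simp [hx] }
  have hpr₀ : ∀ j h x, pr₀ j h x = if γ x = j then h x else 0 := fun _ _ _ => rfl
  have hK : ∀ j, ∀ h ∈ K, pr₀ j h ∈ K := by
    intro j h hh
    refine ⟨fun x hx => ?_, fun x hx => ?_⟩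
    · have h1 : matOp C.mat QZ (pr₀ j h) x = if γ x = j then matOp C.mat QZ h x else 0 := by
        have h2 : ∀ y, C.mat x y • pr₀ j h y = if γ x = j then C.mat x y • h y else 0 := by
          intro y
          rw [hpr₀]
          by_cases hy : d ∣ C.period y
          · by_cases hxy : C.mat x y = 0
            · simp [hxy]
            · rw [hγ2 x y hx hy hxy]
              split_ifs <;> simp
          · rw [hh.2 y hy]; simp
        rw [matOp_apply, Finset.sum_congr rfl fun y _ => h2 y]
        split_ifs
        · rfl
        · simp
      rw [h1, hh.1 x hx, ite_self]
    · rw [hpr₀, hh.2 x hx, ite_self]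
  let G : CyclicGrading (C.supportedMap d) g :=
    { pr := fun j => (pr₀ j).restrict (hK j)
      sum_pr := fun a => by
        refine Subtype.ext (funext fun x => ?_)
        rw [AddSubmonoidClass.coe_finsetSum, Finset.sum_apply]
        change ∑ j, pr₀ j a.1 x = a.1 x
        simp [hpr₀]
      pr_pr := fun i j a => by
        refine Subtype.ext (funext fun x => ?_)
        change pr₀ i (pr₀ j a.1) x = _
        split_ifs with hij
        · subst hij
          change _ = pr₀ i a.1 x
          simp only [hpr₀]
          split_ifs <;> rfl
        · simp only [hpr₀]
          split_ifs with h1 h2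
          · exact absurd (h1.symm.trans h2) hij
          · rfl
          · rfl
      map_pr := fun j a => by
        refine Subtype.ext (funext fun x => ?_)
        change C.act QZ (pr₀ j a.1) x = pr₀ (j + 1) (C.act QZ a.1) x
        obtain ⟨y, rfl⟩ := C.perm.surjective x
        rw [hpr₀, C.act_apply_perm, C.act_apply_perm, hpr₀]
        by_cases hy : d ∣ C.period y
        · rw [hγ1 y hy]
          simp
        · rw [a.2.2 y hy]; simp }
  exact G.grRegular hadm

/-- The kernel of a cell system on `ℚ/ℤ`-valued functions has regular partial quotients. -/
theorem grRegular_kerMap (d : ℕ) [NeZero d] : GrRegular C.kerMap d := by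
  obtain ⟨e, he⟩ := C.exists_grEquiv_ker (NeZero.pos d)
  obtain ⟨e', he'⟩ := C.exists_grEquiv_supported (NeZero.pos d)
  exact GrRegular.of_addEquiv e he (GrRegular.of_addEquiv' e' he' (C.grRegular_supportedMap d))

end CellSystem


section Graphs

variable {V : Type u} {Γ : SimpleGraph V}

theorem iso_pow_coe (G : Γ ≃g Γ) (k : ℕ) (v : V) : (G ^ k) v = G^[k] v := by
  induction k generalizing v with
  | zero => rfl
  | succ k ih => rw [Function.iterate_succ_apply, ← ih, pow_succ]; rfl

/-- In a forest, the square of an automorphism that preserves the component of an edge does not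
invert it. -/
theorem no_inversion_sq (hΓ : Γ.IsAcyclic) (G : Γ ≃g Γ) {u v : V} (huv : Γ.Adj u v)
    (hr : Γ.Reachable u (G u)) : G (G u) ≠ v := by
  intro h
  obtain ⟨c⟩ := hΓ.colorable_two
  let c' : Γ.Coloring Bool := Γ.recolorOfEquiv finTwoEquiv c
  obtain ⟨w⟩ := hr
  let w' : Γ.Walk u (G (G u)) := w.append (w.map G.toHom)
  have h1 : Even w'.length := by
    refine ⟨w.length, ?_⟩
    rw [SimpleGraph.Walk.length_append, SimpleGraph.Walk.length_map]
  have h2 := (c'.even_length_iff_congr w').1 h1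
  rw [h] at h2
  exact c'.valid huv (Bool.eq_iff_iff.2 h2)

/-- An automorphism of a finite forest that maps a vertex into its own component fixes a vertex or
inverts an edge of that component. -/
theorem exists_fixed_or_inverted [Finite V] (hΓ : Γ.IsAcyclic) (G : Γ ≃g Γ) {u : V}
    (hr : Γ.Reachable u (G u)) :
    ∃ y, Γ.Reachable u y ∧ (G y = y ∨ (Γ.Adj y (G y) ∧ G (G y) = y)) := by
  classical
  have := Fintype.ofFinite V
  obtain ⟨y, hy, hmin⟩ := Set.exists_min_image {y | Γ.Reachable u y} (fun y => Γ.dist y (G y))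
    (Set.toFinite _) ⟨u, SimpleGraph.Reachable.refl _⟩
  have hyG : ∀ z, Γ.Reachable u z → Γ.Reachable z (G z) := fun z hz =>
    hz.symm.trans (hr.trans (G.reachable_iff.2 hz))
  refine ⟨y, hy, ?_⟩
  by_contra! hne
  obtain ⟨hne1, hne2⟩ := hne
  obtain ⟨p, hp, hpl⟩ := (hyG y hy).exists_path_of_dist
  have hnil : ¬ p.Nil := fun h => hne1 h.eq.symm
  have hlen : 0 < p.length := SimpleGraph.Walk.not_nil_iff_lt_length.1 hnil
  have hturn : p.penultimate ≠ G p.snd := by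
    intro h
    by_cases hn : p.length = 1
    · have h1 : p.snd = G y := by
        have := p.getVert_length
        rw [hn] at this; exact this
      have h2 : p.penultimate = y := by
        simp [SimpleGraph.Walk.penultimate, hn]
      have h3 : Γ.Adj y (G y) := by
        have := p.adj_snd hnil
        rwa [h1] at this
      exact hne2 h3 (by rw [← h1, ← h, h2])
    · have hsnd : Γ.Reachable u p.snd := hy.trans (p.adj_snd hnil).reachable
      have h1 := hmin p.snd hsnd
      have htn : ¬ p.tail.Nil := by
        rw [SimpleGraph.Walk.not_nil_iff_lt_length]
        have := SimpleGraph.Walk.length_tail_add_one hnil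
        omega
      have h2 : p.tail.penultimate = p.penultimate := by
        have := SimpleGraph.Walk.length_tail_add_one hnil
        simp only [SimpleGraph.Walk.penultimate, SimpleGraph.Walk.getVert_tail]
        congr 1
        have := SimpleGraph.Walk.not_nil_iff_lt_length.1 htn
        omega
      have h3 : Γ.dist p.snd (G p.snd) ≤ p.tail.dropLast.length := by
        rw [← h, ← h2]; exact SimpleGraph.dist_le _
      have h4 := SimpleGraph.Walk.length_tail_add_one hnil
      have h5 : p.tail.dropLast.length = p.tail.length - 1 := by simp
      have h6 := SimpleGraph.Walk.not_nil_iff_lt_length.1 htn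
      omega
  have key : ∀ k : ℕ, ∃ w : Γ.Walk y ((G^[k]) y), w.length = k * p.length ∧
      List.IsChain (· ≠ ·) w.edges ∧ (0 < k → w.edges.head? = some s(y, p.snd)) := by
    intro k
    induction k with
    | zero => exact ⟨SimpleGraph.Walk.nil, by simp, by simp, by simp⟩
    | succ k ih =>
      obtain ⟨w, hw1, hw2, hw3⟩ := ih
      have hphead : p.edges.head? = some s(y, p.snd) := by
        rw [← SimpleGraph.Walk.cons_tail_eq p hnil, SimpleGraph.Walk.edges_cons]
        simp
      have hplast : p.edges.getLast? = some s(p.penultimate, G y) := by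
        have := p.concat_dropLast (p.adj_penultimate hnil)
        rw [← this, SimpleGraph.Walk.edges_concat]
        simp
      refine ⟨(p.append (w.map G.toHom)).copy rfl (Function.iterate_succ_apply' G k y).symm,
        ?_, ?_, ?_⟩
      · rw [SimpleGraph.Walk.length_copy, SimpleGraph.Walk.length_append,
          SimpleGraph.Walk.length_map, hw1]
        ring
      · rw [SimpleGraph.Walk.edges_copy, SimpleGraph.Walk.edges_append,
          SimpleGraph.Walk.edges_map, List.isChain_append]
        refine ⟨(hΓ.isPath_iff_isChain p).1 hp, ?_, ?_⟩
        · rw [List.isChain_map]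
          refine hw2.imp fun a b hab h => hab ?_
          exact Sym2.map.injective G.injective h
        · intro a ha b hb
          rw [hplast, Option.mem_some_iff] at ha
          subst ha
          rcases Nat.eq_zero_or_pos k with hk | hk
          · have : w.edges = [] := by
              rw [← List.length_eq_zero_iff, SimpleGraph.Walk.length_edges, hw1, hk,
                zero_mul]
            rw [List.head?_map, this] at hb
            simp at hb
          · rw [List.head?_map, hw3 hk, Option.map_some, Option.mem_some_iff] at hb
            subst hb
            change s(p.penultimate, G y) ≠ s(G y, G p.snd)
            rw [Ne, Sym2.eq_iff]
            rintro (⟨h1, h2⟩ | ⟨h1, _⟩)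
            · exact (p.adj_snd hnil).ne (G.injective h2)
            · exact hturn h1
      · intro _
        rw [SimpleGraph.Walk.edges_copy, SimpleGraph.Walk.edges_append, List.head?_append, hphead]
        rfl
  obtain ⟨w, hw1, hw2, -⟩ := key (Fintype.card V)
  have h1 := ((hΓ.isPath_iff_isChain w).2 hw2).length_lt
  rw [hw1] at h1
  exact absurd h1 (not_lt.2 (Nat.le_mul_of_pos_right _ hlen))

end Graphs


namespace ForestPair

variable {V : Type u} (P : ForestPair V)

/-- The graph of the edges outside `S`. -/
def offGraph : SimpleGraph V where
  Adj := P.OffAdj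
  symm := ⟨fun _ _ h => h.symm⟩
  loopless := ⟨fun _ h => h.1.ne rfl⟩

theorem offGraph_adj {u v : V} : P.offGraph.Adj u v ↔ P.OffAdj u v := Iff.rfl

theorem offGraph_le : P.offGraph ≤ P.graph := fun _ _ h => h.1

theorem offGraph_isAcyclic : P.offGraph.IsAcyclic := P.isAcyclic.anti P.offGraph_le

/-- The vertex `v` is connected to `S` by edges outside `S`. -/
def Touches (v : V) : Prop := ∃ w ∈ P.S.verts, P.offGraph.Reachable v w

variable {P} in
theorem Touches.of_adj {u v : V} (hu : P.Touches u) (h : P.OffAdj u v) : P.Touches v := by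
  obtain ⟨w, hw, hr⟩ := hu
  exact ⟨w, hw, (SimpleGraph.Adj.reachable (P.offGraph_adj.2 h.symm)).trans hr⟩

/-- The vertices outside `S` that are connected to `S`. -/
abbrev TVert : Type u := {v : V // v ∉ P.S.verts ∧ P.Touches v}

/-- The edges outside `S` that are connected to `S`. -/
abbrev TEdge : Type u := {e : Sym2 V // e ∈ P.offGraph.edgeSet ∧ ∀ v ∈ e, P.Touches v}

/-- The cells outside `S` of the part of the forest that is connected to `S`. -/
abbrev TCell : Type u := P.TVert ⊕ P.TEdge

variable {P}

/-- The edge between two vertices. -/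
def TEdge.mk {u v : V} (h : P.OffAdj u v) (hu : P.Touches u) : P.TEdge :=
  ⟨s(u, v), h, fun w hw => by
    rcases Sym2.mem_iff.1 hw with rfl | rfl
    · exact hu
    · exact hu.of_adj h⟩

/-- The origin of an edge, for a fixed choice of orientations. -/
def TEdge.tail (e : P.TEdge) : V := (Quot.out e.1).1

/-- The end of an edge, for a fixed choice of orientations. -/
def TEdge.head (e : P.TEdge) : V := (Quot.out e.1).2

theorem TEdge.eq (e : P.TEdge) : s(e.tail, e.head) = e.1 := Quot.out_eq e.1

theorem TEdge.offAdj (e : P.TEdge) : P.OffAdj e.tail e.head := by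
  have h := e.2.1
  rwa [← e.eq] at h

theorem TEdge.tail_ne_head (e : P.TEdge) : e.tail ≠ e.head := e.offAdj.1.ne

theorem TEdge.tail_mem (e : P.TEdge) : e.tail ∈ e.1 := by rw [← e.eq]; simp

theorem TEdge.head_mem (e : P.TEdge) : e.head ∈ e.1 := by rw [← e.eq]; simp

theorem TEdge.mem_iff (e : P.TEdge) {v : V} : v ∈ e.1 ↔ v = e.tail ∨ v = e.head := by
  rw [← e.eq, Sym2.mem_iff]

open Classical in
/-- The incidence number of a vertex and an oriented edge. -/
def inc (v : V) (e : P.TEdge) : ℤ := (if e.head = v then 1 else 0) - (if e.tail = v then 1 else 0)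

theorem mem_of_inc_ne_zero {v : V} {e : P.TEdge} (h : inc v e ≠ 0) : v ∈ e.1 := by
  rw [e.mem_iff]
  by_contra! h'
  exact h (by simp [inc, Ne.symm h'.1, Ne.symm h'.2])

open Classical in
/-- The matrix `(f, s) ↦ (∂s, l s - δf)`. -/
def cellMat : P.TCell → P.TCell → ℤ
  | .inl _, .inl _ => 0
  | .inl v, .inr e => inc v.1 e
  | .inr e, .inl v => - inc v.1 e
  | .inr e, .inr e' => if e = e' then (P.length e.1 : ℤ) else 0

/-- The component of `T ∖ S` containing a cell. -/
def cellComponent : P.TCell → P.Components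
  | .inl v => P.cellGraph.connectedComponentMk (Sum.inl ⟨v.1, v.2.1⟩)
  | .inr e => P.edgeComponent e.offAdj

theorem edgeComponent_eq_of_mem {u v w : V} (h : P.OffAdj u v) (hw : w ∉ P.S.verts)
    (hm : w ∈ s(u, v)) :
    P.edgeComponent h = P.cellGraph.connectedComponentMk (Sum.inl ⟨w, hw⟩) := by
  rcases Sym2.mem_iff.1 hm with rfl | rfl
  · rw [← P.edgeComponent_symm h, P.edgeComponent_eq_vertex h.symm hw]
  · exact P.edgeComponent_eq_vertex h hw

theorem cellComponent_eq {v : P.TVert} {e : P.TEdge} (h : v.1 ∈ e.1) :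
    cellComponent (P := P) (Sum.inr e) = cellComponent (Sum.inl v) :=
  edgeComponent_eq_of_mem e.offAdj v.2.1 (by rwa [e.eq])

/-- The vertices in the closure of a cell of `T ∖ S`. -/
def cellPts : P.Cell → Set V
  | .inl v => {v.1}
  | .inr e => {w | w ∈ e.1}

theorem reachable_of_mem_cellPts {x : P.Cell} {u v : V} (hu : u ∈ cellPts x) (hv : v ∈ cellPts x) :
    P.graph.Reachable u v := by
  rcases x with w | ⟨e, he⟩
  · rw [cellPts, Set.mem_singleton_iff] at hu hv
    rw [hu, hv]
  · induction e using Sym2.ind with | _ a b =>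
    have hab : P.graph.Adj a b := he.1
    rcases Sym2.mem_iff.1 hu with rfl | rfl <;> rcases Sym2.mem_iff.1 hv with rfl | rfl
    · exact SimpleGraph.Reachable.refl _
    · exact hab.reachable
    · exact hab.symm.reachable
    · exact SimpleGraph.Reachable.refl _

theorem reachable_of_cellGraph_reachable {x y : P.Cell} (h : P.cellGraph.Reachable x y) :
    ∀ u ∈ cellPts x, ∀ v ∈ cellPts y, P.graph.Reachable u v := by
  obtain ⟨w⟩ := h
  induction w with
  | nil => exact fun u hu v hv => reachable_of_mem_cellPts hu hv
  | @cons x z y hxz w ih =>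
    intro u hu v hv
    obtain ⟨t, htx, htz⟩ : ∃ t, t ∈ cellPts x ∧ t ∈ cellPts z := by
      rcases ((SimpleGraph.fromRel_adj _ _ _).1 hxz).2 with ⟨t, e, rfl, rfl, h⟩ | ⟨t, e, rfl, rfl, h⟩
      · exact ⟨t.1, rfl, h⟩
      · exact ⟨t.1, h, rfl⟩
    exact (reachable_of_mem_cellPts hu htx).trans (ih t htz v hv)

end ForestPair

namespace BYForest

open ForestPair

variable {V : Type u} (T : BYForest V)

/-- The automorphism of the graph of the edges outside `S` induced by `F`. -/
def offIso : T.offGraph ≃g T.offGraph where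
  toEquiv := T.F.toEquiv
  map_rel_iff' := fun {a b} => T.offAdj_map a b

theorem touches_map (v : V) : T.Touches (T.F v) ↔ T.Touches v := by
  constructor
  · rintro ⟨w, hw, hr⟩
    refine ⟨T.F.symm w, ?_, ?_⟩
    · rwa [← T.map_verts, T.F.apply_symm_apply]
    · rw [← T.offIso.reachable_iff]
      change T.offGraph.Reachable (T.F v) (T.F (T.F.symm w))
      rwa [T.F.apply_symm_apply]
  · rintro ⟨w, hw, hr⟩
    exact ⟨T.F w, (T.map_verts w).2 hw, T.offIso.reachable_iff.2 hr⟩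

/-- The action on the vertices. -/
def vertPerm : Equiv.Perm T.TVert :=
  T.F.toEquiv.subtypeEquiv fun v => by
    rw [← T.touches_map v, ← T.map_verts v]; rfl

/-- The action on unordered pairs of vertices. -/
def symEquiv : Sym2 V ≃ Sym2 V where
  toFun := Sym2.map T.F
  invFun := Sym2.map T.F.symm
  left_inv e := by induction e using Sym2.ind with | _ a b => simp
  right_inv e := by induction e using Sym2.ind with | _ a b => simp

/-- The action on the edges. -/
def edgePerm : Equiv.Perm T.TEdge :=
  T.symEquiv.subtypeEquiv fun e => by
    induction e using Sym2.ind with | _ a b =>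
    change (T.OffAdj a b ∧ _) ↔ (T.OffAdj (T.F a) (T.F b) ∧ ∀ w ∈ s(T.F a, T.F b), T.Touches w)
    rw [T.offAdj_map]
    simp [T.touches_map]

theorem vertPerm_coe (v : T.TVert) : (T.vertPerm v).1 = T.F v.1 := rfl

theorem edgePerm_coe (e : T.TEdge) : (T.edgePerm e).1 = Sym2.map T.F e.1 := rfl

theorem edgePerm_eq (e : T.TEdge) : (T.edgePerm e).1 = s(T.F e.tail, T.F e.head) := by
  rw [edgePerm_coe, ← e.eq]; rfl

open Classical in
/-- The sign comparing the orientation of an edge with that of its image. -/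
def orient (e : T.TEdge) : ℤˣ := if (T.edgePerm e).tail = T.F e.tail then 1 else -1

theorem orient_cases (e : T.TEdge) :
    (T.orient e = 1 ∧ (T.edgePerm e).tail = T.F e.tail ∧ (T.edgePerm e).head = T.F e.head) ∨
    (T.orient e = -1 ∧ (T.edgePerm e).tail = T.F e.head ∧ (T.edgePerm e).head = T.F e.tail) := by
  have h : s((T.edgePerm e).tail, (T.edgePerm e).head) = s(T.F e.tail, T.F e.head) := by
    rw [TEdge.eq, edgePerm_eq]
  rcases Sym2.eq_iff.1 h with h | h
  · exact Or.inl ⟨if_pos h.1, h⟩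
  · refine Or.inr ⟨if_neg ?_, h⟩
    rw [h.1]
    exact fun h' => e.tail_ne_head (T.F.injective h').symm

/-- The action on the cells. -/
def cellPerm : Equiv.Perm T.TCell := Equiv.sumCongr T.vertPerm T.edgePerm

/-- The contribution of the orientations to the sign of a cell. -/
def cellOrient : T.TCell → ℤˣ
  | .inl _ => 1
  | .inr e => T.orient e

/-- The signed permutation of the cells. -/
def signedPerm : SignedPerm T.TCell where
  perm := T.cellPerm
  sgn x := T.sign (cellComponent x) * T.cellOrient x

open Classical in
theorem inc_map (v : V) (e : T.TEdge) : inc (T.F v) (T.edgePerm e) = T.orient e * inc v e := by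
  have hF : ∀ a, (if T.F a = T.F v then (1 : ℤ) else 0) = if a = v then 1 else 0 := fun a =>
    if_congr T.F.injective.eq_iff rfl rfl
  unfold inc
  rcases T.orient_cases e with ⟨h1, h2, h3⟩ | ⟨h1, h2, h3⟩
  · rw [h1, h2, h3, hF, hF, Units.val_one, one_mul]
  · rw [h1, h2, h3, hF, hF, Units.val_neg, Units.val_one, neg_mul, one_mul, neg_sub]

theorem length_edgePerm (e : T.TEdge) : T.length (T.edgePerm e).1 = T.length e.1 := by
  rw [edgePerm_eq, T.length_map _ _ e.offAdj.1, e.eq]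

theorem sign_mul_self (u : ℤˣ) : (u : ℤ) * u = 1 := by
  rw [← Units.val_mul, Int.units_mul_self, Units.val_one]

open Classical in
theorem cellMat_map (x y : T.TCell) : cellMat (T.signedPerm.perm x) (T.signedPerm.perm y) =
    T.signedPerm.sgn x * T.signedPerm.sgn y * cellMat x y := by
  have hve : ∀ (v : T.TVert) (e : T.TEdge), inc (T.vertPerm v).1 (T.edgePerm e) =
      (T.sign (cellComponent (Sum.inl v)) * T.cellOrient (Sum.inl v) : ℤˣ) *
      (T.sign (cellComponent (Sum.inr e)) * T.cellOrient (Sum.inr e) : ℤˣ) * inc v.1 e := by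
    intro v e
    rw [vertPerm_coe, inc_map]
    by_cases h : inc v.1 e = 0
    · rw [h]; simp
    · rw [cellComponent_eq (mem_of_inc_ne_zero h)]
      have := sign_mul_self (T.sign (cellComponent (Sum.inl v)))
      simp only [cellOrient, mul_one, Units.val_mul]
      linear_combination (-(T.orient e : ℤ) * inc v.1 e) * this
  rcases x with v | e <;> rcases y with w | e'
  · simp [cellMat, signedPerm, cellPerm]
  · exact hve v e'
  · change - inc (T.vertPerm w).1 (T.edgePerm e) = _ * _ * - inc w.1 e
    rw [hve]
    simp only [signedPerm]
    ring
  · change (if T.edgePerm e = T.edgePerm e' then _ else _) = _ * _ * (if e = e' then _ else _)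
    by_cases h : e = e'
    · subst h
      rw [if_pos rfl, if_pos rfl, length_edgePerm, sign_mul_self, one_mul]
    · rw [if_neg h, if_neg fun h' => h (T.edgePerm.injective h'), mul_zero]

/-- The action of `F` on the cells of `T ∖ S`. -/
def fullCellMap : T.Cell → T.Cell
  | .inl v => Sum.inl ⟨T.F v.1, fun h => v.2 ((T.map_verts _).1 h)⟩
  | .inr e => Sum.inr ⟨Sym2.map T.F e.1, by
      obtain ⟨e, he⟩ := e
      induction e using Sym2.ind with | _ a b =>
      exact (T.offAdj_map a b).2 he⟩

/-- The action of `F` on the cells of `T ∖ S` preserves incidence. -/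
def fullCellHom : T.cellGraph →g T.cellGraph where
  toFun := T.fullCellMap
  map_rel' := by
    intro x y h
    have hne : ∀ a b, T.fullCellMap (Sum.inl a) ≠ T.fullCellMap (Sum.inr b) := fun a b => by
      simp [fullCellMap]
    have hmem : ∀ (v : V) (e : Sym2 V), v ∈ e → T.F v ∈ Sym2.map T.F e := fun v e h =>
      Sym2.mem_map.2 ⟨v, h, rfl⟩
    refine (SimpleGraph.fromRel_adj _ _ _).2 ?_
    rcases ((SimpleGraph.fromRel_adj _ _ _).1 h).2 with ⟨t, e, rfl, rfl, i⟩ | ⟨t, e, rfl, rfl, i⟩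
    · exact ⟨hne _ _, Or.inl ⟨_, _, rfl, rfl, hmem _ _ i⟩⟩
    · exact ⟨(hne _ _).symm, Or.inr ⟨_, _, rfl, rfl, hmem _ _ i⟩⟩

/-- The action of `F` on the components of `T ∖ S`. -/
def componentMap : T.Components → T.Components :=
  SimpleGraph.ConnectedComponent.map T.fullCellHom

theorem cellComponent_perm (x : T.TCell) :
    cellComponent (T.cellPerm x) = T.componentMap (cellComponent x) := by
  rcases x with v | e
  · rfl
  · refine congrArg T.cellGraph.connectedComponentMk (congrArg Sum.inr (Subtype.ext ?_))
    change s((T.edgePerm e).tail, (T.edgePerm e).head) = s(T.F e.tail, T.F e.head)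
    rw [TEdge.eq, edgePerm_eq]

theorem cellComponent_perm_pow (k : ℕ) (x : T.TCell) :
    cellComponent ((T.cellPerm ^ k) x) = T.componentMap^[k] (cellComponent x) := by
  induction k with
  | zero => rfl
  | succ k ih =>
    rw [pow_succ', Equiv.Perm.mul_apply, cellComponent_perm, ih, Function.iterate_succ_apply']

theorem cellPerm_pow_inl (k : ℕ) (v : T.TVert) :
    (T.cellPerm ^ k) (Sum.inl v) = Sum.inl ((T.vertPerm ^ k) v) := by
  induction k with
  | zero => rfl
  | succ k ih => rw [pow_succ', pow_succ', Equiv.Perm.mul_apply, Equiv.Perm.mul_apply, ih]; rfl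

theorem cellPerm_pow_inr (k : ℕ) (e : T.TEdge) :
    (T.cellPerm ^ k) (Sum.inr e) = Sum.inr ((T.edgePerm ^ k) e) := by
  induction k with
  | zero => rfl
  | succ k ih => rw [pow_succ', pow_succ', Equiv.Perm.mul_apply, Equiv.Perm.mul_apply, ih]; rfl

theorem vertPerm_pow_coe (k : ℕ) (v : T.TVert) : ((T.vertPerm ^ k) v).1 = T.F^[k] v.1 := by
  induction k with
  | zero => rfl
  | succ k ih =>
    rw [pow_succ', Equiv.Perm.mul_apply, vertPerm_coe, ih, Function.iterate_succ_apply']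

theorem edgePerm_pow_coe (k : ℕ) (e : T.TEdge) :
    ((T.edgePerm ^ k) e).1 = s(T.F^[k] e.tail, T.F^[k] e.head) := by
  induction k with
  | zero => exact e.eq.symm
  | succ k ih =>
    rw [pow_succ', Equiv.Perm.mul_apply, edgePerm_coe, ih, Function.iterate_succ_apply',
      Function.iterate_succ_apply']
    rfl

/-- An even iterate `F^{2j}`, where `F^j` preserves the component of an edge, fixes the endpoints
of the edge as soon as it fixes the edge. -/
theorem iterate_tail_eq {e : T.TEdge} {j : ℕ}
    (hc : T.componentMap^[j] (cellComponent (Sum.inr e)) = cellComponent (Sum.inr e))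
    (he : (T.edgePerm ^ (2 * j)) e = e) : T.F^[2 * j] e.tail = e.tail ∧
      T.F^[2 * j] e.head = e.head := by
  have h1 := congrArg Subtype.val he
  rw [edgePerm_pow_coe, ← e.eq] at h1
  rcases Sym2.eq_iff.1 h1 with h | h
  · exact h
  exfalso
  have h2 : (T.F ^ j) ((T.F ^ j) e.tail) = e.head := by
    rw [iso_pow_coe, iso_pow_coe, ← Function.iterate_add_apply, ← two_mul]
    exact h.1
  refine no_inversion_sq T.isAcyclic (T.F ^ j) e.offAdj.1 ?_ h2
  rw [← cellComponent_perm_pow, cellPerm_pow_inr] at hc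
  refine reachable_of_cellGraph_reachable (SimpleGraph.ConnectedComponent.exact hc.symm) _ ?_ _ ?_
  · change e.tail ∈ s(e.tail, e.head)
    simp
  · change (T.F ^ j) e.tail ∈ s(((T.edgePerm ^ j) e).tail, ((T.edgePerm ^ j) e).head)
    rw [TEdge.eq, edgePerm_pow_coe, iso_pow_coe]
    simp

/-- The product of the orientation signs along an orbit. -/
def orientIter (k : ℕ) (x : T.TCell) : ℤˣ :=
  ∏ i ∈ Finset.range k, T.cellOrient ((T.cellPerm ^ i) x)

/-- The product of the component signs along an orbit. -/
def signIter (k : ℕ) (c : T.Components) : ℤˣ :=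
  ∏ i ∈ Finset.range k, T.sign (T.componentMap^[i] c)

theorem iter_eq (k : ℕ) (x : T.TCell) :
    T.signedPerm.iter k x = T.signIter k (cellComponent x) * T.orientIter k x := by
  unfold SignedPerm.iter signIter orientIter
  rw [← Finset.prod_mul_distrib]
  refine Finset.prod_congr rfl fun i _ => ?_
  rw [← cellComponent_perm_pow]
  rfl

theorem signIter_two_mul {j : ℕ} {c : T.Components} (hc : T.componentMap^[j] c = c) :
    T.signIter (2 * j) c = 1 := by
  unfold signIter
  rw [two_mul, Finset.prod_range_add]
  have : ∀ i, T.componentMap^[j + i] c = T.componentMap^[i] c := fun i => by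
    rw [add_comm, Function.iterate_add_apply, hc]
  simp only [this]
  exact Int.units_mul_self _

theorem orientIter_inr (k : ℕ) (e : T.TEdge) :
    (T.orientIter k (Sum.inr e) = 1 ∧ ((T.edgePerm ^ k) e).tail = T.F^[k] e.tail) ∨
    (T.orientIter k (Sum.inr e) = -1 ∧ ((T.edgePerm ^ k) e).tail = T.F^[k] e.head) := by
  have main : (T.orientIter k (Sum.inr e) = 1 ∧ ((T.edgePerm ^ k) e).tail = T.F^[k] e.tail ∧
      ((T.edgePerm ^ k) e).head = T.F^[k] e.head) ∨
    (T.orientIter k (Sum.inr e) = -1 ∧ ((T.edgePerm ^ k) e).tail = T.F^[k] e.head ∧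
      ((T.edgePerm ^ k) e).head = T.F^[k] e.tail) := by
    induction k with
    | zero => exact Or.inl ⟨by simp [orientIter], rfl, rfl⟩
    | succ k ih =>
      have h1 : T.orientIter (k + 1) (Sum.inr e) =
          T.orientIter k (Sum.inr e) * T.orient ((T.edgePerm ^ k) e) := by
        rw [orientIter, Finset.prod_range_succ, cellPerm_pow_inr]; rfl
      rw [h1, pow_succ', Equiv.Perm.mul_apply, Function.iterate_succ_apply',
        Function.iterate_succ_apply']
      rcases ih with ⟨a1, a2, a3⟩ | ⟨a1, a2, a3⟩ <;>
        rcases T.orient_cases ((T.edgePerm ^ k) e) with ⟨b1, b2, b3⟩ | ⟨b1, b2, b3⟩ <;>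
        rw [a1, b1, b2, b3, a2, a3] <;> simp
  rcases main with h | h
  · exact Or.inl ⟨h.1, h.2.1⟩
  · exact Or.inr ⟨h.1, h.2.1⟩

theorem iter_two_mul {j : ℕ} {x : T.TCell}
    (hc : T.componentMap^[j] (cellComponent x) = cellComponent x)
    (hx : (T.cellPerm ^ (2 * j)) x = x) : T.signedPerm.iter (2 * j) x = 1 := by
  rw [iter_eq, T.signIter_two_mul hc, one_mul]
  rcases x with v | e
  · exact Finset.prod_eq_one fun i _ => by rw [cellPerm_pow_inl]; rfl
  · rw [cellPerm_pow_inr, Sum.inr.injEq] at hx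
    have h1 := T.iterate_tail_eq hc hx
    rcases T.orientIter_inr (2 * j) e with h | h
    · exact h.1
    · rw [hx, h1.2] at h
      exact absurd h.2 e.tail_ne_head

/-- The period attached to a cell. -/
def cellPeriod (x : T.TCell) : ℕ :=
  Nat.lcm (2 * Function.minimalPeriod T.componentMap (cellComponent x))
    (Function.minimalPeriod T.cellPerm x)

theorem cellPerm_iterate (k : ℕ) (x : T.TCell) : T.cellPerm^[k] x = (T.cellPerm ^ k) x := by
  rw [Equiv.Perm.iterate_eq_pow]

section Finite

variable [Finite V]

theorem mem_periodicPts (x : T.TCell) : x ∈ Function.periodicPts T.cellPerm :=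
  T.cellPerm.injective.mem_periodicPts x

theorem component_mem_periodicPts (x : T.TCell) :
    cellComponent x ∈ Function.periodicPts T.componentMap := by
  obtain ⟨n, hn, h⟩ := T.mem_periodicPts x
  refine ⟨n, hn, ?_⟩
  have h' : (T.cellPerm ^ n) x = x := by rw [← cellPerm_iterate]; exact h
  have := T.cellComponent_perm_pow n x
  rw [h'] at this
  exact this.symm

theorem cellPeriod_pos (x : T.TCell) : 0 < T.cellPeriod x :=
  Nat.lcm_pos (Nat.mul_pos two_pos
    (Function.minimalPeriod_pos_of_mem_periodicPts (T.component_mem_periodicPts x)))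
    (Function.minimalPeriod_pos_of_mem_periodicPts (T.mem_periodicPts x))

theorem cellPeriod_perm (x : T.TCell) : T.cellPeriod (T.cellPerm x) = T.cellPeriod x := by
  unfold cellPeriod
  rw [cellComponent_perm, Function.minimalPeriod_apply (T.component_mem_periodicPts x),
    Function.minimalPeriod_apply (T.mem_periodicPts x)]

end Finite

theorem cellPerm_pow_cellPeriod (x : T.TCell) : (T.cellPerm ^ T.cellPeriod x) x = x := by
  rw [← cellPerm_iterate]
  exact (Function.isPeriodicPt_minimalPeriod T.cellPerm x).trans_dvd (Nat.dvd_lcm_right _ _)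

theorem exists_cellPeriod_eq (x : T.TCell) : ∃ j, T.cellPeriod x = 2 * j ∧
    T.componentMap^[j] (cellComponent x) = cellComponent x := by
  obtain ⟨m, hm⟩ := Nat.dvd_lcm_left
    (2 * Function.minimalPeriod T.componentMap (cellComponent x))
    (Function.minimalPeriod T.cellPerm x)
  refine ⟨Function.minimalPeriod T.componentMap (cellComponent x) * m, ?_, ?_⟩
  · rw [← mul_assoc, ← hm]; rfl
  · exact (Function.isPeriodicPt_minimalPeriod T.componentMap _).trans_dvd (dvd_mul_right _ _)

theorem iter_cellPeriod (x : T.TCell) : T.signedPerm.iter (T.cellPeriod x) x = 1 := by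
  obtain ⟨j, hj, hc⟩ := T.exists_cellPeriod_eq x
  have hx := T.cellPerm_pow_cellPeriod x
  rw [hj] at hx ⊢
  exact T.iter_two_mul hc hx

theorem cellPeriod_dvd {x : T.TCell} {k : ℕ} (hk : (T.cellPerm ^ k) x = x) :
    T.cellPeriod x ∣ 2 * k := by
  have h1 : Function.minimalPeriod T.cellPerm x ∣ k := by
    apply Function.IsPeriodicPt.minimalPeriod_dvd
    rw [← cellPerm_iterate] at hk; exact hk
  have h2 : Function.minimalPeriod T.componentMap (cellComponent x) ∣ k := by
    apply Function.IsPeriodicPt.minimalPeriod_dvd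
    have := T.cellComponent_perm_pow k x
    rw [hk] at this
    exact this.symm
  exact Nat.lcm_dvd (mul_dvd_mul_left 2 h2) (h1.mul_left 2)

/-- The period of a vertex divides the period of every edge containing it. -/
theorem cellPeriod_dvd_of_mem {v : T.TVert} {e : T.TEdge} (h : v.1 ∈ e.1) :
    T.cellPeriod (Sum.inl v) ∣ T.cellPeriod (Sum.inr e) := by
  have hcomp := cellComponent_eq h
  refine Nat.lcm_dvd ?_ ?_
  · rw [← hcomp]; exact Nat.dvd_lcm_left _ _
  · obtain ⟨j, hj, hc⟩ := T.exists_cellPeriod_eq (Sum.inr e)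
    have hx := T.cellPerm_pow_cellPeriod (Sum.inr e)
    rw [hj] at hx ⊢
    rw [cellPerm_pow_inr, Sum.inr.injEq] at hx
    have h1 := T.iterate_tail_eq hc hx
    apply Function.IsPeriodicPt.minimalPeriod_dvd
    change T.cellPerm^[2 * j] (Sum.inl v) = Sum.inl v
    rw [cellPerm_iterate, cellPerm_pow_inl]
    refine congrArg _ (Subtype.ext ?_)
    rw [vertPerm_pow_coe]
    rcases e.mem_iff.1 h with h | h
    · rw [h, h1.1]
    · rw [h, h1.2]

end BYForest


namespace ForestPair

variable {V : Type u} {P : ForestPair V}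

open Classical in
/-- The extension by zero of a function on the vertices outside `S` connected to `S`. -/
def extendVert {G : Type*} [AddCommGroup G] (f : P.TVert → G) (u : V) : G :=
  if h : u ∉ P.S.verts ∧ P.Touches u then f ⟨u, h⟩ else 0

theorem extendVert_coe {G : Type*} [AddCommGroup G] (f : P.TVert → G) (v : P.TVert) :
    extendVert f v.1 = f v := dif_pos v.2

theorem extendVert_of_mem {G : Type*} [AddCommGroup G] (f : P.TVert → G) {u : V}
    (hu : u ∈ P.S.verts) : extendVert f u = 0 := dif_neg fun h => h.1 hu

section Finite

variable [Finite V]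

instance : Fintype P.TVert := Fintype.ofFinite _

instance : Fintype P.TEdge := Fintype.ofFinite _

theorem sum_inc_smul {G : Type*} [AddCommGroup G] (f : P.TVert → G) (e : P.TEdge) :
    ∑ v : P.TVert, inc v.1 e • f v = extendVert f e.head - extendVert f e.tail := by
  classical
  have key : ∀ a : V, ∑ v : P.TVert, (if a = v.1 then (1 : ℤ) else 0) • f v = extendVert f a := by
    intro a
    by_cases h : a ∉ P.S.verts ∧ P.Touches a
    · rw [extendVert, dif_pos h, Finset.sum_eq_single ⟨a, h⟩]
      · simp
      · intro v _ hv
        rw [if_neg fun h' => hv (Subtype.ext h'.symm), zero_smul]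
      · simp
    · rw [extendVert, dif_neg h]
      refine Finset.sum_eq_zero fun v _ => ?_
      rw [if_neg, zero_smul]
      rintro rfl
      exact h v.2
  rw [← key, ← key, ← Finset.sum_sub_distrib]
  refine Finset.sum_congr rfl fun v _ => ?_
  rw [← sub_smul]
  unfold inc
  congr!

theorem matOp_cellMat_inl {G : Type*} [AddCommGroup G] (h : P.TCell → G) (v : P.TVert) :
    matOp cellMat G h (Sum.inl v) = ∑ e, inc v.1 e • h (Sum.inr e) := by
  rw [matOp_apply, Fintype.sum_sum_type]
  simp [cellMat]

theorem matOp_cellMat_inr {G : Type*} [AddCommGroup G] (h : P.TCell → G) (e : P.TEdge) :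
    matOp cellMat G h (Sum.inr e) = (P.length e.1 : ℤ) • h (Sum.inr e) -
      ∑ v : P.TVert, inc v.1 e • h (Sum.inl v) := by
  classical
  rw [matOp_apply, Fintype.sum_sum_type]
  simp only [cellMat, neg_smul, Finset.sum_neg_distrib, ite_smul, zero_smul]
  rw [Finset.sum_ite_eq]
  simp only [Finset.mem_univ, if_true]
  abel

theorem sum_mul_matOp_cellMat (h : P.TCell → ℚ) :
    ∑ x, h x * matOp cellMat ℚ h x = ∑ e : P.TEdge, P.length e.1 * h (Sum.inr e) ^ 2 := by
  rw [Fintype.sum_sum_type]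
  simp only [matOp_cellMat_inl, matOp_cellMat_inr, mul_sub, Finset.mul_sum,
    Finset.sum_sub_distrib]
  rw [Finset.sum_comm]
  have : ∀ (v : P.TVert) (e : P.TEdge), h (Sum.inl v) * (inc v.1 e • h (Sum.inr e)) =
      h (Sum.inr e) * (inc v.1 e • h (Sum.inl v)) := fun v e => by
    simp only [zsmul_eq_mul]; ring
  simp only [this, add_sub_cancel]
  refine Finset.sum_congr rfl fun e _ => ?_
  simp only [zsmul_eq_mul, Int.cast_natCast]
  ring

end Finite

/-- The vertices in the closure of a cell. -/
def ends : P.TCell → Set V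
  | .inl v => {v.1}
  | .inr e => {u | u ∈ e.1}

theorem offAdj_of_mem {u v : V} {e : P.TEdge} (hu : u ∈ e.1) (hv : v ∈ e.1) (h : u ≠ v) :
    P.OffAdj u v := by
  rcases e.mem_iff.1 hu with rfl | rfl <;> rcases e.mem_iff.1 hv with rfl | rfl
  · exact absurd rfl h
  · exact e.offAdj
  · exact e.offAdj.symm
  · exact absurd rfl h

/-- The part of the forest outside `S` spanned by a set of vertices. -/
def offGraphOn (P : ForestPair V) (good : V → Prop) : SimpleGraph V where
  Adj u v := P.OffAdj u v ∧ good u ∧ good v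
  symm := ⟨fun _ _ h => ⟨h.1.symm, h.2.2, h.2.1⟩⟩
  loopless := ⟨fun _ h => h.1.1.ne rfl⟩

theorem offGraphOn_isAcyclic (good : V → Prop) : (P.offGraphOn good).IsAcyclic :=
  P.offGraph_isAcyclic.anti fun _ _ h => h.1

theorem good_of_reachable {good : V → Prop} {u v : V} (hu : good u)
    (h : (P.offGraphOn good).Reachable u v) : good v := by
  obtain ⟨w⟩ := h
  induction w with
  | nil => exact hu
  | cons a _ ih => exact ih a.2.2

theorem reachable_of_mem_ends {good : V → Prop} {x : P.TCell} {u v : V} (hu : u ∈ ends x)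
    (hv : v ∈ ends x) (gu : good u) (gv : good v) : (P.offGraphOn good).Reachable u v := by
  by_cases h : u = v
  · rw [h]
  · rcases x with w | e
    · exact absurd (Eq.trans hu hv.symm) h
    · exact SimpleGraph.Adj.reachable ⟨offAdj_of_mem hu hv h, gu, gv⟩

end ForestPair

namespace BYForest

open ForestPair

variable {V : Type u} (T : BYForest V)

theorem mem_ends_perm (x : T.TCell) (u : V) : T.F u ∈ ends (T.cellPerm x) ↔ u ∈ ends x := by
  rcases x with v | e
  · change T.F u = T.F v.1 ↔ u = v.1
    exact T.F.injective.eq_iff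
  · change T.F u ∈ (T.edgePerm e).1 ↔ u ∈ e.1
    rw [edgePerm_coe, Sym2.mem_map]
    constructor
    · rintro ⟨a, ha, h⟩
      rwa [← T.F.injective h]
    · exact fun h => ⟨u, h, rfl⟩

theorem iterate_mem_ends (k : ℕ) {x : T.TCell} {u : V} (h : u ∈ ends x) :
    T.F^[k] u ∈ ends ((T.cellPerm ^ k) x) := by
  induction k with
  | zero => exact h
  | succ k ih =>
    rw [pow_succ', Equiv.Perm.mul_apply, Function.iterate_succ_apply', mem_ends_perm]
    exact ih

/-- The vertices outside `S` connected to `S` whose period is divisible by `d`. -/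
def PeriodDvd (d : ℕ) (u : V) : Prop := ∃ h, d ∣ T.cellPeriod (Sum.inl ⟨u, h⟩)

/-- Two cells are related if they are equal or joined by vertices with period divisible by `d`. -/
def CellRel (d : ℕ) (x y : T.TCell) : Prop :=
  x = y ∨ ∃ u ∈ ends x, ∃ v ∈ ends y, T.PeriodDvd d u ∧ T.PeriodDvd d v ∧
    (T.offGraphOn (T.PeriodDvd d)).Reachable u v

theorem cellRel_equivalence (d : ℕ) : Equivalence (T.CellRel d) where
  refl _ := Or.inl rfl
  symm := by
    rintro x y (h | ⟨u, hu, v, hv, gu, gv, h⟩)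
    · exact Or.inl h.symm
    · exact Or.inr ⟨v, hv, u, hu, gv, gu, h.symm⟩
  trans := by
    rintro x y z (rfl | ⟨u, hu, v, hv, gu, gv, h⟩) h2
    · exact h2
    rcases h2 with rfl | ⟨u', hu', v', hv', gu', gv', h'⟩
    · exact Or.inr ⟨u, hu, v, hv, gu, gv, h⟩
    · exact Or.inr ⟨u, hu, v', hv', gu, gv', h.trans
        ((reachable_of_mem_ends hv hu' gv gu').trans h')⟩

theorem cellRel_of_mat {d : ℕ} {x y : T.TCell} (hx : d ∣ T.cellPeriod x) (hy : d ∣ T.cellPeriod y)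
    (h : cellMat x y ≠ 0) : T.CellRel d x y := by
  rcases x with v | e <;> rcases y with w | e'
  · exact absurd rfl h
  · exact Or.inr ⟨v.1, rfl, v.1, mem_of_inc_ne_zero h, ⟨v.2, hx⟩, ⟨v.2, hx⟩,
      SimpleGraph.Reachable.refl _⟩
  · exact Or.inr ⟨w.1, mem_of_inc_ne_zero (neg_ne_zero.1 h), w.1, rfl, ⟨w.2, hy⟩, ⟨w.2, hy⟩,
      SimpleGraph.Reachable.refl _⟩
  · refine Or.inl (congrArg _ ?_)
    by_contra h'
    exact h (if_neg h')

section Finite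

variable [Finite V]

theorem periodDvd_map (d : ℕ) (u : V) : T.PeriodDvd d (T.F u) ↔ T.PeriodDvd d u := by
  constructor
  · rintro ⟨h, hd⟩
    have h' : u ∉ T.S.verts ∧ T.Touches u := by
      rwa [← T.touches_map u, ← T.map_verts u]
    exact ⟨h', by rw [← T.cellPeriod_perm]; exact hd⟩
  · rintro ⟨h, hd⟩
    rw [← T.cellPeriod_perm] at hd
    exact ⟨(T.vertPerm ⟨u, h⟩).2, hd⟩

/-- The automorphism induced by `F` on the graph of the vertices with period divisible by `d`. -/
def periodIso (d : ℕ) : T.offGraphOn (T.PeriodDvd d) ≃g T.offGraphOn (T.PeriodDvd d) where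
  toEquiv := T.F.toEquiv
  map_rel_iff' := fun {a b} =>
    and_congr (T.offAdj_map a b) (and_congr (T.periodDvd_map d a) (T.periodDvd_map d b))

theorem periodIso_iterate (d k : ℕ) (u : V) : (T.periodIso d ^ k) u = T.F^[k] u := by
  rw [iso_pow_coe]; rfl

theorem cellRel_perm (d : ℕ) (x y : T.TCell) :
    T.CellRel d (T.cellPerm x) (T.cellPerm y) ↔ T.CellRel d x y := by
  refine or_congr T.cellPerm.injective.eq_iff ?_
  constructor
  · rintro ⟨u, hu, v, hv, gu, gv, h⟩
    obtain ⟨u, rfl⟩ := T.F.surjective u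
    obtain ⟨v, rfl⟩ := T.F.surjective v
    exact ⟨u, (T.mem_ends_perm x u).1 hu, v, (T.mem_ends_perm y v).1 hv,
      (T.periodDvd_map d u).1 gu, (T.periodDvd_map d v).1 gv, (T.periodIso d).reachable_iff.1 h⟩
  · rintro ⟨u, hu, v, hv, gu, gv, h⟩
    exact ⟨T.F u, (T.mem_ends_perm x u).2 hu, T.F v, (T.mem_ends_perm y v).2 hv,
      (T.periodDvd_map d u).2 gu, (T.periodDvd_map d v).2 gv, (T.periodIso d).reachable_iff.2 h⟩

theorem dvd_of_cellRel {d k : ℕ} {x : T.TCell} (hx : d ∣ T.cellPeriod x)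
    (h : T.CellRel d x ((T.cellPerm ^ k) x)) : d ∣ 2 * k := by
  rcases h with h | ⟨u, hu, v, hv, gu, gv, h⟩
  · exact hx.trans (T.cellPeriod_dvd h.symm)
  have gFu : T.PeriodDvd d (T.F^[k] u) := by
    clear h hu hv
    induction k with
    | zero => exact gu
    | succ k ih => rw [Function.iterate_succ_apply', periodDvd_map]; exact ih
  have h1 := h.trans (reachable_of_mem_ends hv (T.iterate_mem_ends k hu) gv gFu)
  rw [← periodIso_iterate] at h1
  obtain ⟨y, hy, h2⟩ := exists_fixed_or_inverted (offGraphOn_isAcyclic _) _ h1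
  obtain ⟨hy', gy⟩ := good_of_reachable gu hy
  rw [periodIso_iterate] at h2
  rcases h2 with h2 | ⟨h2, h3⟩
  · refine gy.trans (T.cellPeriod_dvd ?_)
    rw [cellPerm_pow_inl]
    exact congrArg Sum.inl (Subtype.ext (by rw [vertPerm_pow_coe, h2]))
  · rw [periodIso_iterate] at h3
    let e : T.TEdge := TEdge.mk h2.1 hy'.2
    have he : y ∈ e.1 := by simp [e, TEdge.mk]
    refine (gy.trans (T.cellPeriod_dvd_of_mem (e := e) he)).trans (T.cellPeriod_dvd ?_)
    rw [cellPerm_pow_inr]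
    refine congrArg Sum.inr (Subtype.ext ?_)
    have h4 : ∀ a b : V, ∀ e' : T.TEdge, e'.1 = s(a, b) →
        ((T.edgePerm ^ k) e').1 = s(T.F^[k] a, T.F^[k] b) := by
      intro a b e' h
      rw [edgePerm_pow_coe]
      rw [← e'.eq] at h
      rcases Sym2.eq_iff.1 h with ⟨h, h'⟩ | ⟨h, h'⟩ <;> rw [h, h']
      exact Sym2.eq_swap
    rw [h4 y (T.F^[k] y) e rfl, h3]
    exact Sym2.eq_swap

theorem cellMat_nondeg (d : ℕ) (h : T.TCell → ℚ) (h1 : ∀ x, ¬ d ∣ T.cellPeriod x → h x = 0)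
    (h2 : ∀ x, d ∣ T.cellPeriod x → matOp cellMat ℚ h x = 0) : h = 0 := by
  have h3 : ∑ x, h x * matOp cellMat ℚ h x = 0 := Finset.sum_eq_zero fun x _ => by
    by_cases hx : d ∣ T.cellPeriod x
    · rw [h2 x hx, mul_zero]
    · rw [h1 x hx, zero_mul]
  have hpos : ∀ e : T.TEdge, 0 < T.length e.1 := fun e => T.length_pos _ (by
    rw [← e.eq]; exact e.offAdj.1)
  have h4 : ∀ e : T.TEdge, h (Sum.inr e) = 0 := by
    rw [sum_mul_matOp_cellMat, Finset.sum_eq_zero_iff_of_nonneg (fun e _ => by positivity)] at h3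
    intro e
    have := h3 e (Finset.mem_univ _)
    simpa [(hpos e).ne'] using this
  have h5 : ∀ e : T.TEdge, d ∣ T.cellPeriod (Sum.inr e) →
      extendVert (h ∘ Sum.inl) e.head = extendVert (h ∘ Sum.inl) e.tail := by
    intro e he
    have := h2 _ he
    rw [matOp_cellMat_inr, h4, smul_zero, zero_sub, neg_eq_zero] at this
    rw [← sub_eq_zero, ← sum_inc_smul]
    exact this
  have h6 : ∀ u w : V, T.offGraph.Walk u w → w ∈ T.S.verts →
      extendVert (P := T.toForestPair) (h ∘ Sum.inl) u = 0 := by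
    intro u w p hw
    induction p with
    | nil => exact extendVert_of_mem _ hw
    | @cons u v w a p ih =>
      by_contra hne
      have hu : u ∉ T.S.verts ∧ T.Touches u := by
        by_contra h'
        exact hne (dif_neg h')
      have hd : d ∣ T.cellPeriod (Sum.inl ⟨u, hu⟩) := by
        by_contra h'
        refine hne ((extendVert_coe _ (⟨u, hu⟩ : T.TVert)).trans (h1 _ h'))
      let e : T.TEdge := TEdge.mk a hu.2
      have := h5 e (hd.trans (T.cellPeriod_dvd_of_mem (e := e) (by simp [e, TEdge.mk])))
      have h7 : s(e.tail, e.head) = s(u, v) := e.eq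
      rcases Sym2.eq_iff.1 h7 with ⟨h8, h9⟩ | ⟨h8, h9⟩ <;> rw [h8, h9, ih hw] at this
      · exact hne this.symm
      · exact hne this
  funext x
  rcases x with v | e
  · obtain ⟨w, hw, ⟨p⟩⟩ := v.2.2
    exact (extendVert_coe _ v).symm.trans (h6 _ _ p hw)
  · exact h4 e

/-- The system of cells of a BY forest. -/
def cellSystem : CellSystem T.TCell where
  toSignedPerm := T.signedPerm
  mat := cellMat
  mat_equivariant := T.cellMat_map
  period := T.cellPeriod
  period_pos := T.cellPeriod_pos
  period_perm := T.cellPeriod_perm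
  perm_pow_period := T.cellPerm_pow_cellPeriod
  iter_period := T.iter_cellPeriod
  period_dvd _ _ := T.cellPeriod_dvd
  nondeg := T.cellMat_nondeg
  connect d := ⟨T.CellRel d, T.cellRel_equivalence d, T.cellRel_perm d,
    fun _ _ => T.cellRel_of_mat, fun _ _ => T.dvd_of_cellRel⟩

end Finite

end BYForest


namespace ForestPair

variable {V : Type u} [Fintype V] {P : ForestPair V}

/-- A relative cycle vanishes on the edges that are not connected to `S`. -/
theorem touches_of_ne_zero (c : P.Lattice) {v w : V} (h : c.1.1 v w ≠ 0) : P.Touches v := by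
  classical
  by_contra hv
  have hadj : P.OffAdj v w := by
    by_contra h'
    exact h (c.1.2.2 _ _ h')
  have hw : ¬ P.Touches w := fun hw => hv (hw.of_adj hadj.symm)
  let Γ := P.offGraph.deleteEdges {s(v, w)}
  have hle : Γ ≤ P.offGraph := SimpleGraph.deleteEdges_le _
  have hvw : ¬ Γ.Reachable w v := fun hr =>
    SimpleGraph.isBridge_iff.1 (SimpleGraph.isAcyclic_iff_forall_adj_isBridge.1
      P.offGraph_isAcyclic hadj) hr.symm
  let χ : V → ℤ := fun u => if Γ.Reachable w u then 1 else 0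
  have hχv : χ v = 0 := if_neg hvw
  have hχw : χ w = 1 := if_pos (SimpleGraph.Reachable.refl _)
  have hχ : ∀ a b, P.OffAdj a b → s(a, b) ≠ s(v, w) → χ a = χ b := by
    intro a b hab hne
    have : Γ.Adj a b := (SimpleGraph.deleteEdges_adj).2 ⟨hab, hne⟩
    exact if_congr ⟨fun h => h.trans this.reachable, fun h => h.trans this.symm.reachable⟩ rfl rfl
  have h0 : ∑ b, χ b * ∑ a, c.1.1 a b = 0 := by
    refine Finset.sum_eq_zero fun b _ => ?_
    by_cases hb : b ∈ P.S.verts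
    · have : χ b = 0 := if_neg fun hr => hw ⟨b, hb, hr.mono hle⟩
      rw [this, zero_mul]
    · have := congrFun (LinearMap.mem_ker.1 c.2) ⟨b, hb⟩
      change ∑ a, c.1.1 a b = 0 at this
      rw [this, mul_zero]
  have h1 : ∑ b, ∑ a, (χ b - χ a) * c.1.1 a b = 0 := by
    have h2 : ∑ b, ∑ a, χ a * c.1.1 a b = - ∑ b, χ b * ∑ a, c.1.1 a b := by
      rw [Finset.sum_comm, ← Finset.sum_neg_distrib]
      refine Finset.sum_congr rfl fun a _ => ?_
      rw [← mul_neg, ← Finset.sum_neg_distrib, Finset.mul_sum]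
      refine Finset.sum_congr rfl fun b _ => ?_
      rw [c.1.2.1 b a]
    simp only [sub_mul, Finset.sum_sub_distrib, h2, ← Finset.mul_sum, h0]
    simp
  have h3 : ∀ b a, (χ b - χ a) * c.1.1 a b =
      (if b = w then if a = v then c.1.1 v w else 0 else 0) +
      (if b = v then if a = w then c.1.1 v w else 0 else 0) := by
    intro b a
    by_cases hab : P.OffAdj a b
    · by_cases he : s(a, b) = s(v, w)
      · rcases Sym2.eq_iff.1 he with ⟨rfl, rfl⟩ | ⟨rfl, rfl⟩
        · simp [hχv, hχw, hab.1.ne]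
        · rw [hχv, hχw, c.1.2.1 b a]
          simp [hab.1.ne]
      · rw [hχ a b hab he, sub_self, zero_mul]
        split_ifs <;> simp_all
    · rw [c.1.2.2 a b hab, mul_zero]
      have hvw' : ¬ (b = w ∧ a = v) := by
        rintro ⟨rfl, rfl⟩
        exact hab hadj
      have hwv' : ¬ (b = v ∧ a = w) := by
        rintro ⟨rfl, rfl⟩
        exact hab hadj.symm
      rw [← ite_and, ← ite_and, if_neg hvw', if_neg hwv', add_zero]
  simp only [h3, Finset.sum_add_distrib] at h1
  simp at h1
  exact h h1

/-- The coordinates of a chain. -/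
def coord : P.chains →ₗ[ℤ] (P.TEdge → ℤ) where
  toFun c e := c.1 e.tail e.head
  map_add' _ _ := rfl
  map_smul' _ _ := rfl

open Classical in
/-- The chain with given coordinates. -/
def mkChain (s : P.TEdge → ℤ) : P.chains :=
  ⟨fun u v => ∑ e : P.TEdge, s e * ((if e.tail = u ∧ e.head = v then 1 else 0) -
    (if e.tail = v ∧ e.head = u then 1 else 0)), fun u v => by
      rw [← Finset.sum_neg_distrib]
      exact Finset.sum_congr rfl fun e _ => by ring, fun u v h => by
      refine Finset.sum_eq_zero fun e _ => ?_
      rw [if_neg, if_neg, sub_self, mul_zero]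
      · rintro ⟨rfl, rfl⟩
        exact h e.offAdj.symm
      · rintro ⟨rfl, rfl⟩
        exact h e.offAdj⟩

theorem coord_mkChain (s : P.TEdge → ℤ) : coord (mkChain s) = s := by
  classical
  funext e
  change ∑ e' : P.TEdge, _ = _
  rw [Finset.sum_eq_single e]
  · rw [if_pos ⟨rfl, rfl⟩, if_neg fun h => e.tail_ne_head h.1, sub_zero, mul_one]
  · intro e' _ hne
    rw [if_neg, if_neg, sub_self, mul_zero]
    · rintro ⟨h1, h2⟩
      exact hne (Subtype.ext (by rw [← e'.eq, ← e.eq, h1, h2, Sym2.eq_swap]))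
    · rintro ⟨h1, h2⟩
      exact hne (Subtype.ext (by rw [← e'.eq, ← e.eq, h1, h2]))
  · simp

/-- The boundary map in coordinates. -/
def bd : (P.TEdge → ℤ) →ₗ[ℤ] (P.TVert → ℤ) where
  toFun s v := ∑ e, inc v.1 e * s e
  map_add' s t := by ext v; simp [mul_add, Finset.sum_add_distrib]
  map_smul' n s := by
    ext v
    simp only [Pi.smul_apply, smul_eq_mul, Finset.mul_sum, RingHom.id_apply]
    exact Finset.sum_congr rfl fun e _ => by ring

theorem boundary_mkChain (s : P.TEdge → ℤ) (v : {v : V // v ∉ P.S.verts}) :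
    P.boundary (mkChain s) v = ∑ e, inc v.1 e * s e := by
  classical
  change ∑ u, ∑ e : P.TEdge, _ = _
  rw [Finset.sum_comm]
  refine Finset.sum_congr rfl fun e _ => ?_
  rw [← Finset.mul_sum, mul_comm, Finset.sum_sub_distrib]
  congr 1
  simp only [ite_and, inc]
  rw [Finset.sum_ite_eq]
  by_cases h : e.tail = v.1 <;> simp [h]

theorem mkChain_coord (c : P.Lattice) : mkChain (coord c.1) = c.1 := by
  refine Subtype.ext (funext fun u => funext fun v => ?_)
  by_cases h : P.OffAdj u v ∧ P.Touches u
  · let e : P.TEdge := TEdge.mk h.1 h.2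
    have he : s(e.tail, e.head) = s(u, v) := e.eq
    have h1 : coord (mkChain (coord c.1)) e = coord c.1 e := by rw [coord_mkChain]
    change (mkChain (coord c.1)).1 e.tail e.head = c.1.1 e.tail e.head at h1
    rcases Sym2.eq_iff.1 he with ⟨h2, h3⟩ | ⟨h2, h3⟩
    · rwa [h2, h3] at h1
    · rw [h2, h3, (mkChain (coord c.1)).2.1 u v, c.1.2.1 u v] at h1
      exact neg_injective h1
  · have h1 : c.1.1 u v = 0 := by
      by_contra h'
      refine h ⟨?_, touches_of_ne_zero c h'⟩
      by_contra h2
      exact h' (c.1.2.2 u v h2)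
    rw [h1]
    refine Finset.sum_eq_zero fun e _ => ?_
    rw [if_neg, if_neg, sub_self, mul_zero]
    · rintro ⟨rfl, rfl⟩
      exact h ⟨e.offAdj.symm, e.2.2 _ e.head_mem⟩
    · rintro ⟨rfl, rfl⟩
      exact h ⟨e.offAdj, e.2.2 _ e.tail_mem⟩

theorem bd_coord (c : P.Lattice) : bd (coord c.1) = 0 := by
  funext v
  have h := boundary_mkChain (coord c.1) ⟨v.1, v.2.1⟩
  rw [mkChain_coord, LinearMap.mem_ker.1 c.2] at h
  exact h.symm

theorem mkChain_mem {s : P.TEdge → ℤ} (hs : bd s = 0) : mkChain s ∈ LinearMap.ker P.boundary := by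
  rw [LinearMap.mem_ker]
  funext v
  rw [boundary_mkChain]
  by_cases hv : P.Touches v.1
  · exact congrFun hs ⟨v.1, v.2, hv⟩
  · refine Finset.sum_eq_zero fun e _ => ?_
    have : inc v.1 e = 0 := by
      by_contra h
      exact hv (e.2.2 _ (mem_of_inc_ne_zero h))
    rw [this, zero_mul]

theorem toDual_eq_sum (a b : P.Lattice) :
    P.toDual a b = ∑ e : P.TEdge, (P.length e.1 : ℤ) * (coord a.1 e * coord b.1 e) := by
  rw [toDual_apply]
  symm
  refine Finset.sum_of_injOn (fun e : P.TEdge => e.1) (fun _ _ _ _ h => Subtype.ext h)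
    (fun _ _ => Finset.mem_coe.2 (Finset.mem_univ _)) ?_ ?_
  · intro e _ he
    induction e using Sym2.ind with | _ u v =>
    by_contra h
    rw [edgeProd_mk] at h
    have h1 : a.1.1 u v ≠ 0 := left_ne_zero_of_mul (right_ne_zero_of_mul h)
    have h2 : P.OffAdj u v := by
      by_contra h2
      exact h1 (a.1.2.2 u v h2)
    exact he ⟨TEdge.mk h2 (touches_of_ne_zero a h1), by simp, rfl⟩
  · intro e _
    conv_rhs => rw [← e.eq]
    rw [edgeProd_mk, e.eq]
    rfl

theorem exists_bd_eq_indicator {u w : V} (p : P.offGraph.Walk u w) (hw : w ∈ P.S.verts) :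
    ∃ s : P.TEdge → ℤ, ∀ v : P.TVert, (u = v.1 → bd s v = 1) ∧ (u ≠ v.1 → bd s v = 0) := by
  classical
  have hbd : ∀ (e : P.TEdge) (v : P.TVert), bd (Pi.single e 1) v = inc v.1 e := fun e v => by
    change ∑ e', inc v.1 e' * (Pi.single e 1 : P.TEdge → ℤ) e' = _
    rw [Finset.sum_eq_single e]
    · simp
    · intro e' _ hne
      simp [hne]
    · simp
  induction p with
  | nil =>
    refine ⟨0, fun v => ⟨?_, fun _ => by simp⟩⟩
    rintro rfl
    exact absurd hw v.2.1
  | @cons u u' w a p ih =>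
    obtain ⟨s, hs⟩ := ih hw
    let e : P.TEdge := TEdge.mk a ⟨w, hw, ⟨SimpleGraph.Walk.cons a p⟩⟩
    have he : s(e.tail, e.head) = s(u, u') := e.eq
    have hne : u ≠ u' := a.1.ne
    rcases Sym2.eq_iff.1 he with ⟨h1, h2⟩ | ⟨h1, h2⟩
    · refine ⟨s - Pi.single e 1, fun v => ?_⟩
      rw [map_sub, Pi.sub_apply, hbd, inc, h1, h2]
      by_cases h3 : u = v.1
      · have h4 : u' ≠ v.1 := fun h => hne (h3.trans h.symm)
        simp [h3, h4, (hs v).2 h4]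
      · by_cases h4 : u' = v.1
        · simp [h3, h4, (hs v).1 h4]
        · simp [h3, h4, (hs v).2 h4]
    · refine ⟨s + Pi.single e 1, fun v => ?_⟩
      rw [map_add, Pi.add_apply, hbd, inc, h1, h2]
      by_cases h3 : u = v.1
      · have h4 : u' ≠ v.1 := fun h => hne (h3.trans h.symm)
        simp [h3, h4, (hs v).2 h4]
      · by_cases h4 : u' = v.1
        · simp [h3, h4, (hs v).1 h4]
        · simp [h3, h4, (hs v).2 h4]

theorem bd_surjective : Function.Surjective (bd (P := P)) := by
  classical
  have h : ∀ v : P.TVert, ∃ s : P.TEdge → ℤ, bd s = Pi.single v 1 := fun v => by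
    obtain ⟨w, hw, ⟨p⟩⟩ := v.2.2
    obtain ⟨s, hs⟩ := exists_bd_eq_indicator p hw
    refine ⟨s, funext fun v' => ?_⟩
    by_cases h : v' = v
    · subst h
      rw [(hs v').1 rfl, Pi.single_eq_same]
    · rw [(hs v').2 fun h' => h (Subtype.ext h'.symm), Pi.single_eq_of_ne h]
  choose s hs using h
  intro n
  refine ⟨∑ v, n v • s v, ?_⟩
  rw [map_sum]
  simp only [map_smul, hs]
  funext v
  simp [Finset.sum_apply, Pi.single_apply]

theorem exists_section : ∃ g : (P.TVert → ℤ) →ₗ[ℤ] (P.TEdge → ℤ), ∀ n, bd (g n) = n := by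
  obtain ⟨g, hg⟩ := Module.projective_lifting_property (bd (P := P)) LinearMap.id bd_surjective
  exact ⟨g, fun n => LinearMap.congr_fun hg n⟩

/-- A section of the boundary map. -/
def bdSection : (P.TVert → ℤ) →ₗ[ℤ] (P.TEdge → ℤ) := exists_section.choose

theorem bd_bdSection (n : P.TVert → ℤ) : bd (bdSection n) = n := exists_section.choose_spec n

theorem coord_injective (a b : P.Lattice) (h : coord a.1 = coord b.1) : a = b :=
  Subtype.ext (by rw [← mkChain_coord a, h, mkChain_coord])

/-- A retraction of the group of edge functions onto the lattice. -/
def retraction : (P.TEdge → ℤ) →ₗ[ℤ] P.Lattice where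
  toFun t := ⟨mkChain (t - bdSection (bd t)), mkChain_mem (by rw [map_sub, bd_bdSection, sub_self])⟩
  map_add' s t := coord_injective _ _ (by
    change coord (mkChain _) = coord (mkChain _) + coord (mkChain _)
    rw [coord_mkChain, coord_mkChain, coord_mkChain, map_add, map_add]
    abel)
  map_smul' n t := coord_injective _ _ (by
    change coord (mkChain _) = n • coord (mkChain _)
    rw [coord_mkChain, coord_mkChain, map_smul, map_smul, smul_sub])

theorem coord_retraction (t : P.TEdge → ℤ) :
    coord (retraction t).1 = t - bdSection (bd t) := coord_mkChain _

theorem retraction_coord (c : P.Lattice) : retraction (coord c.1) = c :=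
  coord_injective _ _ (by rw [coord_retraction, bd_coord, map_zero, sub_zero])

/-- The functional on the lattice defined by a function on the edges. -/
def edgeDual : (P.TEdge → ℤ) →ₗ[ℤ] Module.Dual ℤ P.Lattice :=
  LinearMap.mk₂ ℤ (fun t c => ∑ e, t e * coord c.1 e)
    (fun s t c => by simp [add_mul, Finset.sum_add_distrib])
    (fun n s c => by simp [Finset.mul_sum, mul_assoc])
    (fun s c c' => by simp [mul_add, Finset.sum_add_distrib])
    (fun n s c => by
      simp only [Submodule.coe_smul, map_smul, Pi.smul_apply, smul_eq_mul, Finset.mul_sum]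
      exact Finset.sum_congr rfl fun e _ => by ring)

theorem edgeDual_apply (t : P.TEdge → ℤ) (c : P.Lattice) :
    edgeDual t c = ∑ e, t e * coord c.1 e := rfl

theorem edgeDual_surjective : Function.Surjective (edgeDual (P := P)) := by
  classical
  intro φ
  refine ⟨fun e => φ (retraction (Pi.single e 1)), LinearMap.ext fun c => ?_⟩
  have h := LinearMap.pi_apply_eq_sum_univ (φ ∘ₗ retraction) (coord c.1)
  rw [LinearMap.comp_apply, retraction_coord] at h
  rw [h, edgeDual_apply]
  refine Finset.sum_congr rfl fun e _ => ?_
  rw [LinearMap.comp_apply, smul_eq_mul, mul_comm]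
  congr! 3
  funext i
  simp [Pi.single_apply, eq_comm]

theorem edgeDual_eq_zero {t : P.TEdge → ℤ} (ht : edgeDual t = 0) :
    ∃ f : P.TVert → ℤ, ∀ e, t e = ∑ v : P.TVert, inc v.1 e * f v := by
  classical
  refine ⟨fun v => ∑ i, t i * bdSection (Pi.single v 1) i, fun e => ?_⟩
  have h := LinearMap.congr_fun ht (retraction (Pi.single e 1))
  rw [edgeDual_apply, coord_retraction] at h
  have h1 : bd (Pi.single e 1) = fun v : P.TVert => inc v.1 e := by
    funext v
    change ∑ e', inc v.1 e' * (Pi.single e 1 : P.TEdge → ℤ) e' = _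
    simp [Pi.single_apply]
  have h2 : bdSection (fun v : P.TVert => inc v.1 e) =
      ∑ v : P.TVert, inc v.1 e • bdSection (Pi.single v 1) := by
    rw [LinearMap.pi_apply_eq_sum_univ bdSection]
    refine Finset.sum_congr rfl fun v _ => ?_
    congr! 2
    funext w
    simp [Pi.single_apply, eq_comm]
  rw [h1, h2] at h
  simp only [Pi.sub_apply, mul_sub, Finset.sum_sub_distrib, Pi.single_apply, mul_ite, mul_one,
    mul_zero, Finset.sum_ite_eq', Finset.mem_univ, if_true, LinearMap.zero_apply,
    Finset.sum_apply, Pi.smul_apply, smul_eq_mul, sub_eq_zero] at h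
  rw [h]
  simp only [Finset.mul_sum]
  rw [Finset.sum_comm]
  refine Finset.sum_congr rfl fun v _ => Finset.sum_congr rfl fun i _ => ?_
  ring

end ForestPair


namespace BYForest

open ForestPair

variable {V : Type u} (T : BYForest V)

/-- The extension by zero of a function on the edges to the cells. -/
def edgeExtend (t : T.TEdge → ℤ) : T.TCell → ℤ := Sum.elim (fun _ => 0) t

theorem edgeExtend_inl (t : T.TEdge → ℤ) (v : T.TVert) : T.edgeExtend t (Sum.inl v) = 0 := rfl

theorem edgeExtend_inr (t : T.TEdge → ℤ) (e : T.TEdge) : T.edgeExtend t (Sum.inr e) = t e := rfl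

/-- The action of `εF` on the functions on the edges. -/
def edgeAct (t : T.TEdge → ℤ) (e : T.TEdge) : ℤ :=
  T.signedPerm.act ℤ (T.edgeExtend t) (Sum.inr e)

theorem edgeAct_edgePerm (t : T.TEdge → ℤ) (e : T.TEdge) :
    T.edgeAct t (T.edgePerm e) = (T.signedPerm.sgn (Sum.inr e) : ℤ) * t e :=
  T.signedPerm.act_apply_perm _ (Sum.inr e)

theorem act_elim (t : T.TEdge → ℤ) :
    T.signedPerm.act ℤ (T.edgeExtend t) = T.edgeExtend (T.edgeAct t) := by
  funext x
  rcases x with v | e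
  · obtain ⟨v, rfl⟩ := T.vertPerm.surjective v
    refine (T.signedPerm.act_apply_perm _ (Sum.inl v)).trans ?_
    rw [edgeExtend_inl, edgeExtend_inl, smul_zero]
  · rfl

theorem coord_chainMap (c : T.chains) (e : T.TEdge) :
    coord (T.chainMap c) (T.edgePerm e) = (T.signedPerm.sgn (Sum.inr e) : ℤ) * coord c e := by
  have hs : T.edgeSign e.tail e.head = T.sign (cellComponent (Sum.inr e)) := dif_pos e.offAdj
  change T.edgeSign _ _ * c.1 _ _ = ((T.sign (cellComponent (Sum.inr e)) * T.orient e : ℤˣ) : ℤ) *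
    c.1 e.tail e.head
  rcases T.orient_cases e with ⟨h1, h2, h3⟩ | ⟨h1, h2, h3⟩
  · rw [h1, h2, h3, T.F.symm_apply_apply, T.F.symm_apply_apply, hs, mul_one]
  · rw [h1, h2, h3, T.F.symm_apply_apply, T.F.symm_apply_apply, T.edgeSign_symm, hs,
      c.2.1 e.tail e.head]
    simp

/-- Rational functions on the cells obtained from integral functions on the edges. -/
def edgeToRat : (T.TEdge → ℤ) →ₗ[ℤ] (T.TCell → ℚ) where
  toFun t := Int.castAddHom ℚ ∘ T.edgeExtend t
  map_add' s t := by ext x; rcases x with v | e <;> simp [edgeExtend]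
  map_smul' n t := by ext x; rcases x with v | e <;> simp [edgeExtend]

theorem edgeToRat_apply (t : T.TEdge → ℤ) :
    T.edgeToRat t = Int.castAddHom ℚ ∘ T.edgeExtend t := rfl

variable [Fintype V]

theorem dualEquiv_edgeDual (t : T.TEdge → ℤ) :
    T.dualEquiv (edgeDual t) = edgeDual (T.edgeAct t) := by
  refine LinearMap.ext fun b => ?_
  obtain ⟨a, rfl⟩ := T.latticeEquiv.surjective b
  change edgeDual t (T.latticeEquiv.symm (T.latticeEquiv a)) = _
  rw [LinearEquiv.symm_apply_apply, edgeDual_apply, edgeDual_apply,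
    ← Equiv.sum_comp T.edgePerm fun e => T.edgeAct t e * _]
  refine Finset.sum_congr rfl fun e _ => ?_
  change _ = _ * coord (T.chainMap a.1) _
  rw [edgeAct_edgePerm, coord_chainMap]
  have := sign_mul_self (T.signedPerm.sgn (Sum.inr e))
  linear_combination (-(t e * coord a.1 e)) * this

/-- The Néron component group as a quotient of the group of functions on the edges. -/
def edgeToNeron : (T.TEdge → ℤ) →ₗ[ℤ] T.NeronGroup := (LinearMap.range T.toDual).mkQ ∘ₗ edgeDual

theorem edgeToNeron_surjective : Function.Surjective T.edgeToNeron :=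
  (Submodule.mkQ_surjective _).comp edgeDual_surjective

theorem neronMap_edgeToNeron (t : T.TEdge → ℤ) :
    T.neronMap (T.edgeToNeron t) = T.edgeToNeron (T.edgeAct t) :=
  congrArg (LinearMap.range T.toDual).mkQ (T.dualEquiv_edgeDual t)

theorem edgeToNeron_eq_zero_iff (t : T.TEdge → ℤ) :
    T.edgeToNeron t = 0 ↔ ∃ h : T.TCell → ℤ, matOp cellMat ℤ h = T.edgeExtend t := by
  have h0 : T.edgeToNeron t = 0 ↔ edgeDual t ∈ LinearMap.range T.toDual :=
    Submodule.Quotient.mk_eq_zero _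
  have hl : ∀ (a : T.Lattice), T.toDual a = edgeDual fun e => T.length e.1 * coord a.1 e := by
    intro a
    refine LinearMap.ext fun b => ?_
    rw [toDual_eq_sum, edgeDual_apply]
    exact Finset.sum_congr rfl fun e _ => by ring
  rw [h0]
  constructor
  · rintro ⟨a, ha⟩
    rw [hl, ← sub_eq_zero, ← map_sub] at ha
    obtain ⟨f, hf⟩ := edgeDual_eq_zero ha
    refine ⟨Sum.elim f (coord a.1), funext fun x => ?_⟩
    rcases x with v | e
    · rw [matOp_cellMat_inl]
      exact congrFun (bd_coord a) v
    · rw [matOp_cellMat_inr]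
      have := hf e
      simp only [Pi.sub_apply] at this
      simp only [Sum.elim_inl, Sum.elim_inr, smul_eq_mul]
      rw [← this, edgeExtend_inr]
      ring
  · rintro ⟨h, hh⟩
    have hb : bd (h ∘ Sum.inr) = 0 := by
      funext v
      have := congrFun hh (Sum.inl v)
      rwa [matOp_cellMat_inl] at this
    refine ⟨⟨mkChain (h ∘ Sum.inr), mkChain_mem hb⟩, ?_⟩
    rw [hl]
    refine LinearMap.ext fun b => ?_
    rw [edgeDual_apply, edgeDual_apply, ← sub_eq_zero, ← Finset.sum_sub_distrib]
    simp only [coord_mkChain]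
    have key : ∀ e : T.TEdge, T.length e.1 * (h ∘ Sum.inr) e * coord b.1 e - t e * coord b.1 e =
        ∑ v : T.TVert, h (Sum.inl v) * (inc v.1 e * coord b.1 e) := by
      intro e
      have := congrFun hh (Sum.inr e)
      rw [matOp_cellMat_inr] at this
      simp only [edgeExtend_inr, smul_eq_mul] at this
      rw [← this, ← sub_mul, Function.comp_apply, sub_sub_cancel, Finset.sum_mul]
      exact Finset.sum_congr rfl fun v _ => by ring
    rw [Finset.sum_congr rfl fun e _ => key e, Finset.sum_comm]
    refine Finset.sum_eq_zero fun v _ => ?_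
    rw [← Finset.mul_sum]
    exact mul_eq_zero_of_right _ (congrFun (bd_coord b) v)

theorem matOp_rat_bijective : Function.Bijective (matOp (cellMat (P := T.toForestPair)) ℚ) := by
  constructor
  · rw [← LinearMap.ker_eq_bot, LinearMap.ker_eq_bot']
    exact fun h hh => T.cellMat_nondeg 1 h (fun x hx => absurd (one_dvd _) hx)
      fun x _ => congrFun hh x
  · intro N
    obtain ⟨M, hM, -⟩ := T.cellSystem.exists_rat_solution 1 N
    exact ⟨M, funext fun x => hM x (one_dvd _)⟩

/-- The matrix of the cell system as an automorphism of the rational functions. -/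
def ratEquiv : (T.TCell → ℚ) ≃ₗ[ℤ] (T.TCell → ℚ) :=
  LinearEquiv.ofBijective _ T.matOp_rat_bijective

theorem ratEquiv_apply (h : T.TCell → ℚ) : T.ratEquiv h = matOp cellMat ℚ h := rfl

theorem toQZ_comp_int {X : Type u} (h : X → ℤ) : toQZ ∘ Int.castAddHom ℚ ∘ h = 0 :=
  funext fun x => toQZ_eq_zero_iff.2 ⟨h x, rfl⟩

/-- The kernel of the matrix on `ℚ/ℤ`-valued functions as a quotient of the group of functions on
the edges. -/
def edgeToKer : (T.TEdge → ℤ) →ₗ[ℤ] LinearMap.ker (matOp T.cellSystem.mat QZ) :=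
  LinearMap.codRestrict _
    (toQZ.toIntLinearMap.compLeft T.TCell ∘ₗ T.ratEquiv.symm.toLinearMap ∘ₗ T.edgeToRat)
    fun t => by
      change matOp cellMat QZ (toQZ ∘ T.ratEquiv.symm (T.edgeToRat t)) = 0
      rw [matOp_comp, ← ratEquiv_apply, LinearEquiv.apply_symm_apply]
      exact toQZ_comp_int _

theorem edgeToKer_coe (t : T.TEdge → ℤ) :
    (T.edgeToKer t).1 = toQZ ∘ T.ratEquiv.symm (T.edgeToRat t) := rfl

theorem edgeToKer_eq_zero_iff (t : T.TEdge → ℤ) :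
    T.edgeToKer t = 0 ↔ ∃ h : T.TCell → ℤ, matOp cellMat ℤ h = T.edgeExtend t := by
  have hinj : Function.Injective (Int.castAddHom ℚ) := Int.cast_injective
  have hker : T.edgeToKer t = 0 ↔ toQZ ∘ T.ratEquiv.symm (T.edgeToRat t) = 0 := by
    rw [← edgeToKer_coe]
    exact Subtype.ext_iff
  rw [hker]
  constructor
  · intro h
    have h1 : ∀ x, ∃ n : ℤ, (n : ℚ) = T.ratEquiv.symm (T.edgeToRat t) x := fun x =>
      toQZ_eq_zero_iff.1 (congrFun h x)
    choose n hn using h1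
    refine ⟨n, hinj.comp_left ?_⟩
    change Int.castAddHom ℚ ∘ _ = Int.castAddHom ℚ ∘ _
    rw [← matOp_comp, ← edgeToRat_apply, ← ratEquiv_apply, ← LinearEquiv.eq_symm_apply]
    exact funext hn
  · rintro ⟨h, hh⟩
    have : T.ratEquiv.symm (T.edgeToRat t) = Int.castAddHom ℚ ∘ h := by
      rw [LinearEquiv.symm_apply_eq, ratEquiv_apply, matOp_comp, hh, edgeToRat_apply]
    rw [this]
    exact toQZ_comp_int h

theorem edgeToKer_surjective : Function.Surjective T.edgeToKer := by
  rintro ⟨h, hh⟩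
  obtain ⟨q, rfl⟩ := toQZ_surjective.comp_left h
  have h1 : toQZ ∘ matOp cellMat ℚ q = 0 := by
    rw [← matOp_comp]
    exact hh
  choose n hn using fun x => toQZ_eq_zero_iff.1 (congrFun h1 x)
  obtain ⟨s, hs⟩ := bd_surjective (n ∘ Sum.inl)
  refine ⟨fun e => n (Sum.inr e) - T.length e.1 * s e, Subtype.ext ?_⟩
  rw [edgeToKer_coe]
  have h2 : T.ratEquiv.symm (T.edgeToRat fun e => n (Sum.inr e) - T.length e.1 * s e) =
      q - Int.castAddHom ℚ ∘ T.edgeExtend s := by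
    rw [LinearEquiv.symm_apply_eq, map_sub, ratEquiv_apply, ratEquiv_apply, matOp_comp]
    funext x
    rw [Pi.sub_apply, ← hn x, Function.comp_apply]
    rcases x with v | e
    · rw [matOp_cellMat_inl]
      have := congrFun hs v
      change ∑ e, inc v.1 e * s e = n (Sum.inl v) at this
      simp [edgeToRat_apply, ← this, edgeExtend]
    · rw [matOp_cellMat_inr]
      simp [edgeToRat_apply, edgeExtend]
  rw [h2]
  funext x
  have := congrFun (toQZ_comp_int (T.edgeExtend s)) x
  simp only [Function.comp_apply, Pi.zero_apply] at this
  simp only [Function.comp_apply, Pi.sub_apply, map_sub, this, sub_zero]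

theorem kerMap_edgeToKer (t : T.TEdge → ℤ) :
    T.cellSystem.kerMap (T.edgeToKer t) = T.edgeToKer (T.edgeAct t) := by
  refine Subtype.ext ?_
  change T.signedPerm.act QZ (toQZ ∘ T.ratEquiv.symm (T.edgeToRat t)) =
    toQZ ∘ T.ratEquiv.symm (T.edgeToRat (T.edgeAct t))
  rw [SignedPerm.act_comp]
  congr 1
  rw [LinearEquiv.eq_symm_apply, ratEquiv_apply, matOp_act T.cellMat_map, ← ratEquiv_apply,
    LinearEquiv.apply_symm_apply, edgeToRat_apply, edgeToRat_apply, SignedPerm.act_comp, act_elim]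

/-- The Néron component group is the kernel of the matrix on `ℚ/ℤ`-valued functions. -/
def neronEquiv : T.NeronGroup ≃ₗ[ℤ] LinearMap.ker (matOp T.cellSystem.mat QZ) :=
  (T.edgeToNeron.quotKerEquivOfSurjective T.edgeToNeron_surjective).symm ≪≫ₗ
    Submodule.quotEquivOfEq _ _ (by
      ext t
      rw [LinearMap.mem_ker, LinearMap.mem_ker, edgeToNeron_eq_zero_iff,
        edgeToKer_eq_zero_iff]) ≪≫ₗ
    T.edgeToKer.quotKerEquivOfSurjective T.edgeToKer_surjective

theorem neronEquiv_edgeToNeron (t : T.TEdge → ℤ) :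
    T.neronEquiv (T.edgeToNeron t) = T.edgeToKer t := by
  have : (T.edgeToNeron.quotKerEquivOfSurjective T.edgeToNeron_surjective).symm (T.edgeToNeron t) =
      Submodule.Quotient.mk t := by
    rw [LinearEquiv.symm_apply_eq]
    rfl
  simp only [neronEquiv, LinearEquiv.trans_apply, this]
  rfl

theorem isFixpointRegular_neronMap : IsFixpointRegular T.neronMap := by
  refine isFixpointRegular_of_grRegular fun d _ => ?_
  refine GrRegular.of_equiv T.neronEquiv (fun a => ?_) (T.cellSystem.grRegular_kerMap d)
  obtain ⟨t, rfl⟩ := T.edgeToNeron_surjective a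
  rw [neronMap_edgeToNeron, neronEquiv_edgeToNeron, neronEquiv_edgeToNeron, kerMap_edgeToKer]

end BYForest

end BYTheory

end

theorem mainTheorem8 {V : Type u} [Fintype V] (T : BYTheory.BYForest V)
    (hB : T.ParityB) : BYTheory.IsFixpointRegular T.neronMap :=
  T.isFixpointRegular_neronMap
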